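/- Let $U=[0,1]^3$ with periodic boundary conditions (the flat torus of volume $1$), let $0<T<\infty$, and let $0\le f_0\in L^1(U\times\mathbb R^3)$ and $0\le g_0\in L^1(\mathbb R^3)$ be probability densities with $$\int_{U\times\mathbb R^3} f_0(x,v)(1+|v|^2)\,dx\,dv<\infty,\qquad \int_{\mathbb R^3} g_0(v)(1+|v|^2)\,dv<\infty,\qquad \operatorname*{ess\,sup}_{v\in\mathbb R^3} g_0(v)(1+|v|^{3+\eta})<\infty$$ for some $\eta>0$ (for instance $\eta=1$). For $f\in L^1(U\times\mathbb R^3)$ define the gain and loss terms $$Q^+[f](x,v)=\int_{\mathbb S^2}\int_{\mathbb R^3} f(x,v')\,g_0(\bar v')\,[(v-\bar v)\cdot\nu]_+\,d\bar v\,d\nu,\qquad Q^-[f](x,v)=f(x,v)\int_{\mathbb S^2}\int_{\mathbb R^3} g_0(\bar v)\,[(v-\bar v)\cdot\nu]_+\,d\bar v\,d\nu,$$ where $v'=v+\nu\cdot(\bar v-v)\,\nu$ and $\bar v'=\bar v-\nu\cdot(\bar v-v)\,\nu$. Let $Af=-v\cdot\partial_x f-Q^-[f]$, in the sense of distributions on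 $U\times\mathbb R^3$, with domain $D(A)=\{f\in L^1(U\times\mathbb R^3): v\cdot\partial_x f+Q^-[f]\in L^1(U\times\mathbb R^3)\}$; let $Bf=Q^+[f]$ with domain $D(B)=\{f\in L^1(U\times\mathbb R^3): Q^+[f]\in L^1(U\times\mathbb R^3)\}$; and let $A+B$ have domain $D(A)\cap D(B)$. For an operator $L:D(L)\subset L^1(U\times\mathbb R^3)\to L^1(U\times\mathbb R^3)$, a mild solution on $[0,T]$ of $\partial_t u=Lu$, $u(0)=u_0$, is a Bochner integrable function $u:[0,T]\to L^1(U\times\mathbb R^3)$ such that for all $t\in[0,T]$ $$\int_0^t u(\theta)\,d\theta\in D(L)\quad\text{and}\quad L\int_0^t u(\theta)\,d\theta=u(t)-u_0 .$$ Then the linear Boltzmann equation $$\partial_t f_t=-v\cdot\partial_x f_t+Q^+[f_t]-Q^-[f_t]=(A+B)f_t,\qquad f_{t=0}=f_0,$$ has a unique mild solution $f:[0,T]\to L^1(U\times\mathbb R^3)$. More precisely, $A+B$ is closable, there is a mild solution $f$ for $L=A+B$, it is continuous in time, and every mild solution for $L=\overline{A+B}$ (in particular every mild solution for $L=A+B$)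 with initial value $f_0$ coincides with $f$ on $[0,T]$. Moreover, for every $t\in[0,T]$, $$f_t\ge 0\ \text{a.e.},\qquad \int_{U\times\mathbb R^3} f_t(x,v)\,dx\,dv=1,\qquad \int_{U\times\mathbb R^3} f_t(x,v)(1+|v|)\,dx\,dv<\infty,\qquad f_t\in D(B).$$ -/

import Mathlib

open MeasureTheory Set
open scoped ContDiff

noncomputable section

namespace LinBoltz

/-- Velocity space `ℝ³` with its Euclidean norm. -/
abbrev Vel := EuclideanSpace ℝ (Fin 3)

/-- `U = [0,1]³` with periodic boundary conditions: the flat torus, of total volume one. -/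
abbrev Torus := Fin 3 → UnitAddCircle

/-- The phase space `U × ℝ³`, with the product of the Lebesgue measures. -/
abbrev Phase := Torus × Vel

/-- The Banach space `L¹(U × ℝ³)`. -/
abbrev L1Phase := Lp ℝ 1 (volume : Measure Phase)

/-- The Banach space `L¹(ℝ³)`. -/
abbrev L1Vel := Lp ℝ 1 (volume : Measure Vel)

/-- The unit sphere `𝕊²`. -/
abbrev Sph := Metric.sphere (0 : Vel) 1

/-- The surface measure `dν` on `𝕊²` (of total mass `4π`). -/
abbrev sphMeasure : Measure Sph := (volume : Measure Vel).toSphere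

/-- The measure `dv̄ dν` on `𝕊² × ℝ³`. -/
abbrev collMeasure : Measure (Sph × Vel) := sphMeasure.prod volume

instance : IsFiniteMeasure sphMeasure := inferInstance

instance : SFinite sphMeasure := inferInstance

instance : SFinite collMeasure := inferInstance

/-! ### Test functions on the torus and the streaming derivative -/

/-- The covering map `ℝ³ → U`. -/
def torusProj (y : Fin 3 → ℝ) : Torus := fun i => (y i : UnitAddCircle)

/-- The covering map `ℝ³ × ℝ³ → U × ℝ³`. -/
def cover (p : (Fin 3 → ℝ) × Vel) : Phase := (torusProj p.1, p.2)

/-- Test functions: smooth compactly supported functions on `U × ℝ³`; smoothness is smoothness of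
the lift to the universal cover. -/
def IsTestFunction (φ : Phase → ℝ) : Prop :=
  ContDiff ℝ ∞ (fun p => φ (cover p)) ∧ HasCompactSupport φ

/-- `(v · ∂ₓ φ)(x, v)`, the derivative of `s ↦ φ(x + s v, v)` at `s = 0`. -/
def streamDeriv (φ : Phase → ℝ) (z : Phase) : ℝ :=
  deriv (fun s : ℝ => φ (z.1 + torusProj (fun i => s * z.2 i), z.2)) 0

lemma isOpenQuotientMap_cover : IsOpenQuotientMap cover := by
  have h1 : IsOpenQuotientMap torusProj :=
    IsOpenQuotientMap.piMap (f := fun (_ : Fin 3) (y : ℝ) => (y : UnitAddCircle))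
      (fun _ => QuotientAddGroup.isOpenQuotientMap_mk)
  exact h1.prodMap IsOpenQuotientMap.id

lemma continuous_cover : Continuous cover := isOpenQuotientMap_cover.continuous

lemma torusProj_add (y y' : Fin 3 → ℝ) : torusProj (y + y') = torusProj y + torusProj y' := by
  funext i
  simp [torusProj]

lemma IsTestFunction.continuous {φ : Phase → ℝ} (h : IsTestFunction φ) : Continuous φ :=
  isOpenQuotientMap_cover.isQuotientMap.continuous_iff.2 h.1.continuous

lemma streamDeriv_cover {φ : Phase → ℝ} (h : IsTestFunction φ) (p : (Fin 3 → ℝ) × Vel) :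
    streamDeriv φ (cover p) =
      fderiv ℝ (fun q => φ (cover q)) p ((fun i => p.2 i), 0) := by
  have hd : HasFDerivAt (fun q => φ (cover q)) (fderiv ℝ (fun q => φ (cover q)) p) p :=
    (h.1.differentiable (by simp) p).hasFDerivAt
  have hc : HasDerivAt (fun s : ℝ => p + s • (((fun i => p.2 i), 0) : (Fin 3 → ℝ) × Vel))
      ((fun i => p.2 i), 0) 0 := by
    simpa using ((hasDerivAt_id (0 : ℝ)).smul_const
      (((fun i => p.2 i), 0) : (Fin 3 → ℝ) × Vel)).const_add p
  have hd' : HasFDerivAt (fun q => φ (cover q)) (fderiv ℝ (fun q => φ (cover q)) p)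
      (p + (0 : ℝ) • (((fun i => p.2 i), 0) : (Fin 3 → ℝ) × Vel)) := by simpa using hd
  have := (hd'.comp_hasDerivAt (0 : ℝ) hc).deriv
  rw [← this]
  unfold streamDeriv
  congr 1
  funext s
  simp only [cover, Function.comp, Prod.fst_add, Prod.snd_add, Prod.smul_fst, Prod.smul_snd,
    torusProj_add, smul_zero, add_zero]
  rfl

lemma IsTestFunction.continuous_streamDeriv {φ : Phase → ℝ} (h : IsTestFunction φ) :
    Continuous (streamDeriv φ) := by
  refine isOpenQuotientMap_cover.isQuotientMap.continuous_iff.2 ?_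
  have : streamDeriv φ ∘ cover = fun p : (Fin 3 → ℝ) × Vel =>
      fderiv ℝ (fun q => φ (cover q)) p ((fun i => p.2 i), 0) := by
    funext p
    exact streamDeriv_cover h p
  rw [this]
  exact (h.1.continuous_fderiv (by simp)).clm_apply (by fun_prop)

lemma IsTestFunction.hasCompactSupport_streamDeriv {φ : Phase → ℝ} (h : IsTestFunction φ) :
    HasCompactSupport (streamDeriv φ) := by
  have hK : IsCompact ((univ : Set Torus) ×ˢ (Prod.snd '' tsupport φ)) :=
    isCompact_univ.prod (h.2.isCompact.image continuous_snd)
  refine HasCompactSupport.intro hK ?_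
  rintro ⟨x, v⟩ hz
  have : (fun s : ℝ => φ (x + torusProj (fun i => s * v i), v)) = fun _ => 0 := by
    funext s
    apply image_eq_zero_of_notMem_tsupport
    intro hs
    exact hz ⟨mem_univ _, _, hs, rfl⟩
  simp [streamDeriv, this]

lemma integrable_mul_test {f : Phase → ℝ} (hf : LocallyIntegrable f volume) {φ : Phase → ℝ}
    (h : Continuous φ) (h' : HasCompactSupport φ) : Integrable (fun z => f z * φ z) volume := by
  have := hf.integrable_smul_left_of_hasCompactSupport h h'
  refine this.congr (Filter.Eventually.of_forall fun z => ?_)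
  simp [mul_comm]

lemma locallyIntegrable_coe (f : L1Phase) : LocallyIntegrable f volume :=
  (L1.integrable_coeFn f).locallyIntegrable

/-! ### Test functions separate the elements of `L¹` -/

/-- The open unit cube times velocity space, a fundamental domain up to a null set. -/
def cell : Set ((Fin 3 → ℝ) × Vel) := (univ.pi fun _ => Ioo (0 : ℝ) 1) ×ˢ univ

lemma isOpen_cell : IsOpen cell :=
  (isOpen_set_pi finite_univ fun _ _ => isOpen_Ioo).prod isOpen_univ

lemma measurePreserving_cover : MeasurePreserving cover (volume.restrict cell) volume := by
  have h1 : MeasurePreserving ((↑) : ℝ → UnitAddCircle) (volume.restrict (Ioo (0 : ℝ) 1))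
      volume := by
    have := UnitAddCircle.measurePreserving_mk 0
    rwa [zero_add, ← restrict_Ioo_eq_restrict_Ioc] at this
  have h2 := measurePreserving_pi (ι := Fin 3) (fun _ => volume.restrict (Ioo (0 : ℝ) 1))
    (fun _ => (volume : Measure UnitAddCircle)) (fun _ => h1)
  have h3 := h2.prod (MeasurePreserving.id (volume : Measure Vel))
  rw [← Measure.restrict_pi_pi] at h3
  have h4 : ((Measure.pi fun _ : Fin 3 => (volume : Measure ℝ)).restrict
      (univ.pi fun _ => Ioo (0 : ℝ) 1)).prod (volume : Measure Vel)
      = (volume : Measure ((Fin 3 → ℝ) × Vel)).restrict cell := by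
    conv_lhs => rw [← Measure.restrict_univ (μ := (volume : Measure Vel))]
    rw [Measure.prod_restrict]
    rfl
  rw [h4] at h3
  exact h3

/-- The inverse of the covering map on the cell. -/
def cellRep (z : Phase) : (Fin 3 → ℝ) × Vel :=
  (fun i => (AddCircle.equivIoc (1 : ℝ) 0 (z.1 i) : ℝ), z.2)

lemma cellRep_cover {p : (Fin 3 → ℝ) × Vel} (hp : p ∈ cell) : cellRep (cover p) = p := by
  refine Prod.ext ?_ rfl
  funext i
  have hi : p.1 i ∈ Ioo (0 : ℝ) 1 := hp.1 i (mem_univ i)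
  have := AddCircle.equivIoc_coe_of_mem (p := (1 : ℝ)) (a := 0) (y := p.1 i)
    ⟨hi.1, by simpa using hi.2.le⟩
  simp only [cellRep, cover, torusProj]
  rw [this]

lemma isTestFunction_cellRep {ψ : (Fin 3 → ℝ) × Vel → ℝ} (hψ : ContDiff ℝ ∞ ψ)
    (hc : HasCompactSupport ψ) (hs : tsupport ψ ⊆ cell) :
    IsTestFunction (fun z => ψ (cellRep z)) := by
  have hcov : ∀ z, cover (cellRep z) = z := by
    intro z
    refine Prod.ext ?_ rfl
    funext i
    simp only [cellRep, cover, torusProj]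
    exact (AddCircle.equivIoc (1 : ℝ) 0).symm_apply_apply (z.1 i)
  have hK : IsCompact (cover '' tsupport ψ) := hc.isCompact.image continuous_cover
  have hzero : ∀ z, z ∉ cover '' tsupport ψ → ψ (cellRep z) = 0 := by
    intro z hz
    apply image_eq_zero_of_notMem_tsupport
    intro h
    exact hz ⟨_, h, hcov z⟩
  refine ⟨?_, HasCompactSupport.intro hK hzero⟩
  rw [contDiff_iff_contDiffAt]
  intro p
  by_cases hp : cover p ∈ cover '' tsupport ψ
  · obtain ⟨q, hq, hqp⟩ := hp
    have hcont : ContDiff ℝ ∞ (fun p' : (Fin 3 → ℝ) × Vel => p' + (q - p)) := by fun_prop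
    have hper : ∀ p', cover (p' + (q - p)) = cover p' := by
      intro p'
      have h1 : torusProj q.1 = torusProj p.1 := congrArg (fun z : Phase => z.1) hqp
      have h2 : q.2 = p.2 := congrArg (fun z : Phase => z.2) hqp
      refine Prod.ext ?_ (by simp [cover, h2])
      have h3 : torusProj (q.1 - p.1) = 0 := by
        have := torusProj_add (q.1 - p.1) p.1
        rw [sub_add_cancel, h1] at this
        exact left_eq_add.1 (this.trans (add_comm _ _))
      simp [cover, torusProj_add, h3]
    have hev : ∀ᶠ p' in nhds p, p' + (q - p) ∈ cell := by
      apply hcont.continuous.continuousAt.eventually_mem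
      apply isOpen_cell.mem_nhds
      simpa using hs hq
    refine ((hψ.comp hcont).contDiffAt (x := p)).congr_of_eventuallyEq ?_
    filter_upwards [hev] with p' hp'
    simp only [Function.comp]
    rw [← hper p', cellRep_cover hp']
  · have hev : ∀ᶠ p' in nhds p, cover p' ∉ cover '' tsupport ψ :=
      continuous_cover.continuousAt.eventually_mem (hK.isClosed.isOpen_compl.mem_nhds hp)
    refine (contDiffAt_const (c := (0 : ℝ))).congr_of_eventuallyEq ?_
    filter_upwards [hev] with p' hp'
    exact hzero _ hp'

lemma eq_zero_of_integral_test (h : L1Phase)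
    (hh : ∀ φ, IsTestFunction φ → ∫ z, h z * φ z = 0) : h = 0 := by
  have hmp := measurePreserving_cover
  have hint : IntegrableOn (fun p => h (cover p)) cell volume :=
    hmp.integrable_comp_of_integrable (L1.integrable_coeFn h)
  have key : ∀ᵐ p ∂(volume : Measure ((Fin 3 → ℝ) × Vel)), p ∈ cell → h (cover p) = 0 := by
    refine isOpen_cell.ae_eq_zero_of_integral_contDiff_smul_eq_zero
      hint.locallyIntegrableOn ?_
    intro ψ hψ hc hs
    have ht := isTestFunction_cellRep hψ hc hs
    have h0 := hh _ ht
    have hF : AEStronglyMeasurable (fun z => h z * ψ (cellRep z)) (volume : Measure Phase) :=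
      (Lp.aestronglyMeasurable h).mul ht.continuous.aestronglyMeasurable
    have h1 : ∀ F : Phase → ℝ, AEStronglyMeasurable F volume →
        ∫ z, F z = ∫ p in cell, F (cover p) := by
      intro F hF
      rw [← hmp.map_eq] at hF ⊢
      exact integral_map hmp.measurable.aemeasurable hF
    rw [h1 _ hF] at h0
    · rw [← setIntegral_eq_integral_of_forall_compl_eq_zero (s := cell), ← h0]
      · refine setIntegral_congr_fun isOpen_cell.measurableSet ?_
        intro p hp
        simp only [smul_eq_mul]
        rw [cellRep_cover hp, mul_comm]
      · intro p hp
        rw [image_eq_zero_of_notMem_tsupport (fun hm => hp (hs hm)), zero_smul]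
  have key2 : ∀ᵐ p ∂((volume : Measure ((Fin 3 → ℝ) × Vel)).restrict cell),
      h (cover p) = 0 := by
    rwa [ae_restrict_iff' isOpen_cell.measurableSet]
  have key3 : ∀ᵐ z ∂(volume : Measure Phase), h z = 0 := by
    have h1 : MeasurableSet {z | h z = 0} :=
      (Lp.stronglyMeasurable h).measurable (measurableSet_singleton 0)
    have h2 := (ae_map_iff hmp.measurable.aemeasurable h1).2 key2
    rwa [hmp.map_eq] at h2
  exact (Lp.eq_zero_iff_ae_eq_zero).2 key3

/-! ### The loss term and the operator `A` -/

/-- `[(v - v̄) · ν]₊` -/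
def collKernel (v : Vel) (p : Sph × Vel) : ℝ := max (inner ℝ (v - p.2) (p.1 : Vel)) 0

/-- The collision frequency `∫_{𝕊²} ∫_{ℝ³} g(v̄) [(v - v̄) · ν]₊ dv̄ dν`. -/
def collRate (g : L1Vel) (v : Vel) : ℝ := ∫ p, g p.2 * collKernel v p ∂collMeasure

/-- The loss term `Q⁻[f]`. -/
def loss (g : L1Vel) (f : L1Phase) (z : Phase) : ℝ := f z * collRate g z.2

/-- `h = -v · ∂ₓ f - Q⁻[f]` in the sense of distributions on `U × ℝ³`. -/
def IsTransportLoss (g : L1Vel) (f h : L1Phase) : Prop :=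
  LocallyIntegrable (loss g f) volume ∧
    ∀ φ, IsTestFunction φ →
      (∫ z, f z * streamDeriv φ z) - ∫ z, loss g f z * φ z = ∫ z, h z * φ z

lemma loss_add (g : L1Vel) (f f' : L1Phase) :
    loss g (f + f') =ᵐ[volume] fun z => loss g f z + loss g f' z := by
  filter_upwards [Lp.coeFn_add f f'] with z hz
  simp only [loss, hz, Pi.add_apply, add_mul]

lemma loss_smul (g : L1Vel) (c : ℝ) (f : L1Phase) :
    loss g (c • f) =ᵐ[volume] fun z => c * loss g f z := by
  filter_upwards [Lp.coeFn_smul c f] with z hz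
  simp only [loss, hz, Pi.smul_apply, smul_eq_mul, mul_assoc]

lemma IsTransportLoss.add {g : L1Vel} {f f' h h' : L1Phase} (H : IsTransportLoss g f h)
    (H' : IsTransportLoss g f' h') : IsTransportLoss g (f + f') (h + h') := by
  refine ⟨(locallyIntegrable_congr (loss_add g f f')).2 (H.1.add H'.1), fun φ hφ => ?_⟩
  have e1 : ∫ z, (f + f') z * streamDeriv φ z
      = (∫ z, f z * streamDeriv φ z) + ∫ z, f' z * streamDeriv φ z := by
    rw [← integral_add
      (integrable_mul_test (locallyIntegrable_coe f) hφ.continuous_streamDeriv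
        hφ.hasCompactSupport_streamDeriv)
      (integrable_mul_test (locallyIntegrable_coe f') hφ.continuous_streamDeriv
        hφ.hasCompactSupport_streamDeriv)]
    refine integral_congr_ae ?_
    filter_upwards [Lp.coeFn_add f f'] with z hz
    simp only [hz, Pi.add_apply, add_mul]
  have e2 : ∫ z, loss g (f + f') z * φ z
      = (∫ z, loss g f z * φ z) + ∫ z, loss g f' z * φ z := by
    rw [← integral_add (integrable_mul_test H.1 hφ.continuous hφ.2)
      (integrable_mul_test H'.1 hφ.continuous hφ.2)]
    refine integral_congr_ae ?_
    filter_upwards [loss_add g f f'] with z hz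
    simp only [hz, add_mul]
  have e3 : ∫ z, (h + h') z * φ z = (∫ z, h z * φ z) + ∫ z, h' z * φ z := by
    rw [← integral_add (integrable_mul_test (locallyIntegrable_coe h) hφ.continuous hφ.2)
      (integrable_mul_test (locallyIntegrable_coe h') hφ.continuous hφ.2)]
    refine integral_congr_ae ?_
    filter_upwards [Lp.coeFn_add h h'] with z hz
    simp only [hz, Pi.add_apply, add_mul]
  have a := H.2 φ hφ
  have b := H'.2 φ hφ
  rw [e1, e2, e3]
  linarith

lemma IsTransportLoss.smul {g : L1Vel} {f h : L1Phase} (c : ℝ) (H : IsTransportLoss g f h) :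
    IsTransportLoss g (c • f) (c • h) := by
  refine ⟨(locallyIntegrable_congr (loss_smul g c f)).2 (H.1.smul c), fun φ hφ => ?_⟩
  have e1 : ∫ z, (c • f) z * streamDeriv φ z = c * ∫ z, f z * streamDeriv φ z := by
    rw [← integral_const_mul]
    refine integral_congr_ae ?_
    filter_upwards [Lp.coeFn_smul c f] with z hz
    simp only [hz, Pi.smul_apply, smul_eq_mul, mul_assoc]
  have e2 : ∫ z, loss g (c • f) z * φ z = c * ∫ z, loss g f z * φ z := by
    rw [← integral_const_mul]
    refine integral_congr_ae ?_
    filter_upwards [loss_smul g c f] with z hz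
    simp only [hz, mul_assoc]
  have e3 : ∫ z, (c • h) z * φ z = c * ∫ z, h z * φ z := by
    rw [← integral_const_mul]
    refine integral_congr_ae ?_
    filter_upwards [Lp.coeFn_smul c h] with z hz
    simp only [hz, Pi.smul_apply, smul_eq_mul, mul_assoc]
  rw [e1, e2, e3, ← H.2 φ hφ]
  ring

lemma IsTransportLoss.unique {g : L1Vel} {f h h' : L1Phase} (H : IsTransportLoss g f h)
    (H' : IsTransportLoss g f h') : h = h' := by
  rw [← sub_eq_zero]
  refine eq_zero_of_integral_test _ fun φ hφ => ?_
  have e : ∫ z, (h - h') z * φ z = (∫ z, h z * φ z) - ∫ z, h' z * φ z := by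
    rw [← integral_sub (integrable_mul_test (locallyIntegrable_coe h) hφ.continuous hφ.2)
      (integrable_mul_test (locallyIntegrable_coe h') hφ.continuous hφ.2)]
    refine integral_congr_ae ?_
    filter_upwards [Lp.coeFn_sub h h'] with z hz
    simp only [hz, Pi.sub_apply, sub_mul]
  rw [e, ← H.2 φ hφ, ← H'.2 φ hφ, sub_self]

lemma isTransportLoss_zero (g : L1Vel) : IsTransportLoss g 0 0 := by
  have h0 : loss g 0 =ᵐ[volume] fun _ => (0 : ℝ) := by
    filter_upwards [Lp.coeFn_zero ℝ 1 (volume : Measure Phase)] with z hz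
    simp only [loss, hz, Pi.zero_apply, zero_mul]
  have h1 : ∀ F : Phase → ℝ, ∫ z, (0 : L1Phase) z * F z = 0 := by
    intro F
    refine integral_eq_zero_of_ae ?_
    filter_upwards [Lp.coeFn_zero ℝ 1 (volume : Measure Phase)] with z hz
    simp only [hz, Pi.zero_apply, zero_mul]
  refine ⟨(locallyIntegrable_congr h0).2 locallyIntegrable_zero, fun φ _ => ?_⟩
  have h2 : ∫ z, loss g 0 z * φ z = 0 := by
    refine integral_eq_zero_of_ae ?_
    filter_upwards [h0] with z hz
    simp only [hz, Pi.zero_apply, zero_mul]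
  rw [h1, h1, h2, sub_zero]

/-- The operator `A f = -v · ∂ₓ f - Q⁻[f]` (derivative in the sense of distributions), with its
maximal domain `D(A) = {f ∈ L¹ : v · ∂ₓ f + Q⁻[f] ∈ L¹}`. -/
def opA (g : L1Vel) : L1Phase →ₗ.[ℝ] L1Phase where
  domain :=
    { carrier := {f | ∃ h, IsTransportLoss g f h}
      add_mem' := fun ⟨_, h⟩ ⟨_, h'⟩ => ⟨_, h.add h'⟩
      zero_mem' := ⟨0, isTransportLoss_zero g⟩
      smul_mem' := fun c _ ⟨_, h⟩ => ⟨_, h.smul c⟩ }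
  toFun :=
    { toFun := fun f => f.2.choose
      map_add' := fun f f' =>
        (f + f').2.choose_spec.unique (f.2.choose_spec.add f'.2.choose_spec)
      map_smul' := fun c f => (c • f).2.choose_spec.unique (f.2.choose_spec.smul c) }

lemma opA_graph {g : L1Vel} {f h : L1Phase} :
    (f, h) ∈ (opA g).graph ↔ IsTransportLoss g f h := by
  rw [LinearPMap.mem_graph_iff]
  constructor
  · rintro ⟨y, rfl, rfl⟩
    exact y.2.choose_spec
  · intro H
    have hf : f ∈ (opA g).domain := ⟨h, H⟩
    exact ⟨⟨f, hf⟩, rfl, (Exists.choose_spec hf).unique H⟩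

/-! ### The gain term and the operator `B` -/

/-- The pre-collisional velocity `v' = v + ν · (v̄ - v) ν` of the tagged particle. -/
def preVel (v : Vel) (p : Sph × Vel) : Vel :=
  v + (inner ℝ (p.1 : Vel) (p.2 - v)) • (p.1 : Vel)

/-- The pre-collisional velocity `v̄' = v̄ - ν · (v̄ - v) ν` of the background particle. -/
def preVelBar (v : Vel) (p : Sph × Vel) : Vel :=
  p.2 - (inner ℝ (p.1 : Vel) (p.2 - v)) • (p.1 : Vel)

/-- The integrand `f(x, v') g(v̄') [(v - v̄) · ν]₊` of the gain term at `z = (x, v)`. -/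
def gainIntegrand (g : L1Vel) (f : L1Phase) (z : Phase) (p : Sph × Vel) : ℝ :=
  f (z.1, preVel z.2 p) * g (preVelBar z.2 p) * collKernel z.2 p

/-- The gain term `Q⁺[f]`. -/
def gain (g : L1Vel) (f : L1Phase) (z : Phase) : ℝ := ∫ p, gainIntegrand g f z p ∂collMeasure

/-- `Q⁺[f] ∈ L¹(U × ℝ³)`: the integral defining `Q⁺[f](x, v)` converges for almost every `(x, v)`
and the result is integrable. -/
def GainIntegrable (g : L1Vel) (f : L1Phase) : Prop :=
  (∀ᵐ z ∂(volume : Measure Phase), Integrable (gainIntegrand g f z) collMeasure) ∧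
    Integrable (gain g f) volume

/-- For fixed `ν`, the collision map `(v, v̄) ↦ (v', v̄')`. -/
def collMap (ν : Vel) : (Vel × Vel) →ₗ[ℝ] (Vel × Vel) where
  toFun q := (q.1 + (inner ℝ ν (q.2 - q.1)) • ν, q.2 - (inner ℝ ν (q.2 - q.1)) • ν)
  map_add' q q' := by
    refine Prod.ext ?_ ?_ <;>
    · simp only [Prod.fst_add, Prod.snd_add, inner_add_right, inner_sub_right]
      module
  map_smul' c q := by
    refine Prod.ext ?_ ?_ <;>
    · simp only [Prod.smul_fst, Prod.smul_snd, inner_smul_right, inner_sub_right, RingHom.id_apply]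
      module

lemma quasiMeasurePreserving_collMap (ν : Sph) :
    Measure.QuasiMeasurePreserving (collMap (ν : Vel))
      ((volume : Measure Vel).prod volume) ((volume : Measure Vel).prod volume) := by
  have hν : inner ℝ (ν : Vel) (ν : Vel) = (1 : ℝ) := by
    rw [real_inner_self_eq_norm_sq, norm_eq_of_mem_sphere]
    norm_num
  have hinv : collMap (ν : Vel) ∘ₗ collMap (ν : Vel) = LinearMap.id := by
    refine LinearMap.ext fun q => Prod.ext ?_ ?_ <;>
    · simp only [collMap, LinearMap.comp_apply, LinearMap.coe_mk, AddHom.coe_mk, LinearMap.id_apply,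
        inner_add_right, inner_sub_right, inner_smul_right, hν]
      module
  refine Measure.LinearMap.quasiMeasurePreserving _ _ fun h0 => ?_
  have := congrArg LinearMap.det hinv
  rw [LinearMap.det_comp, h0, LinearMap.det_id] at this
  norm_num at this

lemma measurable_preVel : Measurable fun q : Vel × (Sph × Vel) => preVel q.1 q.2 := by
  unfold preVel
  fun_prop

lemma ae_preVel {P : Phase → Prop} (hP : MeasurableSet {z | P z})
    (h : ∀ᵐ z ∂(volume : Measure Phase), P z) :
    ∀ᵐ z ∂(volume : Measure Phase), ∀ᵐ p ∂collMeasure, P (z.1, preVel z.2 p) := by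
  have hx : ∀ᵐ x ∂(volume : Measure Torus), ∀ᵐ v ∂(volume : Measure Vel), P (x, v) :=
    Measure.ae_ae_of_ae_prod h
  have hmx : ∀ x : Torus, MeasurableSet {q : Vel × (Sph × Vel) | P (x, preVel q.1 q.2)} :=
    fun x => measurableSet_preimage (measurable_const.prodMk measurable_preVel) hP
  have main : ∀ᵐ x ∂(volume : Measure Torus), ∀ᵐ q ∂(volume : Measure Vel).prod collMeasure,
      P (x, preVel q.1 q.2) := by
    filter_upwards [hx] with x hxx
    have h1 : ∀ ν : Sph, ∀ᵐ q ∂((volume : Measure Vel).prod volume), P (x, preVel q.1 (ν, q.2)) :=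
      fun ν => (Measure.quasiMeasurePreserving_fst.comp
        (quasiMeasurePreserving_collMap ν)).ae hxx
    have h2 : ∀ᵐ q ∂sphMeasure.prod ((volume : Measure Vel).prod (volume : Measure Vel)),
        P (x, preVel q.2.1 (q.1, q.2.2)) := by
      rw [Measure.ae_prod_iff_ae_ae]
      · exact Filter.Eventually.of_forall h1
      · exact (measurable_snd.fst.prodMk (measurable_fst.prodMk measurable_snd.snd)) (hmx x)
    have h3 : MeasurePreserving (fun q : Vel × (Sph × Vel) => (q.2.1, (q.1, q.2.2)))
        ((volume : Measure Vel).prod collMeasure)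
        (sphMeasure.prod ((volume : Measure Vel).prod (volume : Measure Vel))) := by
      have a := (measurePreserving_prodAssoc (volume : Measure Vel) sphMeasure
        (volume : Measure Vel)).symm MeasurableEquiv.prodAssoc
      have b := (Measure.measurePreserving_swap (μ := (volume : Measure Vel))
        (ν := sphMeasure)).prod (MeasurePreserving.id (volume : Measure Vel))
      have c := measurePreserving_prodAssoc sphMeasure (volume : Measure Vel)
        (volume : Measure Vel)
      exact c.comp (b.comp a)
    exact h3.quasiMeasurePreserving.ae h2
  have main2 : ∀ᵐ q ∂(volume : Measure Torus).prod ((volume : Measure Vel).prod collMeasure),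
      P (q.1, preVel q.2.1 q.2.2) := by
    rw [Measure.ae_prod_iff_ae_ae]
    · exact main
    · exact (measurable_fst.prodMk (measurable_preVel.comp measurable_snd)) hP
  have main3 := (measurePreserving_prodAssoc (volume : Measure Torus) (volume : Measure Vel)
    collMeasure).quasiMeasurePreserving.ae main2
  exact Measure.ae_ae_of_ae_prod main3

lemma gainIntegrand_add (g : L1Vel) (f f' : L1Phase) :
    ∀ᵐ z ∂(volume : Measure Phase), gainIntegrand g (f + f') z =ᵐ[collMeasure]
      fun p => gainIntegrand g f z p + gainIntegrand g f' z p := by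
  have hm : MeasurableSet {z | (f + f') z = f z + f' z} :=
    measurableSet_eq_fun (Lp.stronglyMeasurable _).measurable
      ((Lp.stronglyMeasurable f).measurable.add (Lp.stronglyMeasurable f').measurable)
  filter_upwards [ae_preVel hm (Lp.coeFn_add f f')] with z hz
  filter_upwards [hz] with p hp
  simp only [gainIntegrand, hp]
  ring

lemma gainIntegrand_smul (g : L1Vel) (c : ℝ) (f : L1Phase) :
    ∀ᵐ z ∂(volume : Measure Phase), gainIntegrand g (c • f) z =ᵐ[collMeasure]
      fun p => c * gainIntegrand g f z p := by
  have hm : MeasurableSet {z | (c • f) z = c * f z} :=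
    measurableSet_eq_fun (Lp.stronglyMeasurable _).measurable
      ((Lp.stronglyMeasurable f).measurable.const_mul c)
  filter_upwards [ae_preVel hm (Lp.coeFn_smul c f)] with z hz
  filter_upwards [hz] with p hp
  simp only [gainIntegrand, hp]
  ring

lemma GainIntegrable.gain_add {g : L1Vel} {f f' : L1Phase} (H : GainIntegrable g f)
    (H' : GainIntegrable g f') :
    gain g (f + f') =ᵐ[volume] fun z => gain g f z + gain g f' z := by
  filter_upwards [gainIntegrand_add g f f', H.1, H'.1] with z hz h1 h2
  exact (integral_congr_ae hz).trans (integral_add h1 h2)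

lemma gain_smul (g : L1Vel) (c : ℝ) (f : L1Phase) :
    gain g (c • f) =ᵐ[volume] fun z => c * gain g f z := by
  filter_upwards [gainIntegrand_smul g c f] with z hz
  exact (integral_congr_ae hz).trans (integral_const_mul c _)

lemma GainIntegrable.add {g : L1Vel} {f f' : L1Phase} (H : GainIntegrable g f)
    (H' : GainIntegrable g f') : GainIntegrable g (f + f') := by
  refine ⟨?_, (H.2.add H'.2).congr (H.gain_add H').symm⟩
  filter_upwards [gainIntegrand_add g f f', H.1, H'.1] with z hz h1 h2
  exact (h1.add h2).congr hz.symm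

lemma GainIntegrable.smul {g : L1Vel} {f : L1Phase} (c : ℝ) (H : GainIntegrable g f) :
    GainIntegrable g (c • f) := by
  refine ⟨?_, (H.2.const_mul c).congr (gain_smul g c f).symm⟩
  filter_upwards [gainIntegrand_smul g c f, H.1] with z hz h1
  exact (h1.const_mul c).congr hz.symm

lemma gainIntegrable_zero (g : L1Vel) : GainIntegrable g 0 := by
  have h0 : ∀ᵐ z ∂(volume : Measure Phase), gainIntegrand g 0 z =ᵐ[collMeasure] fun _ => 0 := by
    simpa using gainIntegrand_smul g 0 0
  have h1 : gain g 0 =ᵐ[volume] fun _ => 0 := by simpa using gain_smul g 0 0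
  refine ⟨?_, (integrable_zero _ _ _).congr h1.symm⟩
  filter_upwards [h0] with z hz
  exact (integrable_zero _ _ _).congr hz.symm

/-- `Q⁺[f]` as an element of `L¹(U × ℝ³)`. -/
def GainIntegrable.toL1 {g : L1Vel} {f : L1Phase} (H : GainIntegrable g f) : L1Phase :=
  Integrable.toL1 (gain g f) H.2

lemma GainIntegrable.coeFn_toL1 {g : L1Vel} {f : L1Phase} (H : GainIntegrable g f) :
    H.toL1 =ᵐ[volume] gain g f := Integrable.coeFn_toL1 H.2

lemma toL1_add {g : L1Vel} {f f' : L1Phase} (H : GainIntegrable g f) (H' : GainIntegrable g f') :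
    (H.add H').toL1 = H.toL1 + H'.toL1 := by
  refine Lp.ext ?_
  filter_upwards [(H.add H').coeFn_toL1, H.coeFn_toL1, H'.coeFn_toL1, H.gain_add H',
    Lp.coeFn_add H.toL1 H'.toL1] with z h1 h2 h3 h4 h5
  rw [h1, h5, Pi.add_apply, h2, h3, h4]

lemma toL1_smul {g : L1Vel} {f : L1Phase} (c : ℝ) (H : GainIntegrable g f) :
    (H.smul c).toL1 = c • H.toL1 := by
  refine Lp.ext ?_
  filter_upwards [(H.smul c).coeFn_toL1, H.coeFn_toL1, gain_smul g c f,
    Lp.coeFn_smul c H.toL1] with z h1 h2 h3 h4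
  rw [h1, h4, Pi.smul_apply, h2, h3, smul_eq_mul]

/-- The operator `B f = Q⁺[f]` with domain `D(B) = {f ∈ L¹ : Q⁺[f] ∈ L¹}`. -/
def opB (g : L1Vel) : L1Phase →ₗ.[ℝ] L1Phase where
  domain :=
    { carrier := {f | GainIntegrable g f}
      add_mem' := fun h h' => h.add h'
      zero_mem' := gainIntegrable_zero g
      smul_mem' := fun c _ h => h.smul c }
  toFun :=
    { toFun := fun f => f.2.toL1
      map_add' := fun f f' => toL1_add f.2 f'.2
      map_smul' := fun c f => toL1_smul c f.2 }

lemma opB_graph {g : L1Vel} {f h : L1Phase} :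
    (f, h) ∈ (opB g).graph ↔ GainIntegrable g f ∧ h =ᵐ[volume] gain g f := by
  rw [LinearPMap.mem_graph_iff]
  constructor
  · rintro ⟨y, rfl, rfl⟩
    exact ⟨y.2, GainIntegrable.coeFn_toL1 y.2⟩
  · rintro ⟨H, hh⟩
    exact ⟨⟨f, H⟩, rfl, Lp.ext ((GainIntegrable.coeFn_toL1 H).trans hh.symm)⟩

/-! ### Mild solutions and admissible data -/

/-- `u : [0,T] → L¹(U × ℝ³)` is a mild solution of `∂ₜ u = L u`, `u(0) = u₀`: for all `t ∈ [0,T]`,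
`∫₀ᵗ u(θ) dθ ∈ D(L)` and `L ∫₀ᵗ u(θ) dθ = u(t) - u₀`. The integral is a Bochner integral, so `u`
has to be integrable. Only the values of `u` on `[0,T]` matter. -/
structure IsMildSolution (L : L1Phase →ₗ.[ℝ] L1Phase) (u₀ : L1Phase) (T : ℝ)
    (u : ℝ → L1Phase) : Prop where
  integrable : IntegrableOn u (Icc 0 T) volume
  mild : ∀ t ∈ Icc 0 T, ∃ h : (∫ θ in (0 : ℝ)..t, u θ) ∈ L.domain,
    L ⟨∫ θ in (0 : ℝ)..t, u θ, h⟩ = u t - u₀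

/-- Admissible data. For `η = 1` the last condition reads `ess sup g₀(v) (1 + |v|⁴) < ∞`. -/
structure Admissible (η : ℝ) (f₀ : L1Phase) (g₀ : L1Vel) : Prop where
  f_nonneg : 0 ≤ f₀
  f_mass : ∫ z, f₀ z = 1
  g_nonneg : 0 ≤ g₀
  g_mass : ∫ v, g₀ v = 1
  f_moment : Integrable (fun z : Phase => f₀ z * (1 + ‖z.2‖ ^ 2)) volume
  g_moment : Integrable (fun v : Vel => g₀ v * (1 + ‖v‖ ^ 2)) volume
  g_bound : ∃ C : ℝ, ∀ᵐ v ∂(volume : Measure Vel), g₀ v * (1 + ‖v‖ ^ (3 + η)) ≤ C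

end LinBoltz

end

/-!
Kato's perturbation argument. For `λ > 0` the resolvent `R` of `A` integrates along free streaming
with absorption rate `λ + σ(v)`, where `σ` is the total collision rate; it is the full resolvent
because the stationary equation `(λ - A) d = 0` forces every Fourier coefficient of `d` in the
position to vanish. The collision map is a measure preserving involution, so the gain `B R h` has
at most the mass lost in `R h`, hence `λ ‖R h‖ + ‖B R h‖ ≤ ‖h‖` and the series `∑ R (B R)ᵏ`
converges. Its sum is the resolvent of the closure of `A + B` as soon as `(B R)ⁿ → 0` strongly. For
this one uses the weight `1 + |v|`: a collision adds at most a constant multiple of the mass to the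
weighted norm, since the energy gained comes from the background particle, while `σ(v)` is bounded
by a multiple of the weight, so the norms `‖(B R)ᵏ h‖` are summable for `h` of finite weighted norm.

The Yosida approximations converge to a contraction semigroup, whose orbits solve the equation for
the closure of `A + B`; sign, mass and growth of the weight pass from the resolvents to the limit.
Resolvents map data of finite weighted norm into the domain of `A + B` itself, which removes the
closure. A difference `w` of mild solutions satisfies `L̄ W = w` for `W(t) = ∫₀ᵗ w`; as `w` is only
integrable, one integrates once more, so that `Z(t) = ∫₀ᵗ W` is differentiable with `Z' = L̄ Z`, and
dissipativity gives `Z = 0`, hence `W = 0` and `w = 0`.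
-/

noncomputable section

namespace LinBoltz

open Filter Topology
open scoped ENNReal

/-! ### Lower semicontinuous extended seminorms -/

section Abstract

variable {X : Type*} [NormedAddCommGroup X] [NormedSpace ℝ X]

/-- A lower semicontinuous seminorm with values in `[0, ⊤]`. -/
structure IsLscSeminorm (N : X → ℝ≥0∞) : Prop where
  add_le : ∀ x y, N (x + y) ≤ N x + N y
  smul_le : ∀ (r : ℝ) x, N (r • x) ≤ ENNReal.ofReal |r| * N x
  lsc : LowerSemicontinuous N

lemma isLscSeminorm_enorm : IsLscSeminorm (fun x : X => ‖x‖ₑ) where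
  add_le := enorm_add_le
  smul_le r x := by rw [enorm_smul, Real.enorm_eq_ofReal_abs]
  lsc := continuous_enorm.lowerSemicontinuous

namespace IsLscSeminorm

variable {N : X → ℝ≥0∞}

lemma map_zero (hN : IsLscSeminorm N) : N 0 = 0 := by
  simpa using hN.smul_le 0 0

lemma sum_le (hN : IsLscSeminorm N) {ι : Type*} (s : Finset ι) (f : ι → X) :
    N (∑ i ∈ s, f i) ≤ ∑ i ∈ s, N (f i) :=
  Finset.le_sum_of_subadditive N hN.map_zero.le hN.add_le s f

lemma le_of_tendsto (hN : IsLscSeminorm N) {ι : Type*} {l : Filter ι} [l.NeBot] {f : ι → X} {a : X}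
    (h : Tendsto f l (𝓝 a)) {c : ℝ≥0∞} (hc : ∀ᶠ i in l, N (f i) ≤ c) : N a ≤ c :=
  (hN.lsc.isClosed_preimage c).mem_of_tendsto h hc

lemma le_tsum_of_hasSum (hN : IsLscSeminorm N) {ι : Type*} {f : ι → X} {a : X} (h : HasSum f a) :
    N a ≤ ∑' i, N (f i) :=
  hN.le_of_tendsto (l := atTop) h
    (Eventually.of_forall fun s => (hN.sum_le s f).trans (ENNReal.sum_le_tsum s))

lemma smul_lt_top (hN : IsLscSeminorm N) (r : ℝ) {x : X} (hx : N x < ⊤) : N (r • x) < ⊤ :=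
  (hN.smul_le r x).trans_lt (ENNReal.mul_lt_top ENNReal.ofReal_lt_top hx)

lemma sub_lt_top (hN : IsLscSeminorm N) {x y : X} (hx : N x < ⊤) (hy : N y < ⊤) :
    N (x - y) < ⊤ := by
  rw [sub_eq_add_neg, ← neg_one_smul ℝ y]
  exact (hN.add_le _ _).trans_lt (ENNReal.add_lt_top.2 ⟨hx, hN.smul_lt_top _ hy⟩)

lemma convex_sublevel (hN : IsLscSeminorm N) (c : ℝ≥0∞) : Convex ℝ {x | N x ≤ c} := by
  intro x hx y hy a b ha hb hab
  calc N (a • x + b • y) ≤ N (a • x) + N (b • y) := hN.add_le _ _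
    _ ≤ ENNReal.ofReal |a| * c + ENNReal.ofReal |b| * c := by
        gcongr
        · exact (hN.smul_le a x).trans (by gcongr; exact hx)
        · exact (hN.smul_le b y).trans (by gcongr; exact hy)
    _ = c := by
        rw [abs_of_nonneg ha, abs_of_nonneg hb, ← add_mul, ← ENNReal.ofReal_add ha hb, hab,
          ENNReal.ofReal_one, one_mul]

lemma intervalIntegral_lt_top [CompleteSpace X] (hN : IsLscSeminorm N) {f : ℝ → X} {t : ℝ}
    (ht : 0 ≤ t) (hf : IntegrableOn f (Ioc 0 t)) {c : ℝ≥0∞} (hc : c < ⊤)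
    (hfc : ∀ s ∈ Ioc 0 t, N (f s) ≤ c) : N (∫ s in (0 : ℝ)..t, f s) < ⊤ := by
  rcases ht.eq_or_lt with rfl | ht
  · simp [hN.map_zero]
  have haverage : N (⨍ s in Ioc 0 t, f s) ≤ c :=
    (hN.convex_sublevel c).set_average_mem (hN.lsc.isClosed_preimage c) (by simp [ht]) (by simp)
      ((ae_restrict_iff' measurableSet_Ioc).2 (Eventually.of_forall hfc)) hf
  have hsmul : ∫ s in (0 : ℝ)..t, f s = t • ⨍ s in Ioc 0 t, f s := by
    rw [intervalIntegral.integral_of_le ht.le, setAverage_eq, smul_smul]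
    simp [ht.le, ht.ne']
  rw [hsmul]
  exact hN.smul_lt_top _ (haverage.trans_lt hc)

end IsLscSeminorm

/-! ### Resolvent families -/

/-- `J λ` inverts `λ - L̄` for every `λ > 0`, with `‖J λ‖ ≤ 1 / λ`, and `L` is densely defined:
these are the hypotheses of the Hille–Yosida theorem for the closure of `L`. -/
structure IsResolventFamily (L : X →ₗ.[ℝ] X) (J : ℝ → X →L[ℝ] X) : Prop where
  norm_le : ∀ lam, 0 < lam → ∀ x, lam * ‖J lam x‖ ≤ ‖x‖
  mem_closure : ∀ lam, 0 < lam → ∀ x, (J lam x, lam • J lam x - x) ∈ closure (L.graph : Set (X × X))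
  left_inv : ∀ lam, 0 < lam → ∀ p ∈ L.graph, J lam (lam • p.1 - p.2) = p.1
  dense : Dense (L.domain : Set X)

namespace IsResolventFamily

variable {L : X →ₗ.[ℝ] X} {J : ℝ → X →L[ℝ] X}

lemma mem_closure_iff (hJ : IsResolventFamily L J) {lam : ℝ} (hlam : 0 < lam) {p : X × X} :
    p ∈ closure (L.graph : Set (X × X)) ↔ J lam (lam • p.1 - p.2) = p.1 := by
  constructor
  · have hclosed : IsClosed {p : X × X | J lam (lam • p.1 - p.2) = p.1} :=
      isClosed_eq (by fun_prop) (by fun_prop)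
    exact fun hp => closure_minimal (hJ.left_inv lam hlam) hclosed hp
  · intro hp
    have hmem := hJ.mem_closure lam hlam (lam • p.1 - p.2)
    rwa [hp, sub_sub_cancel] at hmem

lemma norm_smul_le (hJ : IsResolventFamily L J) {lam : ℝ} (hlam : 0 < lam) (x : X) :
    ‖lam • J lam x‖ ≤ ‖x‖ := by
  rw [norm_smul, Real.norm_of_nonneg hlam.le]
  exact hJ.norm_le lam hlam x

lemma smul_sub_self (hJ : IsResolventFamily L J) {lam : ℝ} (hlam : 0 < lam) {x y : X}
    (h : (x, y) ∈ closure (L.graph : Set (X × X))) : lam • J lam x - x = J lam y := by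
  have hx := (hJ.mem_closure_iff hlam).1 h
  simp only [map_sub, map_smul] at hx
  rw [sub_eq_iff_eq_add', ← sub_eq_iff_eq_add, hx]

lemma tendsto_apply_zero (hJ : IsResolventFamily L J) (x : X) :
    Tendsto (fun n : ℕ => J (n + 1) x) atTop (𝓝 0) := by
  refine squeeze_zero_norm (fun n => ?_) (a := fun n : ℕ => ‖x‖ * (1 / ((n : ℝ) + 1))) ?_
  · rw [mul_one_div, le_div_iff₀ (by positivity), mul_comm]
    exact hJ.norm_le (n + 1) (by positivity) x
  · simpa using tendsto_one_div_add_atTop_nhds_zero_nat.const_mul ‖x‖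

lemma tendsto_smul (hJ : IsResolventFamily L J) (x : X) :
    Tendsto (fun n : ℕ => ((n : ℝ) + 1) • J (n + 1) x) atTop (𝓝 x) := by
  rw [Metric.tendsto_atTop]
  intro ε hε
  obtain ⟨y, hy, hxy⟩ := hJ.dense.exists_dist_lt x (show 0 < ε / 3 by positivity)
  obtain ⟨z, hz⟩ := LinearPMap.mem_domain_iff.1 hy
  obtain ⟨n₀, hn₀⟩ := Metric.tendsto_atTop.1 (hJ.tendsto_apply_zero z) (ε / 3) (by positivity)
  refine ⟨n₀, fun n hn => ?_⟩
  have hpos : (0 : ℝ) < n + 1 := by positivity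
  have hsplit : ((n : ℝ) + 1) • J (n + 1) x - x = ((n : ℝ) + 1) • J (n + 1) (x - y)
      + J (n + 1) z - (x - y) := by
    rw [← hJ.smul_sub_self hpos (subset_closure hz), map_sub, smul_sub]
    abel
  have hz_lt := hn₀ n hn
  rw [dist_zero_right] at hz_lt
  rw [dist_eq_norm] at hxy ⊢
  rw [hsplit]
  calc _ ≤ ‖((n : ℝ) + 1) • J (n + 1) (x - y)‖ + ‖J (n + 1) z‖ + ‖x - y‖ :=
        (norm_sub_le _ _).trans (by gcongr; exact norm_add_le _ _)
    _ < ε := by linarith [hJ.norm_smul_le hpos (x - y)]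

lemma tendsto_smul_of_tendsto (hJ : IsResolventFamily L J) {z : ℕ → X} {x : X}
    (hz : Tendsto z atTop (𝓝 x)) :
    Tendsto (fun n : ℕ => ((n : ℝ) + 1) • J (n + 1) (z n)) atTop (𝓝 x) := by
  have herror : Tendsto (fun n : ℕ => ((n : ℝ) + 1) • J (n + 1) (z n - x)) atTop (𝓝 0) :=
    squeeze_zero_norm (fun n => hJ.norm_smul_le (by positivity) _)
      (tendsto_iff_norm_sub_tendsto_zero.1 hz)
  simpa [smul_sub] using herror.add (hJ.tendsto_smul x)

lemma snd_eq_zero (hJ : IsResolventFamily L J) {y : X}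
    (hy : ((0 : X), y) ∈ closure (L.graph : Set (X × X))) : y = 0 := by
  refine tendsto_nhds_unique (hJ.tendsto_smul y) (tendsto_const_nhds.congr fun n => ?_)
  rw [← hJ.smul_sub_self (show (0 : ℝ) < n + 1 by positivity) hy]
  simp

lemma isClosable (hJ : IsResolventFamily L J) : L.IsClosable := by
  refine ⟨L.graph.topologicalClosure.toLinearPMap, (Submodule.toLinearPMap_graph_eq _ ?_).symm⟩
  rintro ⟨x, y⟩ hxy (rfl : x = 0)
  exact hJ.snd_eq_zero hxy

lemma mem_graph_closure_iff (hJ : IsResolventFamily L J) {p : X × X} :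
    p ∈ L.closure.graph ↔ p ∈ closure (L.graph : Set (X × X)) := by
  rw [← hJ.isClosable.graph_closure_eq_closure_graph]
  rfl

lemma resolvent_identity (hJ : IsResolventFamily L J) {a b : ℝ} (ha : 0 < a) (hb : 0 < b) (x : X) :
    (b - a) • J a (J b x) = J a x - J b x := by
  have h := hJ.smul_sub_self ha (hJ.mem_closure b hb x)
  simp only [map_sub, map_smul] at h
  linear_combination (norm := module) -h

lemma commute (hJ : IsResolventFamily L J) {a b : ℝ} (ha : 0 < a) (hb : 0 < b) :
    Commute (J a) (J b) := by
  rcases eq_or_ne b a with rfl | hne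
  · exact Commute.refl _
  ext x
  refine smul_right_injective X (sub_ne_zero.2 hne) ?_
  calc (b - a) • J a (J b x) = -(J b x - J a x) := by rw [hJ.resolvent_identity ha hb, neg_sub]
    _ = (b - a) • J b (J a x) := by rw [← hJ.resolvent_identity hb ha, ← neg_smul, neg_sub]

lemma norm_le_norm_sub_smul (hJ : IsResolventFamily L J) {x y : X}
    (h : (x, y) ∈ closure (L.graph : Set (X × X))) {s : ℝ} (hs : 0 < s) : ‖x‖ ≤ ‖x - s • y‖ := by
  have hx : J s⁻¹ (s⁻¹ • x - y) = x := (hJ.mem_closure_iff (inv_pos.2 hs)).1 h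
  have hle := hJ.norm_le s⁻¹ (inv_pos.2 hs) (s⁻¹ • x - y)
  have hsmul : s⁻¹ • x - y = s⁻¹ • (x - s • y) := by
    rw [smul_sub, smul_smul, inv_mul_cancel₀ hs.ne', one_smul]
  rw [hx, hsmul, norm_smul, Real.norm_of_nonneg (inv_pos.2 hs).le] at hle
  exact le_of_mul_le_mul_left hle (inv_pos.2 hs)

lemma intervalIntegral_mem_closure [CompleteSpace X] (hJ : IsResolventFamily L J) {a b : ℝ}
    {z w : ℝ → X} (hz : IntervalIntegrable z volume a b) (hw : IntervalIntegrable w volume a b)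
    (h : ∀ s ∈ uIcc a b, (z s, w s) ∈ closure (L.graph : Set (X × X))) :
    (∫ s in a..b, z s, ∫ s in a..b, w s) ∈ closure (L.graph : Set (X × X)) := by
  rw [hJ.mem_closure_iff one_pos]
  simp only [one_smul]
  rw [← intervalIntegral.integral_sub hz hw,
    ← ContinuousLinearMap.intervalIntegral_comp_comm _ (hz.sub hw)]
  refine intervalIntegral.integral_congr fun s hs => ?_
  simpa using (hJ.mem_closure_iff one_pos).1 (h s hs)

/-! ### Uniqueness of mild solutions -/

lemma eventually_norm_le_norm_add (hJ : IsResolventFamily L J) {t : ℝ} {Z : ℝ → X} {w : X}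
    (hZ : HasDerivWithinAt Z w (Iic t) t) (hmem : (Z t, w) ∈ closure (L.graph : Set (X × X)))
    {r : ℝ} (hr : 0 < r) : ∀ᶠ u in 𝓝[<] t, ‖Z t‖ ≤ ‖Z u‖ + r * (t - u) := by
  have hlittleO := (hasDerivWithinAt_iff_isLittleO.1 hZ).def hr
  filter_upwards [hlittleO.filter_mono (nhdsWithin_mono t Iio_subset_Iic_self),
    self_mem_nhdsWithin] with u hu hut
  have hpos : 0 < t - u := sub_pos.2 hut
  rw [Real.norm_eq_abs, abs_sub_comm, abs_of_pos hpos] at hu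
  have hsplit : Z t - (t - u) • w = Z u - (Z u - Z t - (u - t) • w) := by module
  calc ‖Z t‖ ≤ ‖Z t - (t - u) • w‖ := hJ.norm_le_norm_sub_smul hmem hpos
    _ ≤ ‖Z u‖ + r * (t - u) := by
      rw [hsplit]
      exact (norm_sub_le _ _).trans (by gcongr)

lemma eq_zero_of_hasDerivWithinAt (hJ : IsResolventFamily L J) {T : ℝ} {Z W : ℝ → X}
    (hZ : ContinuousOn Z (Icc 0 T)) (h0 : Z 0 = 0)
    (hd : ∀ t ∈ Ioc 0 T, HasDerivWithinAt Z (W t) (Iic t) t)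
    (hmem : ∀ t ∈ Ioc 0 T, (Z t, W t) ∈ closure (L.graph : Set (X × X))) :
    ∀ t ∈ Icc 0 T, Z t = 0 := by
  intro t ht
  have hcont : ContinuousOn (fun s => -‖Z (t - s)‖) (Icc 0 t) :=
    (hZ.comp (by fun_prop) fun s hs => ⟨by linarith [hs.2], by linarith [hs.1, ht.2]⟩).norm.neg
  have hle := image_le_of_liminf_slope_right_le_deriv_boundary (f := fun s => -‖Z (t - s)‖)
    hcont (B := fun _ => -‖Z t‖) (B' := fun _ => 0) (by simp) continuousOn_const
    (fun s _ => hasDerivWithinAt_const _ _ _) ?_ (right_mem_Icc.2 ht.1)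
  · simp only [sub_self, h0, norm_zero, neg_zero] at hle
    exact norm_le_zero_iff.1 (by linarith)
  intro s hs r hr
  have hts : t - s ∈ Ioc 0 T := ⟨by linarith [hs.2], by linarith [hs.1, ht.2]⟩
  have hreflect : Tendsto (fun z => t - z) (𝓝[>] s) (𝓝[<] (t - s)) :=
    tendsto_nhdsWithin_iff.2 ⟨((continuous_const.sub continuous_id).tendsto s).mono_left
      nhdsWithin_le_nhds, by filter_upwards [self_mem_nhdsWithin] with z hz using by simpa using hz⟩
  refine Eventually.frequently ?_
  filter_upwards [hreflect.eventually (hJ.eventually_norm_le_norm_add (hd _ hts) (hmem _ hts)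
    (half_pos hr)), self_mem_nhdsWithin] with z hz hzs
  have hzs' : 0 < z - s := sub_pos.2 hzs
  rw [slope_def_field, div_lt_iff₀ hzs']
  nlinarith

end IsResolventFamily

lemma continuousOn_primitive {w : ℝ → X} {T : ℝ} (hw : IntegrableOn w (Icc 0 T)) :
    ContinuousOn (fun t => ∫ s in (0 : ℝ)..t, w s) (Icc 0 T) := by
  rcases le_total 0 T with hT | hT
  · rw [← uIcc_of_le hT] at hw ⊢
    exact intervalIntegral.continuousOn_primitive_interval hw
  · exact (subsingleton_Icc_of_ge hT).continuousOn _

lemma intervalIntegrable_of_integrableOn_Icc {E : Type*} [NormedAddCommGroup E] {w : ℝ → E}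
    {t T : ℝ} (hw : IntegrableOn w (Icc 0 T)) (ht : t ∈ Icc 0 T) :
    IntervalIntegrable w volume 0 t :=
  (intervalIntegrable_iff_integrableOn_Icc_of_le ht.1).2
    (hw.mono_set (Icc_subset_Icc_right ht.2))

lemma hasDerivWithinAt_primitive [CompleteSpace X] {w : ℝ → X} {t T : ℝ}
    (hw : ContinuousOn w (Icc 0 T)) (ht : t ∈ Ioc 0 T) :
    HasDerivWithinAt (fun t => ∫ s in (0 : ℝ)..t, w s) (w t) (Iic t) t := by
  have hw' : ContinuousOn w (Icc 0 t) := hw.mono (Icc_subset_Icc_right ht.2)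
  refine intervalIntegral.integral_hasDerivWithinAt_right
    (intervalIntegrable_of_integrableOn_Icc hw.integrableOn_Icc ⟨ht.1.le, ht.2⟩)
    ⟨Icc 0 t, Icc_mem_nhdsLE ht.1, hw'.aestronglyMeasurable measurableSet_Icc⟩
    ((hw' t (right_mem_Icc.2 ht.1.le)).mono_of_mem_nhdsWithin (Icc_mem_nhdsLE ht.1))

lemma IsResolventFamily.eq_zero_of_integral_mem_closure [CompleteSpace X] {L : X →ₗ.[ℝ] X}
    {J : ℝ → X →L[ℝ] X} (hJ : IsResolventFamily L J) {T : ℝ} {w : ℝ → X}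
    (hw : IntegrableOn w (Icc 0 T))
    (hmem : ∀ t ∈ Icc 0 T, (∫ s in (0 : ℝ)..t, w s, w t) ∈ closure (L.graph : Set (X × X))) :
    ∀ t ∈ Icc 0 T, w t = 0 := by
  set W : ℝ → X := fun t => ∫ s in (0 : ℝ)..t, w s
  have hW : ContinuousOn W (Icc 0 T) := continuousOn_primitive hw
  have hprimitive_mem : ∀ t ∈ Icc 0 T,
      (∫ s in (0 : ℝ)..t, W s, W t) ∈ closure (L.graph : Set (X × X)) := by
    intro t ht
    refine hJ.intervalIntegral_mem_closure
      (intervalIntegrable_of_integrableOn_Icc hW.integrableOn_Icc ht)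
      (intervalIntegrable_of_integrableOn_Icc hw ht) fun s hs => ?_
    rw [uIcc_of_le ht.1] at hs
    exact hmem s ⟨hs.1, hs.2.trans ht.2⟩
  have hprimitive_zero : ∀ t ∈ Icc 0 T, ∫ s in (0 : ℝ)..t, W s = 0 :=
    hJ.eq_zero_of_hasDerivWithinAt (continuousOn_primitive hW.integrableOn_Icc) (by simp)
      (fun t ht => hasDerivWithinAt_primitive hW ht)
      fun t ht => hprimitive_mem t (Ioc_subset_Icc_self ht)
  intro t ht
  have hW_zero : W t = 0 := hJ.snd_eq_zero (hprimitive_zero t ht ▸ hprimitive_mem t ht)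
  exact hJ.snd_eq_zero (hW_zero ▸ hmem t ht)

end Abstract

/-! ### Yosida approximation -/

section Semigroup

variable {X : Type*} [NormedAddCommGroup X] [NormedSpace ℝ X]

lemma pow_succ_apply (M : X →L[ℝ] X) (n : ℕ) (x : X) : (M ^ (n + 1)) x = M ((M ^ n) x) := by
  rw [pow_succ', mul_apply_eq_comp]

lemma pow_apply_mem {K : Set X} {M : X →L[ℝ] X} (hM : ∀ x ∈ K, M x ∈ K) {x : X} (hx : x ∈ K)
    (n : ℕ) : (M ^ n) x ∈ K := by
  induction n with
  | zero => simpa using hx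
  | succ n ih =>
    rw [pow_succ_apply]
    exact hM _ ih

/-- The Yosida approximation `λ² J - λ` of `L`, where `J = (λ - L)⁻¹`. -/
def yosida (J : X →L[ℝ] X) (lam : ℝ) : X →L[ℝ] X :=
  lam ^ 2 • J - lam • (1 : X →L[ℝ] X)

/-- The semigroup `exp (t (λ² J - λ))` generated by the Yosida approximation. -/
def yosidaExp (J : X →L[ℝ] X) (lam t : ℝ) : X →L[ℝ] X :=
  NormedSpace.exp (t • yosida J lam)

lemma yosida_apply (J : X →L[ℝ] X) (lam : ℝ) (x : X) :
    yosida J lam x = lam • (lam • J x - x) := by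
  simp [yosida, sq, smul_smul, smul_sub]

lemma commute_yosida {J K : X →L[ℝ] X} (h : Commute J K) (a b : ℝ) :
    Commute (yosida J a) (yosida K b) :=
  .sub_left
    (.sub_right ((h.smul_left _).smul_right _) ((Commute.one_right _).smul_right _))
    ((Commute.one_left _).smul_left _)

lemma IsResolventFamily.yosida_mem_closure {L : X →ₗ.[ℝ] X} {J : ℝ → X →L[ℝ] X}
    (hJ : IsResolventFamily L J) {lam : ℝ} (hlam : 0 < lam) (x : X) :
    (lam • J lam x, yosida (J lam) lam x) ∈ closure (L.graph : Set (X × X)) := by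
  rw [hJ.mem_closure_iff hlam, yosida_apply]
  simp [smul_sub]

variable [CompleteSpace X]

lemma hasSum_exp_smul_apply (G : X →L[ℝ] X) (s : ℝ) (x : X) :
    HasSum (fun k : ℕ => ((k.factorial : ℝ)⁻¹ * s ^ k) • (G ^ k) x)
      (NormedSpace.exp (s • G) x) := by
  have h := (NormedSpace.exp_series_hasSum_exp' (𝕂 := ℝ) (s • G)).mapL
    (ContinuousLinearMap.apply ℝ X x)
  simpa [smul_pow, smul_smul] using h

lemma hasDerivAt_exp_smul_apply (G H : X →L[ℝ] X) (x : X) (s : ℝ) :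
    HasDerivAt (fun s : ℝ => (H * NormedSpace.exp (s • G)) x)
      ((H * NormedSpace.exp (s • G)) (G x)) s :=
  (ContinuousLinearMap.apply ℝ X x).hasFDerivAt.comp_hasDerivAt s
    ((hasDerivAt_exp_smul_const (𝕂 := ℝ) G s).const_mul H)

lemma continuous_yosidaExp_apply (J : X →L[ℝ] X) (lam : ℝ) (x : X) :
    Continuous fun t : ℝ => yosidaExp J lam t x :=
  continuous_iff_continuousAt.2 fun t => by
    simpa [yosidaExp] using (hasDerivAt_exp_smul_apply (yosida J lam) 1 x t).continuousAt

lemma exp_add_of_commute_real {G H : X →L[ℝ] X} (h : Commute G H) :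
    NormedSpace.exp (G + H) = NormedSpace.exp G * NormedSpace.exp H := by
  let _ : NormedAlgebra ℚ (X →L[ℝ] X) := NormedAlgebra.restrictScalars ℚ ℝ _
  exact NormedSpace.exp_add_of_commute h

lemma yosidaExp_eq (J : X →L[ℝ] X) (lam t : ℝ) :
    yosidaExp J lam t = Real.exp (-(t * lam)) • NormedSpace.exp ((t * lam ^ 2) • J) := by
  have hsplit : t • yosida J lam
      = (t * lam ^ 2) • J + algebraMap ℝ (X →L[ℝ] X) (-(t * lam)) := by
    rw [Algebra.algebraMap_eq_smul_one, yosida]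
    module
  have hscalar : NormedSpace.exp (algebraMap ℝ (X →L[ℝ] X) (-(t * lam)))
      = algebraMap ℝ (X →L[ℝ] X) (Real.exp (-(t * lam))) := by
    rw [Real.exp_eq_exp_ℝ]
    exact (NormedSpace.algebraMap_exp_comm (𝕂 := ℝ) (-(t * lam))).symm
  rw [yosidaExp, hsplit, exp_add_of_commute_real (Algebra.commute_algebraMap_right _ _), hscalar,
    Algebra.algebraMap_eq_smul_one, mul_smul_comm, mul_one]

lemma IsLscSeminorm.exp_smul_le {N : X → ℝ≥0∞} (hN : IsLscSeminorm N) {G : X →L[ℝ] X} {c s : ℝ}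
    (hc : 0 ≤ c) (hs : 0 ≤ s) (hG : ∀ x, N (G x) ≤ ENNReal.ofReal c * N x) (x : X) :
    N (NormedSpace.exp (s • G) x) ≤ ENNReal.ofReal (Real.exp (s * c)) * N x := by
  have hpow : ∀ k : ℕ, N ((G ^ k) x) ≤ ENNReal.ofReal (c ^ k) * N x := by
    intro k
    induction k with
    | zero => simp
    | succ k ih =>
      rw [pow_succ_apply, pow_succ', ENNReal.ofReal_mul hc, mul_assoc]
      exact (hG _).trans (by gcongr)
  have hexp : HasSum (fun k : ℕ => (k.factorial : ℝ)⁻¹ * s ^ k * c ^ k) (Real.exp (s * c)) := by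
    rw [Real.exp_eq_exp_ℝ]
    simpa [mul_pow, mul_assoc] using NormedSpace.exp_series_hasSum_exp' (𝕂 := ℝ) (s * c)
  calc N (NormedSpace.exp (s • G) x)
      ≤ ∑' k : ℕ, N (((k.factorial : ℝ)⁻¹ * s ^ k) • (G ^ k) x) :=
        hN.le_tsum_of_hasSum (hasSum_exp_smul_apply G s x)
    _ ≤ ∑' k : ℕ, ENNReal.ofReal ((k.factorial : ℝ)⁻¹ * s ^ k * c ^ k) * N x := by
        refine ENNReal.tsum_le_tsum fun k => (hN.smul_le _ _).trans ?_
        rw [abs_of_nonneg (by positivity),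
          ENNReal.ofReal_mul (p := (k.factorial : ℝ)⁻¹ * s ^ k) (by positivity), mul_assoc]
        gcongr
        exact hpow k
    _ = ENNReal.ofReal (Real.exp (s * c)) * N x := by
        rw [ENNReal.tsum_mul_right, ← ENNReal.ofReal_tsum_of_nonneg (fun k => by positivity)
          hexp.summable, hexp.tsum_eq]

lemma IsLscSeminorm.yosidaExp_le {N : X → ℝ≥0∞} (hN : IsLscSeminorm N) {J : X →L[ℝ] X}
    {C lam t : ℝ} (hC : 0 ≤ C) (hlam : 0 < lam) (ht : 0 ≤ t)
    (hJ : ∀ x, N (J x) ≤ ENNReal.ofReal ((1 + C / lam) / lam) * N x) (x : X) :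
    N (yosidaExp J lam t x) ≤ ENNReal.ofReal (Real.exp (t * C)) * N x := by
  have hexponent : -(t * lam) + t * lam ^ 2 * ((1 + C / lam) / lam) = t * C := by
    field_simp
    ring
  calc N (yosidaExp J lam t x)
      ≤ ENNReal.ofReal |Real.exp (-(t * lam))| * N (NormedSpace.exp ((t * lam ^ 2) • J) x) := by
        rw [yosidaExp_eq]
        exact hN.smul_le _ _
    _ ≤ ENNReal.ofReal |Real.exp (-(t * lam))|
          * (ENNReal.ofReal (Real.exp (t * lam ^ 2 * ((1 + C / lam) / lam))) * N x) := by
        gcongr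
        exact hN.exp_smul_le (by positivity) (by positivity) hJ x
    _ = ENNReal.ofReal (Real.exp (t * C)) * N x := by
        rw [← mul_assoc, ← ENNReal.ofReal_mul (abs_nonneg _), abs_of_pos (Real.exp_pos _),
          ← Real.exp_add, hexponent]

lemma map_exp_smul_of_map_eq_zero (m : X →L[ℝ] ℝ) {G : X →L[ℝ] X} (hG : ∀ x, m (G x) = 0) (s : ℝ)
    (x : X) : m (NormedSpace.exp (s • G) x) = m x := by
  have hseries := (hasSum_exp_smul_apply G s x).mapL m
  have hzero := hasSum_single (f := fun k : ℕ => m (((k.factorial : ℝ)⁻¹ * s ^ k) • (G ^ k) x)) 0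
    fun k hk => by
      obtain ⟨n, rfl⟩ := Nat.exists_eq_succ_of_ne_zero hk
      rw [map_smul, pow_succ_apply, hG, smul_zero]
  simpa using hseries.unique hzero

lemma map_yosidaExp (m : X →L[ℝ] ℝ) {J : X →L[ℝ] X} {lam : ℝ} (hJ : ∀ x, lam * m (J x) = m x)
    (t : ℝ) (x : X) : m (yosidaExp J lam t x) = m x :=
  map_exp_smul_of_map_eq_zero m (fun y => by simp [yosida_apply, hJ]) t x

lemma yosidaExp_mem (K : ProperCone ℝ X) {J : X →L[ℝ] X} (hJ : ∀ x ∈ K, J x ∈ K) {lam t : ℝ}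
    (ht : 0 ≤ t) {x : X} (hx : x ∈ K) : yosidaExp J lam t x ∈ K := by
  rw [yosidaExp_eq, smul_apply]
  refine K.smul_mem (K.isClosed.mem_of_tendsto (hasSum_exp_smul_apply J (t * lam ^ 2) x)
    (Eventually.of_forall fun s => ?_)) (Real.exp_pos _).le
  exact sum_mem fun k _ => K.smul_mem (pow_apply_mem (K := (K : Set X)) hJ hx k) (by positivity)

lemma yosida_integral_yosidaExp (J : X →L[ℝ] X) (lam t : ℝ) (x : X) :
    yosida J lam (∫ s in (0 : ℝ)..t, yosidaExp J lam s x) = yosidaExp J lam t x - x := by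
  have hcont := continuous_yosidaExp_apply J lam x
  have hderiv : ∀ s, HasDerivAt (fun s => yosidaExp J lam s x)
      (yosida J lam (yosidaExp J lam s x)) s := fun s =>
    (ContinuousLinearMap.apply ℝ X x).hasFDerivAt.comp_hasDerivAt s
      (hasDerivAt_exp_smul_const' (𝕂 := ℝ) (yosida J lam) s)
  rw [← ContinuousLinearMap.intervalIntegral_comp_comm _ (hcont.intervalIntegrable 0 t),
    intervalIntegral.integral_eq_sub_of_hasDerivAt (fun s _ => hderiv s)
      (((yosida J lam).continuous.comp hcont).intervalIntegrable 0 t)]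
  simp [yosidaExp]

namespace IsResolventFamily

variable {L : X →ₗ.[ℝ] X} {J : ℝ → X →L[ℝ] X}

lemma norm_yosidaExp_le (hJ : IsResolventFamily L J) {lam t : ℝ} (hlam : 0 < lam) (ht : 0 ≤ t)
    (x : X) : ‖yosidaExp (J lam) lam t x‖ ≤ ‖x‖ := by
  have hle := isLscSeminorm_enorm.yosidaExp_le (J := J lam) le_rfl hlam ht (fun y => ?_) x
  · simpa [enorm_le_iff_norm_le] using hle
  · rw [zero_div, add_zero, ← ofReal_norm, ← ofReal_norm, ← ENNReal.ofReal_mul (by positivity),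
      one_div, inv_mul_eq_div]
    refine ENNReal.ofReal_le_ofReal ((le_div_iff₀ hlam).2 ?_)
    rw [mul_comm]
    exact hJ.norm_le lam hlam y

lemma norm_yosidaExp_sub_le (hJ : IsResolventFamily L J) {a b t : ℝ} (ha : 0 < a) (hb : 0 < b)
    (ht : 0 ≤ t) (x : X) :
    ‖yosidaExp (J a) a t x - yosidaExp (J b) b t x‖
      ≤ ‖yosida (J a) a x - yosida (J b) b x‖ * t := by
  set G := yosida (J a) a
  set H := yosida (J b) b
  have hcomm : Commute H G := commute_yosida (hJ.commute hb ha) b a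
  have hinterp : ∀ s y, (NormedSpace.exp (t • H) * NormedSpace.exp (s • (G - H))) y
      = yosidaExp (J b) b (t - s) (yosidaExp (J a) a s y) := by
    intro s y
    have hsum : t • H + s • (G - H) = (t - s) • H + s • G := by module
    rw [← exp_add_of_commute_real (((hcomm.sub_right (.refl _)).smul_left t).smul_right s), hsum,
      exp_add_of_commute_real ((hcomm.smul_left _).smul_right _)]
    rfl
  have hbound : ∀ s ∈ Ico 0 t,
      ‖(NormedSpace.exp (t • H) * NormedSpace.exp (s • (G - H))) ((G - H) x)‖ ≤ ‖(G - H) x‖ := by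
    intro s hs
    rw [hinterp]
    exact (hJ.norm_yosidaExp_le hb (by linarith [hs.2]) _).trans (hJ.norm_yosidaExp_le ha hs.1 _)
  have hle := norm_image_sub_le_of_norm_deriv_le_segment' (a := 0) (b := t)
    (fun s _ => (hasDerivAt_exp_smul_apply (G - H) (NormedSpace.exp (t • H)) x s).hasDerivWithinAt)
    hbound t (right_mem_Icc.2 ht)
  rw [hinterp t, hinterp 0] at hle
  simpa [yosidaExp] using hle

lemma uniformCauchySeqOn_yosidaExp (hJ : IsResolventFamily L J) (x : X) (T : ℝ) :
    UniformCauchySeqOn (fun (n : ℕ) t => yosidaExp (J (n + 1)) (n + 1) t x) atTop (Icc 0 T) := by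
  rw [Metric.uniformCauchySeqOn_iff]
  intro ε hε
  obtain ⟨y, hy, hxy⟩ := hJ.dense.exists_dist_lt x (show 0 < ε / 3 by positivity)
  obtain ⟨z, hz⟩ := LinearPMap.mem_domain_iff.1 hy
  rw [dist_eq_norm] at hxy
  obtain ⟨n₀, hn₀⟩ := Metric.cauchySeq_iff.1 (hJ.tendsto_smul z).cauchySeq (ε / 3 / (|T| + 1))
    (by positivity)
  refine ⟨n₀, fun m hm n hn t ht => ?_⟩
  have hm1 : (0 : ℝ) < m + 1 := by positivity
  have hn1 : (0 : ℝ) < n + 1 := by positivity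
  have hy_le : ‖yosidaExp (J (m + 1)) (m + 1) t y - yosidaExp (J (n + 1)) (n + 1) t y‖
      ≤ ε / 3 := by
    have hsub := hJ.norm_yosidaExp_sub_le hm1 hn1 ht.1 y
    rw [yosida_apply, yosida_apply, hJ.smul_sub_self hm1 (subset_closure hz),
      hJ.smul_sub_self hn1 (subset_closure hz), ← dist_eq_norm (_ • _)] at hsub
    calc _ ≤ ε / 3 / (|T| + 1) * (|T| + 1) := by
          refine hsub.trans ?_
          gcongr
          · exact ht.1
          · exact (hn₀ m hm n hn).le
          · exact ht.2.trans (by linarith [le_abs_self T])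
      _ = ε / 3 := by field_simp
  have hsplit : yosidaExp (J (m + 1)) (m + 1) t x - yosidaExp (J (n + 1)) (n + 1) t x
      = yosidaExp (J (m + 1)) (m + 1) t (x - y)
        + (yosidaExp (J (m + 1)) (m + 1) t y - yosidaExp (J (n + 1)) (n + 1) t y)
        - yosidaExp (J (n + 1)) (n + 1) t (x - y) := by
    simp only [map_sub]
    abel
  rw [dist_eq_norm, hsplit]
  refine ((norm_sub_le _ _).trans (add_le_add_left (norm_add_le _ _) _)).trans_lt ?_
  linarith [hJ.norm_yosidaExp_le hm1 ht.1 (x - y), hJ.norm_yosidaExp_le hn1 ht.1 (x - y)]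

end IsResolventFamily

/-! ### The semigroup -/

/-- The contraction semigroup generated by the closure of `L`, for `J` a resolvent family of `L`:
the limit of the exponentials of the Yosida approximations at `λ = n + 1`. -/
def semigroup (J : ℝ → X →L[ℝ] X) (t : ℝ) (x : X) : X :=
  limUnder atTop fun n : ℕ => yosidaExp (J (n + 1)) (n + 1) t x

namespace IsResolventFamily

variable {L : X →ₗ.[ℝ] X} {J : ℝ → X →L[ℝ] X}

lemma tendsto_semigroup (hJ : IsResolventFamily L J) {t : ℝ} (ht : 0 ≤ t) (x : X) :
    Tendsto (fun n : ℕ => yosidaExp (J (n + 1)) (n + 1) t x) atTop (𝓝 (semigroup J t x)) :=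
  ((hJ.uniformCauchySeqOn_yosidaExp x t).cauchySeq (right_mem_Icc.2 ht)).tendsto_limUnder

lemma continuousOn_semigroup (hJ : IsResolventFamily L J) (x : X) :
    ContinuousOn (fun t => semigroup J t x) (Ici 0) := by
  have hIcc : ∀ T, ContinuousOn (fun t => semigroup J t x) (Icc 0 T) := fun T =>
    ((hJ.uniformCauchySeqOn_yosidaExp x T).tendstoUniformlyOn_of_tendsto
      fun t ht => hJ.tendsto_semigroup ht.1 x).continuousOn
      (Frequently.of_forall fun n => (continuous_yosidaExp_apply _ _ x).continuousOn)
  intro t ht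
  refine (hIcc (t + 1) t ⟨ht, by linarith⟩).mono_of_mem_nhdsWithin ?_
  exact mem_nhdsWithin.2 ⟨Iio (t + 1), isOpen_Iio, by simp, fun s hs => ⟨hs.2, hs.1.le⟩⟩

lemma integral_semigroup_mem_closure (hJ : IsResolventFamily L J) {t : ℝ} (ht : 0 ≤ t) (x : X) :
    (∫ s in (0 : ℝ)..t, semigroup J s x, semigroup J t x - x)
      ∈ closure (L.graph : Set (X × X)) := by
  have hintegral : Tendsto
      (fun n : ℕ => ∫ s in (0 : ℝ)..t, yosidaExp (J (n + 1)) (n + 1) s x) atTop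
      (𝓝 (∫ s in (0 : ℝ)..t, semigroup J s x)) := by
    refine intervalIntegral.tendsto_integral_filter_of_dominated_convergence (fun _ => ‖x‖)
      (Eventually.of_forall fun n => (continuous_yosidaExp_apply _ _ x).aestronglyMeasurable)
      (Eventually.of_forall fun n => Eventually.of_forall fun s hs => ?_)
      intervalIntegrable_const (Eventually.of_forall fun s hs => ?_)
    all_goals rw [uIoc_of_le ht] at hs
    · exact hJ.norm_yosidaExp_le (by positivity) hs.1.le x
    · exact hJ.tendsto_semigroup hs.1.le x
  refine isClosed_closure.mem_of_tendsto
    ((hJ.tendsto_smul_of_tendsto hintegral).prodMk_nhds ((hJ.tendsto_semigroup ht x).sub_const x))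
    (Eventually.of_forall fun n => ?_)
  rw [← yosida_integral_yosidaExp]
  exact hJ.yosida_mem_closure (by positivity) _

lemma semigroup_mem (hJ : IsResolventFamily L J) (K : ProperCone ℝ X)
    (hK : ∀ lam, 0 < lam → ∀ x ∈ K, J lam x ∈ K) {t : ℝ} (ht : 0 ≤ t) {x : X} (hx : x ∈ K) :
    semigroup J t x ∈ K :=
  K.isClosed.mem_of_tendsto (hJ.tendsto_semigroup ht x)
    (Eventually.of_forall fun n => yosidaExp_mem K (hK _ (by positivity)) ht hx)

lemma map_semigroup (hJ : IsResolventFamily L J) (m : X →L[ℝ] ℝ)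
    (hm : ∀ lam, 0 < lam → ∀ x, lam * m (J lam x) = m x) {t : ℝ} (ht : 0 ≤ t) (x : X) :
    m (semigroup J t x) = m x :=
  tendsto_nhds_unique ((m.continuous.tendsto _).comp (hJ.tendsto_semigroup ht x))
    (tendsto_const_nhds.congr fun n => (map_yosidaExp m (hm _ (by positivity)) t x).symm)

end IsResolventFamily

lemma IsLscSeminorm.semigroup_le {N : X → ℝ≥0∞} (hN : IsLscSeminorm N)
    {L : X →ₗ.[ℝ] X} {J : ℝ → X →L[ℝ] X}
    (hJ : IsResolventFamily L J) {C : ℝ} (hC : 0 ≤ C)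
    (hJN : ∀ lam, 0 < lam → ∀ x, N (J lam x) ≤ ENNReal.ofReal ((1 + C / lam) / lam) * N x) {t : ℝ}
    (ht : 0 ≤ t) (x : X) : N (semigroup J t x) ≤ ENNReal.ofReal (Real.exp (t * C)) * N x :=
  hN.le_of_tendsto (hJ.tendsto_semigroup ht x) (Eventually.of_forall fun n =>
    hN.yosidaExp_le hC (by positivity) ht (hJN _ (by positivity)) x)

end Semigroup

/-! ### Perturbation series for the resolvent -/

section Kato

variable {X : Type*} [NormedAddCommGroup X] [NormedSpace ℝ X]

lemma mem_graph_add {A B : X →ₗ.[ℝ] X} {x y : X} :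
    (x, y) ∈ (A + B).graph ↔ ∃ a b, (x, a) ∈ A.graph ∧ (x, b) ∈ B.graph ∧ y = a + b := by
  constructor
  · intro h
    obtain ⟨z, rfl, rfl⟩ := (LinearPMap.mem_graph_iff _).1 h
    exact ⟨A ⟨z, z.2.1⟩, B ⟨z, z.2.2⟩, A.mem_graph ⟨z, z.2.1⟩, B.mem_graph ⟨z, z.2.2⟩,
      LinearPMap.add_apply A B z⟩
  · rintro ⟨a, b, hA, hB, rfl⟩
    obtain ⟨⟨_, hzA⟩, rfl, rfl⟩ := (LinearPMap.mem_graph_iff _).1 hA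
    obtain ⟨⟨_, hzB⟩, rfl, rfl⟩ := (LinearPMap.mem_graph_iff _).1 hB
    exact (LinearPMap.mem_graph_iff _).2 ⟨⟨_, hzA, hzB⟩, rfl, LinearPMap.add_apply A B _⟩

/-- Kato's setting for the perturbation of `A` by `B`: `R` is the resolvent `(λ - A)⁻¹`, `M` is the
everywhere defined operator `B R`, and `λ ‖R x‖ + ‖M x‖ ≤ ‖x‖`. -/
structure IsKatoPair (A B : X →ₗ.[ℝ] X) (lam : ℝ) (R M : X →L[ℝ] X) : Prop where
  pos : 0 < lam
  norm_le : ∀ x, lam * ‖R x‖ + ‖M x‖ ≤ ‖x‖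
  mem_graph : ∀ x, (R x, lam • R x - x) ∈ A.graph
  left_inv : ∀ p ∈ A.graph, R (lam • p.1 - p.2) = p.1
  mem_graph_perturbation : ∀ x, (R x, M x) ∈ B.graph

lemma sum_pow_sub_map (M : X →L[ℝ] X) (n : ℕ) (x : X) :
    ∑ k ∈ Finset.range n, (M ^ k) x - M (∑ k ∈ Finset.range n, (M ^ k) x) = x - (M ^ n) x := by
  simp only [map_sum, ← pow_succ_apply]
  rw [← Finset.sum_sub_distrib, Finset.sum_range_sub']
  simp

lemma tendsto_sub_pow {M : X →L[ℝ] X} {x : X}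
    (hM : Tendsto (fun n : ℕ => (M ^ n) x) atTop (𝓝 0)) :
    Tendsto (fun n : ℕ => x - (M ^ n) x) atTop (𝓝 x) := by
  simpa using hM.const_sub x

namespace IsKatoPair

variable {A B : X →ₗ.[ℝ] X} {lam : ℝ} {R M : X →L[ℝ] X}

lemma mem_graph_add (h : IsKatoPair A B lam R M) (x : X) :
    (R x, lam • R x - (x - M x)) ∈ (A + B).graph :=
  LinBoltz.mem_graph_add.2 ⟨_, _, h.mem_graph x, h.mem_graph_perturbation x, by abel⟩

lemma exists_of_mem_graph_add (h : IsKatoPair A B lam R M) {p : X × X} (hp : p ∈ (A + B).graph) :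
    ∃ x, p.1 = R x ∧ lam • p.1 - p.2 = x - M x := by
  obtain ⟨a, b, hA, hB, hab⟩ := LinBoltz.mem_graph_add.1 hp
  have hR : R (lam • p.1 - a) = p.1 := h.left_inv _ hA
  have hM : b = M (lam • p.1 - a) :=
    LinearPMap.mem_graph_snd_inj B hB (h.mem_graph_perturbation _) hR.symm
  exact ⟨_, hR.symm, by rw [← hM, hab]; abel⟩

lemma norm_pow_apply_le (h : IsKatoPair A B lam R M) (n : ℕ) (x : X) : ‖(M ^ n) x‖ ≤ ‖x‖ := by
  induction n with
  | zero => simp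
  | succ n ih =>
    have hR : 0 ≤ lam * ‖R ((M ^ n) x)‖ := mul_nonneg h.pos.le (norm_nonneg _)
    rw [pow_succ_apply]
    linarith [h.norm_le ((M ^ n) x)]

lemma sum_norm_add_le (h : IsKatoPair A B lam R M) (n : ℕ) (x : X) :
    lam * ∑ k ∈ Finset.range n, ‖R ((M ^ k) x)‖ + ‖(M ^ n) x‖ ≤ ‖x‖ := by
  induction n with
  | zero => simp
  | succ n ih =>
    rw [Finset.sum_range_succ, mul_add, pow_succ_apply]
    linarith [h.norm_le ((M ^ n) x)]

lemma sum_norm_le (h : IsKatoPair A B lam R M) (n : ℕ) (x : X) :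
    ∑ k ∈ Finset.range n, ‖R ((M ^ k) x)‖ ≤ ‖x‖ / lam := by
  rw [le_div_iff₀ h.pos, mul_comm]
  linarith [h.sum_norm_add_le n x, norm_nonneg ((M ^ n) x)]

lemma summable_norm (h : IsKatoPair A B lam R M) (x : X) :
    Summable fun k => ‖R ((M ^ k) x)‖ :=
  summable_of_sum_range_le (fun _ => norm_nonneg _) fun n => h.sum_norm_le n x

lemma norm_tsum_le (h : IsKatoPair A B lam R M) (x : X) :
    ‖∑' k, R ((M ^ k) x)‖ ≤ lam⁻¹ * ‖x‖ := by
  rw [inv_mul_eq_div]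
  exact (norm_tsum_le_tsum_norm (h.summable_norm x)).trans
    ((h.summable_norm x).tsum_le_of_sum_range_le fun n => h.sum_norm_le n x)

variable [CompleteSpace X]

/-- Kato's perturbation series `∑ R Mᵏ`, the candidate for the resolvent at `λ` of the closure of
`A + B`. -/
def resolvent (h : IsKatoPair A B lam R M) : X →L[ℝ] X :=
  LinearMap.mkContinuous
    { toFun := fun x => ∑' k, R ((M ^ k) x)
      map_add' := fun x y => by
        simp only [map_add]
        exact (h.summable_norm x).of_norm.tsum_add (h.summable_norm y).of_norm
      map_smul' := fun r x => by
        simp only [map_smul, RingHom.id_apply]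
        exact (h.summable_norm x).of_norm.tsum_const_smul r }
    lam⁻¹ h.norm_tsum_le

lemma hasSum_resolvent (h : IsKatoPair A B lam R M) (x : X) :
    HasSum (fun k => R ((M ^ k) x)) (h.resolvent x) :=
  (h.summable_norm x).of_norm.hasSum

lemma norm_resolvent_le (h : IsKatoPair A B lam R M) (x : X) :
    lam * ‖h.resolvent x‖ ≤ ‖x‖ :=
  (le_inv_mul_iff₀ h.pos).1 (h.norm_tsum_le x)

lemma tendsto_sum (h : IsKatoPair A B lam R M) (x : X) :
    Tendsto (fun n : ℕ => R (∑ k ∈ Finset.range n, (M ^ k) x)) atTop (𝓝 (h.resolvent x)) := by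
  simpa only [map_sum] using (h.hasSum_resolvent x).tendsto_sum_nat

lemma resolvent_mem_closure (h : IsKatoPair A B lam R M)
    (hM : ∀ x, Tendsto (fun n : ℕ => (M ^ n) x) atTop (𝓝 0)) (x : X) :
    (h.resolvent x, lam • h.resolvent x - x) ∈ closure ((A + B).graph : Set (X × X)) := by
  have hsnd : Tendsto (fun n : ℕ => lam • R (∑ k ∈ Finset.range n, (M ^ k) x) - (x - (M ^ n) x))
      atTop (𝓝 (lam • h.resolvent x - x)) :=
    ((h.tendsto_sum x).const_smul lam).sub (tendsto_sub_pow (hM x))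
  refine mem_closure_of_tendsto ((h.tendsto_sum x).prodMk_nhds hsnd)
    (Eventually.of_forall fun n => ?_)
  rw [← sum_pow_sub_map M n x]
  exact h.mem_graph_add _

lemma resolvent_sub_map (h : IsKatoPair A B lam R M)
    (hM : ∀ x, Tendsto (fun n : ℕ => (M ^ n) x) atTop (𝓝 0)) (x : X) :
    h.resolvent (x - M x) = R x := by
  refine tendsto_nhds_unique (h.tendsto_sum (x - M x))
    (((R.continuous.tendsto x).comp (tendsto_sub_pow (hM x))).congr fun n => ?_)
  have hcomm : ∀ k, (M ^ k) (x - M x) = (M ^ k) x - (M ^ (k + 1)) x := fun k => by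
    rw [map_sub, pow_succ, mul_apply_eq_comp]
  simp only [hcomm, Finset.sum_range_sub', pow_zero, one_apply_eq_self, Function.comp_apply]

lemma resolvent_left_inv (h : IsKatoPair A B lam R M)
    (hM : ∀ x, Tendsto (fun n : ℕ => (M ^ n) x) atTop (𝓝 0)) {p : X × X}
    (hp : p ∈ (A + B).graph) : h.resolvent (lam • p.1 - p.2) = p.1 := by
  obtain ⟨x, hR, hx⟩ := h.exists_of_mem_graph_add hp
  rw [hx, hR, h.resolvent_sub_map hM]

lemma map_resolvent (h : IsKatoPair A B lam R M)
    (hM : ∀ x, Tendsto (fun n : ℕ => (M ^ n) x) atTop (𝓝 0)) (m : X →L[ℝ] ℝ)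
    (hm : ∀ x, lam * m (R x) + m (M x) = m x) (x : X) : lam * m (h.resolvent x) = m x := by
  refine tendsto_nhds_unique (((m.continuous.tendsto _).comp (h.tendsto_sum x)).const_mul lam)
    (((m.continuous.tendsto x).comp (tendsto_sub_pow (hM x))).congr fun n => ?_)
  rw [Function.comp_apply, Function.comp_apply, ← sum_pow_sub_map, map_sub,
    ← hm (∑ k ∈ Finset.range n, (M ^ k) x)]
  ring

lemma resolvent_mem (h : IsKatoPair A B lam R M) (K : ProperCone ℝ X) (hR : ∀ x ∈ K, R x ∈ K)
    (hM : ∀ x ∈ K, M x ∈ K) {x : X} (hx : x ∈ K) : h.resolvent x ∈ K :=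
  K.isClosed.mem_of_tendsto (h.hasSum_resolvent x)
    (Eventually.of_forall fun _ => K.sum_mem fun k _ =>
      hR _ (pow_apply_mem (K := (K : Set X)) hM hx k))

end IsKatoPair

/-- The weight `N` is a Lyapunov functional for the pair `R, M`: along one step of the perturbation
series it grows by at most a multiple of the norm, and it controls `M`. -/
structure IsLyapunov (N : X → ℝ≥0∞) (C c lam : ℝ) (R M : X →L[ℝ] X) : Prop where
  weight_le : ∀ x, N (M x) + ENNReal.ofReal lam * N (R x) ≤ N x + ENNReal.ofReal C * ‖R x‖ₑ
  enorm_le : ∀ x, ‖M x‖ₑ ≤ ENNReal.ofReal c * N (R x)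

namespace IsLyapunov

variable {A B : X →ₗ.[ℝ] X} {N : X → ℝ≥0∞} {C c lam : ℝ} {R M : X →L[ℝ] X}

lemma sum_weight_le (hN : IsLyapunov N C c lam R M) (n : ℕ) (x : X) :
    N ((M ^ n) x) + ENNReal.ofReal lam * ∑ k ∈ Finset.range n, N (R ((M ^ k) x))
      ≤ N x + ENNReal.ofReal C * ∑ k ∈ Finset.range n, ‖R ((M ^ k) x)‖ₑ := by
  induction n with
  | zero => simp
  | succ n ih =>
    simp only [Finset.sum_range_succ, mul_add, pow_succ_apply, ← add_assoc]
    calc _ = (N (M ((M ^ n) x)) + ENNReal.ofReal lam * N (R ((M ^ n) x)))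
          + ENNReal.ofReal lam * ∑ k ∈ Finset.range n, N (R ((M ^ k) x)) := by ring
      _ ≤ (N ((M ^ n) x) + ENNReal.ofReal C * ‖R ((M ^ n) x)‖ₑ)
          + ENNReal.ofReal lam * ∑ k ∈ Finset.range n, N (R ((M ^ k) x)) :=
        add_le_add_left (hN.weight_le _) _
      _ = (N ((M ^ n) x) + ENNReal.ofReal lam * ∑ k ∈ Finset.range n, N (R ((M ^ k) x)))
          + ENNReal.ofReal C * ‖R ((M ^ n) x)‖ₑ := by ring
      _ ≤ _ := by gcongr

lemma tsum_weight_le (hN : IsLyapunov N C c lam R M) (h : IsKatoPair A B lam R M) (x : X) :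
    ENNReal.ofReal lam * ∑' k, N (R ((M ^ k) x))
      ≤ N x + ENNReal.ofReal C * ENNReal.ofReal (‖x‖ / lam) := by
  rw [← ENNReal.tsum_mul_left]
  refine ENNReal.tsum_le_of_sum_range_le fun n => ?_
  rw [← Finset.mul_sum]
  refine (le_add_self.trans (hN.sum_weight_le n x)).trans ?_
  gcongr
  simp only [← ofReal_norm]
  rw [← ENNReal.ofReal_sum_of_nonneg (fun _ _ => norm_nonneg _)]
  exact ENNReal.ofReal_le_ofReal (h.sum_norm_le n x)

lemma tsum_weight_lt_top (hN : IsLyapunov N C c lam R M) (h : IsKatoPair A B lam R M) {x : X}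
    (hx : N x < ⊤) : ∑' k, N (R ((M ^ k) x)) < ⊤ := by
  have hprod : ENNReal.ofReal lam * ∑' k, N (R ((M ^ k) x)) < ⊤ :=
    (hN.tsum_weight_le h x).trans_lt (ENNReal.add_lt_top.2
      ⟨hx, ENNReal.mul_lt_top ENNReal.ofReal_lt_top ENNReal.ofReal_lt_top⟩)
  exact ENNReal.lt_top_of_mul_ne_top_right hprod.ne (by simpa using h.pos)

variable [CompleteSpace X]

lemma weight_resolvent_le (hN : IsLyapunov N C c lam R M) (h : IsKatoPair A B lam R M)
    (hlsc : IsLscSeminorm N) (hC : 0 ≤ C) (hle : ∀ x, ‖x‖ₑ ≤ N x) (x : X) :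
    N (h.resolvent x) ≤ ENNReal.ofReal ((1 + C / lam) / lam) * N x := by
  have hlam := h.pos
  have hnorm : ENNReal.ofReal C * ENNReal.ofReal (‖x‖ / lam) ≤ ENNReal.ofReal (C / lam) * N x :=
    calc ENNReal.ofReal C * ENNReal.ofReal (‖x‖ / lam)
        = ENNReal.ofReal (C / lam) * ‖x‖ₑ := by
          rw [← ofReal_norm, ← ENNReal.ofReal_mul hC, ← ENNReal.ofReal_mul (by positivity),
            mul_div_left_comm, mul_comm]
      _ ≤ _ := by gcongr; exact hle x
  rw [ENNReal.ofReal_div_of_pos hlam, ← ENNReal.mul_div_right_comm,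
    ENNReal.le_div_iff_mul_le (by simp [hlam]) (by simp), mul_comm]
  calc ENNReal.ofReal lam * N (h.resolvent x)
      ≤ ENNReal.ofReal lam * ∑' k, N (R ((M ^ k) x)) := by
        gcongr
        exact hlsc.le_tsum_of_hasSum (h.hasSum_resolvent x)
    _ ≤ N x + ENNReal.ofReal (C / lam) * N x := (hN.tsum_weight_le h x).trans (by gcongr)
    _ = ENNReal.ofReal (1 + C / lam) * N x := by
        rw [ENNReal.ofReal_add zero_le_one (by positivity), ENNReal.ofReal_one, add_mul, one_mul]

lemma summable_pow (hN : IsLyapunov N C c lam R M) (h : IsKatoPair A B lam R M) {x : X}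
    (hx : N x < ⊤) : Summable fun k => (M ^ k) x := by
  have hle : ∑' k, ‖(M ^ (k + 1)) x‖ₑ ≤ ENNReal.ofReal c * ∑' k, N (R ((M ^ k) x)) := by
    rw [← ENNReal.tsum_mul_left]
    refine ENNReal.tsum_le_tsum fun k => ?_
    rw [pow_succ_apply]
    exact hN.enorm_le _
  have hlt := hle.trans_lt (ENNReal.mul_lt_top ENNReal.ofReal_lt_top (hN.tsum_weight_lt_top h hx))
  rw [← summable_nat_add_iff 1]
  exact Summable.of_norm (by simpa using ENNReal.summable_toReal hlt.ne)

lemma resolvent_mem_domain (hN : IsLyapunov N C c lam R M) (h : IsKatoPair A B lam R M) {x : X}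
    (hx : N x < ⊤) : h.resolvent x ∈ (A + B).domain := by
  have heq : h.resolvent x = R (∑' k, (M ^ k) x) :=
    (h.hasSum_resolvent x).unique ((hN.summable_pow h hx).hasSum.mapL R)
  rw [heq]
  exact LinearPMap.mem_domain_of_mem_graph (h.mem_graph_add _)

lemma tendsto_pow (hN : IsLyapunov N C c lam R M) (h : IsKatoPair A B lam R M)
    (hd : Dense {x | N x < ⊤}) (x : X) : Tendsto (fun n : ℕ => (M ^ n) x) atTop (𝓝 0) := by
  rw [Metric.tendsto_atTop]
  intro ε hε
  obtain ⟨y, hy, hxy⟩ := hd.exists_dist_lt x (half_pos hε)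
  obtain ⟨n₀, hn₀⟩ :=
    Metric.tendsto_atTop.1 (hN.summable_pow h hy).tendsto_atTop_zero (ε / 2) (half_pos hε)
  refine ⟨n₀, fun n hn => ?_⟩
  have hy_lt := hn₀ n hn
  rw [dist_zero_right] at hy_lt ⊢
  rw [dist_eq_norm] at hxy
  calc ‖(M ^ n) x‖ = ‖(M ^ n) (x - y) + (M ^ n) y‖ := by rw [← map_add, sub_add_cancel]
    _ ≤ ‖x - y‖ + ‖(M ^ n) y‖ := (norm_add_le _ _).trans (by gcongr; exact h.norm_pow_apply_le n _)
    _ < ε := by linarith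

end IsLyapunov

end Kato

/-! ### Free streaming -/

/-- The free flow `(x, v) ↦ (x + t v, v)`. -/
def stream (t : ℝ) (z : Phase) : Phase := (z.1 + torusProj (fun i => t * z.2 i), z.2)

@[simp] lemma stream_snd (t : ℝ) (z : Phase) : (stream t z).2 = z.2 := rfl

@[simp] lemma stream_zero (z : Phase) : stream 0 z = z := by
  refine Prod.ext ?_ rfl
  funext i
  simp [stream, torusProj]

lemma stream_stream (s t : ℝ) (z : Phase) : stream s (stream t z) = stream (s + t) z := by
  refine Prod.ext ?_ rfl
  simp only [stream, add_mul]
  rw [add_assoc, ← torusProj_add, add_comm (fun i => t * z.2 i)]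
  rfl

lemma continuous_torusProj : Continuous torusProj :=
  continuous_pi fun i => (AddCircle.continuous_mk' 1).comp (continuous_apply i)

@[fun_prop]
lemma continuous_stream : Continuous fun q : ℝ × Phase => stream q.1 q.2 := by
  unfold stream
  have htorus : Continuous fun q : ℝ × Phase => torusProj (fun i => q.1 * q.2.2 i) :=
    continuous_torusProj.comp (by fun_prop)
  fun_prop

lemma measurable_stream_neg : Measurable fun q : Phase × ℝ => stream (-q.2) q.1 :=
  (continuous_stream.comp (f := fun q : Phase × ℝ => (-q.2, q.1)) (by fun_prop)).measurable

lemma measurePreserving_stream (t : ℝ) :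
    MeasurePreserving (stream t) (volume : Measure Phase) volume := by
  have htorus : Continuous fun q : Vel × Torus => torusProj (fun i => t * q.1 i) :=
    continuous_torusProj.comp (by fun_prop)
  have hskew : MeasurePreserving
      (fun q : Vel × Torus => (q.1, q.2 + torusProj (fun i => t * q.1 i)))
      ((volume : Measure Vel).prod (volume : Measure Torus))
      ((volume : Measure Vel).prod (volume : Measure Torus)) :=
    (MeasurePreserving.id (volume : Measure Vel)).skew_product (μc := volume) (μd := volume)
      (g := fun (v : Vel) (x : Torus) => x + torusProj (fun i => t * v i))
      (Continuous.measurable (by fun_prop))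
      (Eventually.of_forall fun _ => (measurePreserving_add_right volume _).map_eq)
  exact (Measure.measurePreserving_swap (μ := (volume : Measure Vel))
    (ν := (volume : Measure Torus))).comp (hskew.comp (Measure.measurePreserving_swap
    (μ := (volume : Measure Torus)) (ν := (volume : Measure Vel))))

lemma measurePreserving_stream_prod (m : Measure ℝ) [SFinite m] :
    MeasurePreserving (fun q : Phase × ℝ => (stream q.2 q.1, q.2))
      ((volume : Measure Phase).prod m) ((volume : Measure Phase).prod m) := by
  have hskew : MeasurePreserving (fun q : ℝ × Phase => (q.1, stream q.1 q.2))
      (m.prod (volume : Measure Phase)) (m.prod (volume : Measure Phase)) :=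
    (MeasurePreserving.id m).skew_product continuous_stream.measurable
      (Eventually.of_forall fun t => (measurePreserving_stream t).map_eq)
  exact Measure.measurePreserving_swap.comp (hskew.comp Measure.measurePreserving_swap)

lemma ae_stream {P : Phase → Prop} (hP : MeasurableSet {z | P z})
    (h : ∀ᵐ z ∂(volume : Measure Phase), P z) (m : Measure ℝ) [SFinite m] :
    ∀ᵐ z ∂(volume : Measure Phase), ∀ᵐ t ∂m, P (stream (-t) z) := by
  have hP' : MeasurableSet {q : Phase × ℝ | P (stream (-q.2) q.1)} := measurable_stream_neg hP
  rw [Measure.ae_ae_comm hP']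
  exact Eventually.of_forall fun t => (measurePreserving_stream (-t)).quasiMeasurePreserving.ae h

/-! ### The resolvent of transport with absorption -/

section StreamResolvent

lemma integral_exp_neg_mul_Ioi {c : ℝ} (hc : 0 < c) :
    ∫ t in Ioi (0 : ℝ), Real.exp (-c * t) = c⁻¹ := by
  rw [integral_exp_mul_Ioi (by linarith)]
  simp [neg_div_neg_eq]

lemma lintegral_exp_neg_mul_Ioi {c : ℝ} (hc : 0 < c) :
    ∫⁻ t in Ioi (0 : ℝ), ENNReal.ofReal (Real.exp (-c * t)) = ENNReal.ofReal c⁻¹ := by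
  rw [← integral_exp_neg_mul_Ioi hc, ofReal_integral_eq_lintegral_ofReal]
  · exact integrableOn_exp_mul_Ioi (by linarith) 0
  · exact Eventually.of_forall fun t => (Real.exp_pos _).le

variable {a : Vel → ℝ} {h h' : Phase → ℝ}

/-- The resolvent `(v · ∂ₓ + a(v))⁻¹ h` of transport with absorption rate `a`, given along
characteristics by `∫₀^∞ exp(-a(v) t) h(x - t v, v) dt`. -/
def streamResolvent (a : Vel → ℝ) (h : Phase → ℝ) (z : Phase) : ℝ :=
  ∫ t in Ioi (0 : ℝ), Real.exp (-a z.2 * t) * h (stream (-t) z)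

/-- The version of `streamResolvent` for functions with values in `[0, ∞]`. -/
def streamLResolvent (a : Vel → ℝ) (F : Phase → ℝ≥0∞) (z : Phase) : ℝ≥0∞ :=
  ∫⁻ t in Ioi (0 : ℝ), ENNReal.ofReal (Real.exp (-a z.2 * t)) * F (stream (-t) z)

lemma stronglyMeasurable_streamResolvent (ha : Measurable a) (hh : StronglyMeasurable h) :
    StronglyMeasurable (streamResolvent a h) :=
  StronglyMeasurable.integral_prod_right' (f := fun q : Phase × ℝ =>
    Real.exp (-a q.1.2 * q.2) * h (stream (-q.2) q.1))
    ((Measurable.stronglyMeasurable (by fun_prop)).mul (hh.comp_measurable measurable_stream_neg))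

lemma lintegral_streamLResolvent_mul (ha : Measurable a) {F G : Phase → ℝ≥0∞} (hF : Measurable F)
    (hG : Measurable G) :
    ∫⁻ z, streamLResolvent a F z * G z = ∫⁻ z, F z *
      ∫⁻ t in Ioi (0 : ℝ), ENNReal.ofReal (Real.exp (-a z.2 * t)) * G (stream t z) := by
  have hFs := hF.comp measurable_stream_neg
  have hkernel : Measurable fun q : Phase × ℝ =>
      ENNReal.ofReal (Real.exp (-a q.1.2 * q.2)) * F (stream (-q.2) q.1) * G q.1 := by
    fun_prop
  have hΘ := measurePreserving_stream_prod (volume.restrict (Ioi (0 : ℝ)))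
  have hkernel' : Measurable fun q : Phase × ℝ =>
      ENNReal.ofReal (Real.exp (-a q.1.2 * q.2)) * G (stream q.2 q.1) := by
    have := hG.comp hΘ.measurable.fst
    fun_prop
  calc ∫⁻ z, streamLResolvent a F z * G z
      = ∫⁻ q, ENNReal.ofReal (Real.exp (-a q.1.2 * q.2)) * F (stream (-q.2) q.1) * G q.1
          ∂((volume : Measure Phase).prod (volume.restrict (Ioi 0))) := by
        rw [lintegral_prod _ hkernel.aemeasurable]
        refine lintegral_congr fun z => (lintegral_mul_const _ ?_).symm
        have := hFs.comp (measurable_prodMk_left (x := z))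
        fun_prop
    _ = ∫⁻ q, ENNReal.ofReal (Real.exp (-a q.1.2 * q.2)) * F q.1 * G (stream q.2 q.1)
          ∂((volume : Measure Phase).prod (volume.restrict (Ioi 0))) := by
        rw [← hΘ.lintegral_comp hkernel]
        simp only [stream_snd, stream_stream, neg_add_cancel, stream_zero]
    _ = _ := by
        simp_rw [mul_comm _ (F _), mul_assoc]
        rw [lintegral_prod _ (by fun_prop)]
        refine lintegral_congr fun z => lintegral_const_mul (F z) ?_
        exact hkernel'.comp (measurable_prodMk_left (x := z))

lemma lintegral_streamLResolvent_mul_rate (ha : Measurable a) (hpos : ∀ v, 0 < a v)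
    {F : Phase → ℝ≥0∞} (hF : Measurable F) {Φ : Vel → ℝ≥0∞} (hΦ : Measurable Φ) :
    ∫⁻ z, streamLResolvent a F z * (ENNReal.ofReal (a z.2) * Φ z.2) = ∫⁻ z, F z * Φ z.2 := by
  rw [lintegral_streamLResolvent_mul ha hF (G := fun z => ENNReal.ofReal (a z.2) * Φ z.2)
    (by fun_prop)]
  refine lintegral_congr fun z => ?_
  simp only [stream_snd]
  rw [lintegral_mul_const _ (by fun_prop), lintegral_exp_neg_mul_Ioi (hpos _),
    ← mul_assoc (ENNReal.ofReal _), ← ENNReal.ofReal_mul (inv_pos.2 (hpos _)).le,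
    inv_mul_cancel₀ (hpos _).ne', ENNReal.ofReal_one, one_mul]

lemma enorm_streamResolvent_le (h : Phase → ℝ) (z : Phase) :
    ‖streamResolvent a h z‖ₑ ≤ streamLResolvent a (fun z => ‖h z‖ₑ) z := by
  refine (enorm_integral_le_lintegral_enorm _).trans (le_of_eq ?_)
  simp only [streamLResolvent, enorm_mul, Real.enorm_of_nonneg (Real.exp_pos _).le]

lemma lintegral_streamResolvent_mul_rate_le (ha : Measurable a) (hpos : ∀ v, 0 < a v)
    (hh : Measurable h) {Φ : Vel → ℝ≥0∞} (hΦ : Measurable Φ) :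
    ∫⁻ z, ‖streamResolvent a h z‖ₑ * (ENNReal.ofReal (a z.2) * Φ z.2) ≤ ∫⁻ z, ‖h z‖ₑ * Φ z.2 := by
  rw [← lintegral_streamLResolvent_mul_rate ha hpos hh.enorm hΦ]
  gcongr with z
  exact enorm_streamResolvent_le h z

lemma integrable_streamKernel (ha : Measurable a) (hpos : ∀ v, 0 < a v)
    (hh : StronglyMeasurable h) (hi : Integrable h) {Ψ : Phase → ℝ} {C : ℝ} (hΨ : Measurable Ψ)
    (hC : ∀ z, |Ψ z| ≤ C * a z.2) :
    Integrable (fun q : Phase × ℝ => Real.exp (-a q.1.2 * q.2) * h (stream (-q.2) q.1) * Ψ q.1)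
      ((volume : Measure Phase).prod (volume.restrict (Ioi 0))) := by
  have hhs := hh.measurable.comp measurable_stream_neg
  have hmeas : Measurable fun q : Phase × ℝ =>
      Real.exp (-a q.1.2 * q.2) * h (stream (-q.2) q.1) * Ψ q.1 := by
    fun_prop
  refine ⟨hmeas.aestronglyMeasurable, ?_⟩
  have hfinite : ∫⁻ z, streamLResolvent a (fun z => ‖h z‖ₑ) z
      * (ENNReal.ofReal (a z.2) * ENNReal.ofReal C) < ⊤ := by
    rw [lintegral_streamLResolvent_mul_rate ha hpos hh.measurable.enorm
      (Φ := fun _ => ENNReal.ofReal C) measurable_const, lintegral_mul_const _ hh.measurable.enorm]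
    exact ENNReal.mul_lt_top hi.2 ENNReal.ofReal_lt_top
  refine lt_of_le_of_lt ?_ hfinite
  rw [lintegral_prod _ hmeas.enorm.aemeasurable]
  refine lintegral_mono fun z => ?_
  have hΨz : ‖Ψ z‖ₑ ≤ ENNReal.ofReal (a z.2) * ENNReal.ofReal C := by
    rw [← ENNReal.ofReal_mul (hpos _).le, Real.enorm_eq_ofReal_abs, mul_comm]
    exact ENNReal.ofReal_le_ofReal (hC z)
  have hslice : Measurable fun t : ℝ => ENNReal.ofReal (Real.exp (-a z.2 * t))
      * ‖h (stream (-t) z)‖ₑ := by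
    have := hhs.comp (measurable_prodMk_left (x := z))
    fun_prop
  simp only [enorm_mul, Real.enorm_of_nonneg (Real.exp_pos _).le]
  rw [lintegral_mul_const _ hslice]
  exact mul_le_mul_right hΨz _

lemma integrable_streamResolvent_mul (ha : Measurable a) (hpos : ∀ v, 0 < a v)
    (hh : StronglyMeasurable h) (hi : Integrable h) {Ψ : Phase → ℝ} {C : ℝ} (hΨ : Measurable Ψ)
    (hC : ∀ z, |Ψ z| ≤ C * a z.2) :
    Integrable fun z => streamResolvent a h z * Ψ z := by
  simpa only [streamResolvent, integral_mul_const]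
    using (integrable_streamKernel ha hpos hh hi hΨ hC).integral_prod_left

lemma ae_integrableOn_exp_mul_stream (ha : Measurable a) (hpos : ∀ v, 0 < a v)
    (hh : StronglyMeasurable h) (hi : Integrable h) :
    ∀ᵐ z, IntegrableOn (fun t => Real.exp (-a z.2 * t) * h (stream (-t) z)) (Ioi 0) := by
  have hkernel := integrable_streamKernel ha hpos hh hi (Ψ := fun z => a z.2) (C := 1)
    (by fun_prop) fun z => by rw [abs_of_pos (hpos _), one_mul]
  filter_upwards [hkernel.prod_right_ae] with z hz
  exact (integrable_mul_const_iff (hpos z.2).ne'.isUnit _).1 hz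

/-- The adjoint of the resolvent is the resolvent of the backward flow. -/
lemma integral_streamResolvent_mul (ha : Measurable a) (hpos : ∀ v, 0 < a v)
    (hh : StronglyMeasurable h) (hi : Integrable h) {Ψ : Phase → ℝ} {C : ℝ} (hΨ : Measurable Ψ)
    (hC : ∀ z, |Ψ z| ≤ C * a z.2) :
    ∫ z, streamResolvent a h z * Ψ z
      = ∫ z, h z * ∫ t in Ioi (0 : ℝ), Real.exp (-a z.2 * t) * Ψ (stream t z) := by
  have hkernel := integrable_streamKernel ha hpos hh hi hΨ hC
  have hΘ := measurePreserving_stream_prod (volume.restrict (Ioi (0 : ℝ)))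
  have hkernel' := hΘ.integrable_comp_of_integrable hkernel
  calc ∫ z, streamResolvent a h z * Ψ z
      = ∫ q, Real.exp (-a q.1.2 * q.2) * h (stream (-q.2) q.1) * Ψ q.1
          ∂((volume : Measure Phase).prod (volume.restrict (Ioi 0))) := by
        rw [integral_prod _ hkernel]
        simp only [streamResolvent, integral_mul_const]
    _ = ∫ q, ((fun q : Phase × ℝ => Real.exp (-a q.1.2 * q.2) * h (stream (-q.2) q.1) * Ψ q.1) ∘
          fun q : Phase × ℝ => (stream q.2 q.1, q.2)) q
          ∂((volume : Measure Phase).prod (volume.restrict (Ioi 0))) := by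
        conv_lhs => rw [← hΘ.map_eq]
        exact integral_map hΘ.measurable.aemeasurable
          (hΘ.map_eq.symm ▸ hkernel.aestronglyMeasurable)
    _ = _ := by
        rw [integral_prod _ hkernel']
        simp only [Function.comp, stream_stream, neg_add_cancel, stream_zero, stream_snd,
          mul_comm _ (h _), mul_assoc (h _), integral_const_mul]

lemma streamResolvent_congr (hh : StronglyMeasurable h) (hh' : StronglyMeasurable h')
    (heq : h =ᵐ[volume] h') : streamResolvent a h =ᵐ[volume] streamResolvent a h' := by
  filter_upwards [ae_stream (measurableSet_eq_fun hh.measurable hh'.measurable) heq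
    (volume.restrict (Ioi 0))] with z hz
  refine integral_congr_ae ?_
  filter_upwards [hz] with t ht
  rw [ht]

lemma streamResolvent_nonneg (hh : StronglyMeasurable h) (h0 : ∀ᵐ z, 0 ≤ h z) :
    ∀ᵐ z, 0 ≤ streamResolvent a h z := by
  filter_upwards [ae_stream (measurableSet_le measurable_const hh.measurable) h0
    (volume.restrict (Ioi 0))] with z hz
  refine integral_nonneg_of_ae ?_
  filter_upwards [hz] with t ht
  exact mul_nonneg (Real.exp_pos _).le ht

lemma enorm_eq_lintegral (f : L1Phase) : ‖f‖ₑ = ∫⁻ z, ‖f z‖ₑ := by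
  rw [Lp.enorm_def, eLpNorm_one_eq_lintegral_enorm]

end StreamResolvent

section StreamResolventL1

variable {a : Vel → ℝ} {lam : ℝ}

lemma integrable_streamResolvent (ha : Measurable a) (hlam : 0 < lam) (hle : ∀ v, lam ≤ a v)
    {h : Phase → ℝ} (hh : StronglyMeasurable h) (hi : Integrable h) :
    Integrable (streamResolvent a h) := by
  simpa only [mul_one] using integrable_streamResolvent_mul ha (fun v => hlam.trans_le (hle v)) hh
    hi (Ψ := fun _ => 1) (C := lam⁻¹) measurable_const fun z => by
      rw [abs_one, inv_mul_eq_div, one_le_div hlam]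
      exact hle z.2

/-- `streamResolvent` as a linear map on `L¹`. -/
def streamResolventLinear (ha : Measurable a) (hlam : 0 < lam) (hle : ∀ v, lam ≤ a v) :
    L1Phase →ₗ[ℝ] L1Phase where
  toFun h := (integrable_streamResolvent ha hlam hle (Lp.stronglyMeasurable h)
    (L1.integrable_coeFn h)).toL1 (streamResolvent a h)
  map_add' h h' := by
    have hpos : ∀ v, 0 < a v := fun v => hlam.trans_le (hle v)
    rw [← Integrable.toL1_add, Integrable.toL1_eq_toL1_iff]
    refine (streamResolvent_congr (Lp.stronglyMeasurable _)
      ((Lp.stronglyMeasurable h).add (Lp.stronglyMeasurable h')) (Lp.coeFn_add h h')).trans ?_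
    filter_upwards [ae_integrableOn_exp_mul_stream ha hpos (Lp.stronglyMeasurable h)
      (L1.integrable_coeFn h), ae_integrableOn_exp_mul_stream ha hpos (Lp.stronglyMeasurable h')
      (L1.integrable_coeFn h')] with z hz hz'
    rw [Pi.add_apply, streamResolvent, streamResolvent, streamResolvent, ← integral_add hz hz']
    simp only [Pi.add_apply, mul_add]
  map_smul' r h := by
    rw [RingHom.id_apply, ← Integrable.toL1_smul, Integrable.toL1_eq_toL1_iff]
    refine (streamResolvent_congr (Lp.stronglyMeasurable _)
      ((Lp.stronglyMeasurable h).const_smul r) (Lp.coeFn_smul r h)).trans ?_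
    refine Eventually.of_forall fun z => ?_
    simp only [streamResolvent, Pi.smul_apply, smul_eq_mul, mul_left_comm _ r, integral_const_mul]

lemma norm_streamResolventLinear_le (ha : Measurable a) (hlam : 0 < lam) (hle : ∀ v, lam ≤ a v)
    (h : L1Phase) : ‖streamResolventLinear ha hlam hle h‖ ≤ lam⁻¹ * ‖h‖ := by
  have hpos : ∀ v, 0 < a v := fun v => hlam.trans_le (hle v)
  have hi := integrable_streamResolvent ha hlam hle (Lp.stronglyMeasurable h)
    (L1.integrable_coeFn h)
  have hR : streamResolventLinear ha hlam hle h = hi.toL1 _ := rfl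
  rw [inv_mul_eq_div, le_div_iff₀' hlam, ← ENNReal.ofReal_le_ofReal_iff (norm_nonneg _),
    ENNReal.ofReal_mul hlam.le, ofReal_norm, ofReal_norm, hR, Integrable.enorm_toL1,
    enorm_eq_lintegral]
  calc ENNReal.ofReal lam * ∫⁻ z, ‖streamResolvent a h z‖ₑ
      = ∫⁻ z, ‖streamResolvent a h z‖ₑ * (ENNReal.ofReal lam * 1) := by
        rw [mul_one, lintegral_mul_const _
          (stronglyMeasurable_streamResolvent ha (Lp.stronglyMeasurable h)).measurable.enorm,
          mul_comm]
    _ ≤ ∫⁻ z, ‖streamResolvent a h z‖ₑ * (ENNReal.ofReal (a z.2) * 1) := by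
        gcongr with z
        exact hle z.2
    _ ≤ ∫⁻ z, ‖h z‖ₑ * 1 := lintegral_streamResolvent_mul_rate_le ha hpos
        (Lp.stronglyMeasurable h).measurable (Φ := fun _ => 1) measurable_const
    _ = ∫⁻ z, ‖h z‖ₑ := by simp only [mul_one]

/-- `streamResolvent` as a bounded operator on `L¹`, of norm at most `lam⁻¹`. -/
def streamResolventL1 (ha : Measurable a) (hlam : 0 < lam) (hle : ∀ v, lam ≤ a v) :
    L1Phase →L[ℝ] L1Phase :=
  (streamResolventLinear ha hlam hle).mkContinuous lam⁻¹
    (norm_streamResolventLinear_le ha hlam hle)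

lemma coeFn_streamResolventL1 (ha : Measurable a) (hlam : 0 < lam) (hle : ∀ v, lam ≤ a v)
    (h : L1Phase) : streamResolventL1 ha hlam hle h =ᵐ[volume] streamResolvent a h :=
  (integrable_streamResolvent ha hlam hle (Lp.stronglyMeasurable h)
    (L1.integrable_coeFn h)).coeFn_toL1

lemma lintegral_streamResolventL1_mul_rate_le (ha : Measurable a) (hlam : 0 < lam)
    (hle : ∀ v, lam ≤ a v) (h : L1Phase) {Φ : Vel → ℝ≥0∞} (hΦ : Measurable Φ) :
    ∫⁻ z, ‖streamResolventL1 ha hlam hle h z‖ₑ * (ENNReal.ofReal (a z.2) * Φ z.2)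
      ≤ ∫⁻ z, ‖h z‖ₑ * Φ z.2 := by
  refine le_of_eq_of_le (lintegral_congr_ae ?_) (lintegral_streamResolvent_mul_rate_le ha
    (fun v => hlam.trans_le (hle v)) (Lp.stronglyMeasurable h).measurable hΦ)
  filter_upwards [coeFn_streamResolventL1 ha hlam hle h] with z hz
  rw [hz]

lemma streamResolventL1_nonneg (ha : Measurable a) (hlam : 0 < lam) (hle : ∀ v, lam ≤ a v)
    {h : L1Phase} (h0 : 0 ≤ h) : 0 ≤ streamResolventL1 ha hlam hle h := by
  rw [← Lp.coeFn_nonneg] at h0 ⊢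
  filter_upwards [coeFn_streamResolventL1 ha hlam hle h,
    streamResolvent_nonneg (a := a) (Lp.stronglyMeasurable h) h0] with z hz hz0
  rw [hz]
  exact hz0

lemma integral_streamResolventL1_mul (ha : Measurable a) (hlam : 0 < lam) (hle : ∀ v, lam ≤ a v)
    (h : L1Phase) {Ψ : Phase → ℝ} {C : ℝ} (hΨ : Measurable Ψ) (hC : ∀ z, |Ψ z| ≤ C * a z.2) :
    ∫ z, streamResolventL1 ha hlam hle h z * Ψ z
      = ∫ z, h z * ∫ t in Ioi (0 : ℝ), Real.exp (-a z.2 * t) * Ψ (stream t z) := by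
  rw [← integral_streamResolvent_mul ha (fun v => hlam.trans_le (hle v)) (Lp.stronglyMeasurable h)
    (L1.integrable_coeFn h) hΨ hC]
  refine integral_congr_ae ?_
  filter_upwards [coeFn_streamResolventL1 ha hlam hle h] with z hz
  rw [hz]

lemma integrable_streamResolventL1_mul (ha : Measurable a) (hlam : 0 < lam)
    (hle : ∀ v, lam ≤ a v) (h : L1Phase) {Ψ : Phase → ℝ} {C : ℝ} (hΨ : Measurable Ψ)
    (hC : ∀ z, |Ψ z| ≤ C * a z.2) :
    Integrable fun z => streamResolventL1 ha hlam hle h z * Ψ z := by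
  refine (integrable_streamResolvent_mul ha (fun v => hlam.trans_le (hle v))
    (Lp.stronglyMeasurable h) (L1.integrable_coeFn h) hΨ hC).congr ?_
  filter_upwards [coeFn_streamResolventL1 ha hlam hle h] with z hz
  rw [hz]

lemma integral_streamResolventL1_mul_rate (ha : Measurable a) (hlam : 0 < lam)
    (hle : ∀ v, lam ≤ a v) (h : L1Phase) :
    ∫ z, streamResolventL1 ha hlam hle h z * a z.2 = ∫ z, h z := by
  have hpos : ∀ v, 0 < a v := fun v => hlam.trans_le (hle v)
  rw [integral_streamResolventL1_mul ha hlam hle h (Ψ := fun z => a z.2) (C := 1) (by fun_prop)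
    (fun z => by rw [abs_of_pos (hpos _), one_mul])]
  refine integral_congr_ae (Eventually.of_forall fun z => ?_)
  simp only [stream_snd]
  rw [integral_mul_const, integral_exp_neg_mul_Ioi (hpos _), inv_mul_cancel₀ (hpos _).ne', mul_one]

end StreamResolventL1

/-! ### Strong continuity of the streaming resolvent at infinity -/

section StrongContinuity

variable {σ : Vel → ℝ} {h : Phase → ℝ}

lemma mul_streamResolvent_eq {r : ℝ} (hr : 0 < r) (σ : Vel → ℝ) (h : Phase → ℝ) (z : Phase) :
    r * streamResolvent (fun v => r + σ v) h z = ∫ s in Ioi (0 : ℝ),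
      Real.exp (-(1 + σ z.2 * r⁻¹) * s) * h (stream (-(r⁻¹ * s)) z) := by
  have hscale := integral_comp_mul_left_Ioi
    (fun t => Real.exp (-(r + σ z.2) * t) * h (stream (-t) z)) 0 (inv_pos.2 hr)
  rw [mul_zero, inv_inv, smul_eq_mul] at hscale
  rw [streamResolvent, ← hscale]
  refine setIntegral_congr_fun measurableSet_Ioi fun s _ => ?_
  congr 2
  field_simp

lemma norm_streamResolvent_le (hσ0 : ∀ v, 0 ≤ σ v) {C : ℝ} (hC : ∀ z, ‖h z‖ ≤ C) {r : ℝ}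
    (hr : 0 < r) (z : Phase) : ‖streamResolvent (fun v => r + σ v) h z‖ ≤ r⁻¹ * C := by
  rw [← integral_exp_neg_mul_Ioi hr, ← integral_mul_const]
  refine norm_integral_le_of_norm_le
    ((integrableOn_exp_mul_Ioi (by linarith) 0).mul_const C) ?_
  refine (ae_restrict_iff' measurableSet_Ioi).2 (Eventually.of_forall fun s (hs : 0 < s) => ?_)
  rw [norm_mul, Real.norm_of_nonneg (Real.exp_pos _).le]
  refine mul_le_mul (Real.exp_le_exp.2 ?_) (hC _) (norm_nonneg _) (Real.exp_pos _).le
  linarith [mul_nonneg (hσ0 z.2) hs.le]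

lemma tendsto_mul_streamResolvent (hσ0 : ∀ v, 0 ≤ σ v) (hc : Continuous h) {C : ℝ}
    (hC : ∀ z, ‖h z‖ ≤ C) (z : Phase) :
    Tendsto (fun n : ℕ => ((n : ℝ) + 1) * streamResolvent (fun v => n + 1 + σ v) h z) atTop
      (𝓝 (h z)) := by
  simp_rw [fun n : ℕ => mul_streamResolvent_eq (show (0 : ℝ) < n + 1 by positivity) σ h z]
  have hlimit : ∫ s in Ioi (0 : ℝ), Real.exp (-1 * s) * h z = h z := by
    rw [integral_mul_const, integral_exp_neg_mul_Ioi one_pos, inv_one, one_mul]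
  rw [← hlimit]
  have hstream (s : ℝ) : Continuous fun r : ℝ => stream (-(r * s)) z :=
    continuous_stream.comp (f := fun r : ℝ => (-(r * s), z)) (by fun_prop)
  refine tendsto_integral_of_dominated_convergence (fun s => Real.exp (-1 * s) * C)
    (fun n => ?_) ((integrableOn_exp_mul_Ioi (by norm_num) 0).mul_const C) (fun n => ?_) ?_
  · have : Continuous fun s : ℝ => stream (-(((n : ℝ) + 1)⁻¹ * s)) z :=
      continuous_stream.comp (f := fun s : ℝ => (-(((n : ℝ) + 1)⁻¹ * s), z)) (by fun_prop)
    exact Continuous.aestronglyMeasurable (by fun_prop)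
  · refine (ae_restrict_iff' measurableSet_Ioi).2 (Eventually.of_forall fun s (hs : 0 < s) => ?_)
    rw [norm_mul, Real.norm_of_nonneg (Real.exp_pos _).le]
    refine mul_le_mul (Real.exp_le_exp.2 ?_) (hC _) (norm_nonneg _) (Real.exp_pos _).le
    have : 0 ≤ σ z.2 * ((n : ℝ) + 1)⁻¹ * s := by
      have := hσ0 z.2
      positivity
    linarith
  · refine Eventually.of_forall fun s => ?_
    have hinv : Tendsto (fun n : ℕ => ((n : ℝ) + 1)⁻¹) atTop (𝓝 0) := by
      simpa using tendsto_one_div_add_atTop_nhds_zero_nat (𝕜 := ℝ)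
    have hcont : Continuous fun r : ℝ =>
        Real.exp (-(1 + σ z.2 * r) * s) * h (stream (-(r * s)) z) := by
      have := hstream s
      fun_prop
    simpa [Function.comp_def] using (hcont.tendsto 0).comp hinv

lemma exists_isCompact_stream_eq_zero (hs : HasCompactSupport h) :
    ∃ K : Set Phase, IsCompact K ∧ ∀ z ∉ K, ∀ t, h (stream t z) = 0 := by
  refine ⟨univ ×ˢ (Prod.snd '' tsupport h),
    isCompact_univ.prod (hs.isCompact.image continuous_snd), fun z hz t => ?_⟩
  refine image_eq_zero_of_notMem_tsupport fun ht => hz ⟨mem_univ _, _, ht, rfl⟩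

lemma tendsto_integral_norm_mul_streamResolvent_sub (hσ : Measurable σ) (hσ0 : ∀ v, 0 ≤ σ v)
    (hc : Continuous h) (hs : HasCompactSupport h) :
    Tendsto (fun n : ℕ => ∫ z, ‖((n : ℝ) + 1) * streamResolvent (fun v => n + 1 + σ v) h z - h z‖)
      atTop (𝓝 0) := by
  obtain ⟨C, hC⟩ := hs.exists_bound_of_continuous hc
  obtain ⟨K, hK, hzero⟩ := exists_isCompact_stream_eq_zero hs
  rw [← integral_zero Phase ℝ (μ := volume)]
  refine tendsto_integral_of_dominated_convergence (K.indicator fun _ => C + C) (fun n => ?_)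
    ((integrable_indicator_iff hK.measurableSet).2 (integrableOn_const hK.measure_ne_top))
    (fun n => Eventually.of_forall fun z => ?_) (Eventually.of_forall fun z => ?_)
  · exact ((((stronglyMeasurable_streamResolvent (by fun_prop) hc.stronglyMeasurable).const_mul
      ((n : ℝ) + 1)).sub hc.stronglyMeasurable).norm).aestronglyMeasurable
  · have hn : (0 : ℝ) < n + 1 := by positivity
    rw [norm_norm]
    by_cases hz : z ∈ K
    · rw [indicator_of_mem hz]
      refine (norm_sub_le _ _).trans (add_le_add ?_ (hC z))
      rw [norm_mul, Real.norm_of_nonneg hn.le, ← le_inv_mul_iff₀ hn]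
      exact norm_streamResolvent_le hσ0 hC hn z
    · have hz0 : h z = 0 := by simpa using hzero z hz 0
      simp [streamResolvent, hzero z hz, hz0, indicator_of_notMem hz]
  · simpa using ((tendsto_mul_streamResolvent hσ0 hc hC z).sub_const (h z)).norm

lemma tendsto_smul_streamResolventL1 (hσ : Measurable σ) (hσ0 : ∀ v, 0 ≤ σ v) (hc : Continuous h)
    (hs : HasCompactSupport h) (hi : Integrable h) :
    Tendsto (fun n : ℕ => ((n : ℝ) + 1) • streamResolventL1 (hσ.const_add ((n : ℝ) + 1))
      (by positivity) (fun v => le_add_of_nonneg_right (hσ0 v)) (hi.toL1 h))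
      atTop (𝓝 (hi.toL1 h)) := by
  rw [tendsto_iff_norm_sub_tendsto_zero]
  refine (tendsto_integral_norm_mul_streamResolvent_sub hσ hσ0 hc hs).congr fun n => ?_
  rw [L1.norm_eq_integral_norm]
  refine integral_congr_ae ?_
  have hn : (0 : ℝ) < n + 1 := by positivity
  have hle := fun v => le_add_of_nonneg_right (a := (n : ℝ) + 1) (hσ0 v)
  filter_upwards [Lp.coeFn_sub (((n : ℝ) + 1) • streamResolventL1 (hσ.const_add _) hn hle
      (hi.toL1 h)) (hi.toL1 h), hi.coeFn_toL1, Lp.coeFn_smul ((n : ℝ) + 1)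
      (streamResolventL1 (hσ.const_add _) hn hle (hi.toL1 h)),
    coeFn_streamResolventL1 (hσ.const_add _) hn hle (hi.toL1 h),
    streamResolvent_congr (a := fun v => n + 1 + σ v) (Lp.stronglyMeasurable (hi.toL1 h))
      hc.stronglyMeasurable hi.coeFn_toL1] with z hsub hh hsmul hres hcongr
  rw [hsub, Pi.sub_apply, hh, hsmul, Pi.smul_apply, hres, hcongr, smul_eq_mul]

lemma dense_of_streamResolventL1_mem (hσ : Measurable σ) (hσ0 : ∀ v, 0 ≤ σ v)
    {D : Submodule ℝ L1Phase}
    (hD : ∀ (lam : ℝ) (hlam : 0 < lam) h, streamResolventL1 (hσ.const_add lam) hlam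
      (fun v => le_add_of_nonneg_right (hσ0 v)) h ∈ D) :
    Dense (D : Set L1Phase) := by
  intro f
  rw [Metric.mem_closure_iff]
  intro ε hε
  have : IsLocallyFiniteMeasure (volume : Measure Phase) :=
    inferInstanceAs (IsLocallyFiniteMeasure
      ((volume : Measure Torus).prod (volume : Measure Vel)))
  obtain ⟨h, hs, hle, hc, hi⟩ := (L1.integrable_coeFn f).exists_hasCompactSupport_integral_sub_le
    (show 0 < ε / 2 by positivity)
  have hfh : dist f (hi.toL1 h) ≤ ε / 2 := by
    rw [dist_eq_norm, L1.norm_eq_integral_norm]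
    refine le_trans (le_of_eq (integral_congr_ae ?_)) hle
    filter_upwards [Lp.coeFn_sub f (hi.toL1 h), hi.coeFn_toL1] with z hsub hh
    rw [hsub, Pi.sub_apply, hh]
  obtain ⟨n, hn⟩ := Metric.tendsto_atTop.1 (tendsto_smul_streamResolventL1 hσ hσ0 hc hs hi) (ε / 2)
    (by positivity)
  refine ⟨_, D.smul_mem ((n : ℝ) + 1) (hD (n + 1) (by positivity) (hi.toL1 h)), ?_⟩
  have hhn := hn n le_rfl
  rw [dist_comm] at hhn
  linarith [dist_triangle f (hi.toL1 h) (((n : ℝ) + 1) • streamResolventL1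
    (hσ.const_add ((n : ℝ) + 1)) (by positivity) (fun v => le_add_of_nonneg_right (hσ0 v))
    (hi.toL1 h))]

end StrongContinuity

/-! ### The streaming resolvent solves the transport equation -/

lemma streamDeriv_eq (φ : Phase → ℝ) (z : Phase) :
    streamDeriv φ z = deriv (fun s => φ (stream s z)) 0 := rfl

lemma hasDerivAt_test_stream {φ : Phase → ℝ} (hφ : IsTestFunction φ) (z : Phase) (t : ℝ) :
    HasDerivAt (fun s => φ (stream s z)) (streamDeriv φ (stream t z)) t := by
  have hd : ∀ z, DifferentiableAt ℝ (fun s => φ (stream s z)) 0 := by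
    intro z
    obtain ⟨p, rfl⟩ := isOpenQuotientMap_cover.surjective z
    have hlift : (fun s => φ (stream s (cover p)))
        = (fun q => φ (cover q)) ∘ fun s : ℝ => (p.1 + fun i => s * p.2 i, p.2) := by
      funext s
      simp only [stream, cover, Function.comp, torusProj_add]
    rw [hlift]
    exact ((hφ.1.differentiable (by simp)) _).comp _ (by fun_prop)
  have hzero := (hd (stream t z)).hasDerivAt
  rw [← streamDeriv_eq, ← sub_self t] at hzero
  refine (hzero.comp_sub_const t t).congr_of_eventuallyEq (Eventually.of_forall fun s => ?_)
  simp only [stream_stream, sub_add_cancel]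

lemma exists_bound_test {φ : Phase → ℝ} (hφ : IsTestFunction φ) :
    ∃ C, (∀ z, |φ z| ≤ C) ∧ ∀ z, |streamDeriv φ z| ≤ C := by
  obtain ⟨C, hC⟩ := hφ.2.exists_bound_of_continuous hφ.continuous
  obtain ⟨C', hC'⟩ := hφ.hasCompactSupport_streamDeriv.exists_bound_of_continuous
    hφ.continuous_streamDeriv
  exact ⟨max C C', fun z => (hC z).trans (le_max_left _ _),
    fun z => (hC' z).trans (le_max_right _ _)⟩

lemma integrableOn_exp_neg_mul_mul {c C : ℝ} (hc : 0 < c) {f : ℝ → ℝ} (hf : Continuous f)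
    (hC : ∀ t, |f t| ≤ C) : IntegrableOn (fun t => Real.exp (-c * t) * f t) (Ioi 0) :=
  (integrableOn_exp_mul_Ioi (by linarith) 0).mul_bdd hf.aestronglyMeasurable
    (Eventually.of_forall hC)

lemma tendsto_exp_neg_mul_mul {c C : ℝ} (hc : 0 < c) {f : ℝ → ℝ} (hC : ∀ t, |f t| ≤ C) :
    Tendsto (fun t => Real.exp (-c * t) * f t) atTop (𝓝 0) :=
  (Real.tendsto_exp_atBot.comp
    (tendsto_id.const_mul_atTop_of_neg (by linarith))).zero_mul_isBoundedUnder_le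
    ⟨C, eventually_map.2 (Eventually.of_forall hC)⟩

lemma integral_exp_mul_streamDeriv_sub {c : ℝ} (hc : 0 < c) {φ : Phase → ℝ}
    (hφ : IsTestFunction φ) (z : Phase) :
    ∫ t in Ioi (0 : ℝ), Real.exp (-c * t) * (streamDeriv φ (stream t z) - c * φ (stream t z))
      = -φ z := by
  obtain ⟨C, hC, hC'⟩ := exists_bound_test hφ
  have hstream : Continuous fun t : ℝ => stream t z :=
    continuous_stream.comp (f := fun t : ℝ => (t, z)) (by fun_prop)
  have hderiv : ∀ t, HasDerivAt (fun t => Real.exp (-c * t) * φ (stream t z))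
      (Real.exp (-c * t) * (streamDeriv φ (stream t z) - c * φ (stream t z))) t := by
    intro t
    have hexp : HasDerivAt (fun t => Real.exp (-c * t)) (Real.exp (-c * t) * -c) t := by
      simpa using ((hasDerivAt_id t).const_mul (-c)).exp
    exact (hexp.mul (hasDerivAt_test_stream hφ z t)).congr_deriv (by ring)
  have hint := integrableOn_exp_neg_mul_mul (C := C + c * C) hc
    (f := fun t => streamDeriv φ (stream t z) - c * φ (stream t z))
    ((hφ.continuous_streamDeriv.comp hstream).sub ((hφ.continuous.comp hstream).const_mul c))
    fun t => (abs_sub _ _).trans <| by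
      rw [abs_mul, abs_of_pos hc]
      exact add_le_add (hC' _) (mul_le_mul_of_nonneg_left (hC _) hc.le)
  rw [integral_Ioi_of_hasDerivAt_of_tendsto (hderiv 0).continuousAt.continuousWithinAt
    (fun t _ => hderiv t) hint (tendsto_exp_neg_mul_mul hc fun t => hC _)]
  simp only [mul_zero, Real.exp_zero, one_mul, stream_zero, zero_sub]

lemma integrable_mul_transport_test {g : L1Vel} (lam : ℝ) {f : L1Phase}
    (hf : LocallyIntegrable (loss g f) volume) {φ : Phase → ℝ} (hφ : IsTestFunction φ) :
    Integrable fun z : Phase => f z * (streamDeriv φ z - (lam + collRate g z.2) * φ z) := by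
  have hderiv := integrable_mul_test (locallyIntegrable_coe f) hφ.continuous_streamDeriv
    hφ.hasCompactSupport_streamDeriv
  have hloss := integrable_mul_test hf hφ.continuous hφ.2
  have htest := integrable_mul_test (locallyIntegrable_coe f) hφ.continuous hφ.2
  refine ((hderiv.sub hloss).sub (htest.const_mul lam)).congr (Eventually.of_forall fun z => ?_)
  simp only [loss, Pi.sub_apply]
  ring

lemma integral_mul_transport_test {g : L1Vel} (lam : ℝ) {f : L1Phase}
    (hf : LocallyIntegrable (loss g f) volume) {φ : Phase → ℝ} (hφ : IsTestFunction φ) :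
    ∫ z, f z * (streamDeriv φ z - (lam + collRate g z.2) * φ z)
      = (∫ z, f z * streamDeriv φ z) - (∫ z, loss g f z * φ z) - lam * ∫ z, f z * φ z := by
  have hderiv := integrable_mul_test (locallyIntegrable_coe f) hφ.continuous_streamDeriv
    hφ.hasCompactSupport_streamDeriv
  have hloss := integrable_mul_test hf hφ.continuous hφ.2
  have htest := integrable_mul_test (locallyIntegrable_coe f) hφ.continuous hφ.2
  rw [← integral_const_mul, ← integral_sub hderiv hloss,
    ← integral_sub (by exact hderiv.sub hloss) (htest.const_mul lam)]
  refine integral_congr_ae (Eventually.of_forall fun z => ?_)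
  simp only [loss]
  ring

lemma integral_smul_sub_mul_test (lam : ℝ) (f h : L1Phase) {φ : Phase → ℝ}
    (hφ : IsTestFunction φ) :
    ∫ z, (lam • f - h) z * φ z = lam * (∫ z, f z * φ z) - ∫ z, h z * φ z := by
  have hf := integrable_mul_test (locallyIntegrable_coe f) hφ.continuous hφ.2
  have hh := integrable_mul_test (locallyIntegrable_coe h) hφ.continuous hφ.2
  rw [← integral_const_mul, ← integral_sub (hf.const_mul lam) hh]
  refine integral_congr_ae ?_
  filter_upwards [Lp.coeFn_sub (lam • f) h, Lp.coeFn_smul lam f] with z hsub hsmul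
  rw [hsub, Pi.sub_apply, hsmul, Pi.smul_apply, smul_eq_mul]
  ring

section Absorption

variable {g : L1Vel} {lam : ℝ}

variable (lam) in
/-- The resolvent of `-(v · ∂ₓ + Q⁻)`, the streaming resolvent with rate `lam + collRate g`. -/
def lossResolvent (hσ : Measurable (collRate g)) (hσ0 : ∀ v, 0 ≤ collRate g v) (hlam : 0 < lam) :
    L1Phase →L[ℝ] L1Phase :=
  streamResolventL1 (hσ.const_add lam) hlam fun v => le_add_of_nonneg_right (hσ0 v)

lemma integrable_loss_lossResolvent (hσ : Measurable (collRate g)) (hσ0 : ∀ v, 0 ≤ collRate g v)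
    (hlam : 0 < lam) (h : L1Phase) : Integrable (loss g (lossResolvent lam hσ hσ0 hlam h)) :=
  integrable_streamResolventL1_mul (hσ.const_add lam) hlam _ h (Ψ := fun z => collRate g z.2)
    (C := 1) (by fun_prop) fun z => by rw [abs_of_nonneg (hσ0 _)]; linarith

lemma integral_lossResolvent_mul_transport_test (hσ : Measurable (collRate g))
    (hσ0 : ∀ v, 0 ≤ collRate g v) (hlam : 0 < lam) (h : L1Phase) {φ : Phase → ℝ}
    (hφ : IsTestFunction φ) :
    ∫ z, lossResolvent lam hσ hσ0 hlam h z * (streamDeriv φ z - (lam + collRate g z.2) * φ z)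
      = -∫ z, h z * φ z := by
  obtain ⟨C, hC, hC'⟩ := exists_bound_test hφ
  have hC0 : 0 ≤ C := (abs_nonneg _).trans (hC 0)
  have hpos : ∀ v, 0 < lam + collRate g v := fun v => add_pos_of_pos_of_nonneg hlam (hσ0 v)
  have hbound : ∀ z : Phase, |streamDeriv φ z - (lam + collRate g z.2) * φ z|
      ≤ (C / lam + C) * (lam + collRate g z.2) := by
    intro z
    refine (abs_sub _ _).trans ?_
    rw [abs_mul, abs_of_pos (hpos _), add_mul (C / lam), mul_comm C]
    refine add_le_add ((hC' z).trans ?_) (mul_le_mul_of_nonneg_left (hC z) (hpos _).le)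
    rw [div_mul_eq_mul_div, le_div_iff₀ hlam]
    exact mul_le_mul_of_nonneg_left (le_add_of_nonneg_right (hσ0 _)) hC0
  have hmeas : Measurable fun z : Phase => streamDeriv φ z - (lam + collRate g z.2) * φ z :=
    hφ.continuous_streamDeriv.measurable.sub
      (Measurable.mul (by fun_prop) hφ.continuous.measurable)
  rw [lossResolvent, integral_streamResolventL1_mul _ _ _ h hmeas hbound]
  simp only [stream_snd, integral_exp_mul_streamDeriv_sub (hpos _) hφ, mul_neg, integral_neg]

lemma isTransportLoss_lossResolvent (hσ : Measurable (collRate g)) (hσ0 : ∀ v, 0 ≤ collRate g v)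
    (hlam : 0 < lam) (h : L1Phase) :
    IsTransportLoss g (lossResolvent lam hσ hσ0 hlam h)
      (lam • lossResolvent lam hσ hσ0 hlam h - h) := by
  have hloss := (integrable_loss_lossResolvent hσ hσ0 hlam h).locallyIntegrable
  refine ⟨hloss, fun φ hφ => ?_⟩
  rw [integral_smul_sub_mul_test lam _ h hφ]
  linarith [integral_mul_transport_test lam hloss hφ,
    integral_lossResolvent_mul_transport_test hσ hσ0 hlam h hφ]

end Absorption

/-! ### Uniqueness for the transport equation, by Fourier series in the position -/

/-- The phase `2π k · y` of the character of frequency `k`. -/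
def phaseDot (k : Fin 3 → ℤ) (y : Fin 3 → ℝ) : ℝ := 2 * Real.pi * ∑ i, k i * y i

@[fun_prop]
lemma contDiff_phaseDot (k : Fin 3 → ℤ) : ContDiff ℝ ∞ (phaseDot k) := by
  unfold phaseDot
  fun_prop

lemma phaseDot_smul (k : Fin 3 → ℤ) (s : ℝ) (v : Fin 3 → ℝ) :
    phaseDot k (fun i => s * v i) = s * phaseDot k v := by
  simp only [phaseDot, mul_left_comm _ s, ← Finset.mul_sum]

lemma mFourier_add_torusProj (k : Fin 3 → ℤ) (x : Torus) (y : Fin 3 → ℝ) :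
    UnitAddTorus.mFourier k (x + torusProj y)
      = UnitAddTorus.mFourier k x * Complex.exp (phaseDot k y * Complex.I) := by
  have hexp : Complex.exp (phaseDot k y * Complex.I)
      = ∏ i, fourier (T := 1) (k i) ((y i : ℝ) : UnitAddCircle) := by
    simp only [fourier_coe_apply]
    rw [← Complex.exp_sum]
    congr 1
    simp only [phaseDot, Complex.ofReal_mul, Complex.ofReal_sum, Finset.mul_sum, Finset.sum_mul]
    refine Finset.sum_congr rfl fun i _ => ?_
    push_cast
    ring
  rw [hexp]
  simp only [UnitAddTorus.mFourier, ContinuousMap.coe_mk]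
  rw [← Finset.prod_mul_distrib]
  refine Finset.prod_congr rfl fun i _ => ?_
  simp only [Pi.add_apply, torusProj, fourier_apply, smul_add, AddCircle.toCircle_add,
    Circle.coe_mul]

/-- The real part of the character `exp(2π i k · x)`. -/
def fourierRe (k : Fin 3 → ℤ) (x : Torus) : ℝ := (UnitAddTorus.mFourier k x).re

/-- The imaginary part of the character `exp(2π i k · x)`. -/
def fourierIm (k : Fin 3 → ℤ) (x : Torus) : ℝ := (UnitAddTorus.mFourier k x).im

lemma continuous_fourierRe (k : Fin 3 → ℤ) : Continuous (fourierRe k) :=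
  Complex.continuous_re.comp (UnitAddTorus.mFourier k).continuous

lemma continuous_fourierIm (k : Fin 3 → ℤ) : Continuous (fourierIm k) :=
  Complex.continuous_im.comp (UnitAddTorus.mFourier k).continuous

lemma fourierRe_add (k : Fin 3 → ℤ) (x : Torus) (y : Fin 3 → ℝ) :
    fourierRe k (x + torusProj y)
      = fourierRe k x * Real.cos (phaseDot k y) - fourierIm k x * Real.sin (phaseDot k y) := by
  simp only [fourierRe, fourierIm, mFourier_add_torusProj, Complex.mul_re,
    Complex.exp_ofReal_mul_I_re, Complex.exp_ofReal_mul_I_im]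

lemma fourierIm_add (k : Fin 3 → ℤ) (x : Torus) (y : Fin 3 → ℝ) :
    fourierIm k (x + torusProj y)
      = fourierRe k x * Real.sin (phaseDot k y) + fourierIm k x * Real.cos (phaseDot k y) := by
  simp only [fourierRe, fourierIm, mFourier_add_torusProj, Complex.mul_im,
    Complex.exp_ofReal_mul_I_re, Complex.exp_ofReal_mul_I_im]

lemma contDiff_fourierRe (k : Fin 3 → ℤ) : ContDiff ℝ ∞ fun y => fourierRe k (torusProj y) := by
  have htrig (y : Fin 3 → ℝ) : fourierRe k (torusProj y)
      = fourierRe k 0 * Real.cos (phaseDot k y) - fourierIm k 0 * Real.sin (phaseDot k y) := by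
    rw [← fourierRe_add, zero_add]
  simp only [htrig]
  fun_prop

lemma contDiff_fourierIm (k : Fin 3 → ℤ) : ContDiff ℝ ∞ fun y => fourierIm k (torusProj y) := by
  have htrig (y : Fin 3 → ℝ) : fourierIm k (torusProj y)
      = fourierRe k 0 * Real.sin (phaseDot k y) + fourierIm k 0 * Real.cos (phaseDot k y) := by
    rw [← fourierIm_add, zero_add]
  simp only [htrig]
  fun_prop

lemma isTestFunction_mul {c : Torus → ℝ} (hc : ContDiff ℝ ∞ fun y => c (torusProj y)) {χ : Vel → ℝ}
    (hχ : ContDiff ℝ ∞ χ) (hs : HasCompactSupport χ) :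
    IsTestFunction fun z => c z.1 * χ z.2 := by
  refine ⟨(hc.comp contDiff_fst).mul (hχ.comp contDiff_snd),
    HasCompactSupport.intro (isCompact_univ.prod hs.isCompact) fun z hz => ?_⟩
  have : χ z.2 = 0 := image_eq_zero_of_notMem_tsupport fun h => hz ⟨mem_univ _, h⟩
  rw [this, mul_zero]

lemma streamDeriv_fourierRe (k : Fin 3 → ℤ) (χ : Vel → ℝ) (z : Phase) :
    streamDeriv (fun z => fourierRe k z.1 * χ z.2) z
      = phaseDot k (fun i => z.2 i) * -fourierIm k z.1 * χ z.2 := by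
  unfold streamDeriv
  simp only [fourierRe_add, phaseDot_smul]
  set κ := phaseDot k fun i => z.2 i
  have hderiv : HasDerivAt (fun s : ℝ => (fourierRe k z.1 * Real.cos (s * κ)
      - fourierIm k z.1 * Real.sin (s * κ)) * χ z.2)
      ((fourierRe k z.1 * (-Real.sin (0 * κ) * (1 * κ))
        - fourierIm k z.1 * (Real.cos (0 * κ) * (1 * κ))) * χ z.2) 0 :=
    (((((hasDerivAt_id (0 : ℝ)).mul_const κ).cos).const_mul _).sub
      ((((hasDerivAt_id (0 : ℝ)).mul_const κ).sin).const_mul _)).mul_const _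
  rw [hderiv.deriv, zero_mul, Real.sin_zero, Real.cos_zero]
  ring

lemma streamDeriv_fourierIm (k : Fin 3 → ℤ) (χ : Vel → ℝ) (z : Phase) :
    streamDeriv (fun z => fourierIm k z.1 * χ z.2) z
      = phaseDot k (fun i => z.2 i) * fourierRe k z.1 * χ z.2 := by
  unfold streamDeriv
  simp only [fourierIm_add, phaseDot_smul]
  set κ := phaseDot k fun i => z.2 i
  have hderiv : HasDerivAt (fun s : ℝ => (fourierRe k z.1 * Real.sin (s * κ)
      + fourierIm k z.1 * Real.cos (s * κ)) * χ z.2)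
      ((fourierRe k z.1 * (Real.cos (0 * κ) * (1 * κ))
        + fourierIm k z.1 * (-Real.sin (0 * κ) * (1 * κ))) * χ z.2) 0 :=
    (((((hasDerivAt_id (0 : ℝ)).mul_const κ).sin).const_mul _).add
      ((((hasDerivAt_id (0 : ℝ)).mul_const κ).cos).const_mul _)).mul_const _
  rw [hderiv.deriv, zero_mul, Real.sin_zero, Real.cos_zero]
  ring

section CompactSpace

variable {X : Type*} [TopologicalSpace X] [CompactSpace X] [MeasurableSpace X]
  [OpensMeasurableSpace X] {μ : Measure X} {d : X → ℝ}

lemma integrable_mul_of_continuous (hd : Integrable d μ) {c : X → ℝ} (hc : Continuous c) :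
    Integrable (fun x => d x * c x) μ := by
  obtain ⟨C, hC⟩ := isCompact_univ.exists_bound_of_continuousOn hc.continuousOn
  exact hd.mul_bdd hc.aestronglyMeasurable (Eventually.of_forall fun x => hC x (mem_univ x))

lemma integrable_smul_continuousMap (hd : Integrable d μ) (p : C(X, ℂ)) :
    Integrable (fun x => d x • p x) μ :=
  hd.smul_bdd ‖p‖ p.continuous.aestronglyMeasurable
    (Eventually.of_forall fun x => p.norm_coe_le_norm x)

/-- The functional `p ↦ ∫ d p` on continuous functions given by an integrable density `d`. -/
def integralAgainst (hd : Integrable d μ) : C(X, ℂ) →L[ℂ] ℂ := LinearMap.mkContinuous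
  { toFun := fun p => ∫ x, d x • p x ∂μ
    map_add' := fun p q => by
      rw [← integral_add (integrable_smul_continuousMap hd p) (integrable_smul_continuousMap hd q)]
      simp only [ContinuousMap.add_apply, smul_add]
    map_smul' := fun r p => by
      simp only [RingHom.id_apply, ← integral_smul, ContinuousMap.smul_apply, smul_comm r] }
  (∫ x, ‖d x‖ ∂μ) fun p => by
    rw [← integral_mul_const]
    refine norm_integral_le_of_norm_le (hd.norm.mul_const _) (Eventually.of_forall fun x => ?_)
    rw [norm_smul]
    gcongr
    exact p.norm_coe_le_norm x

lemma re_integralAgainst (hd : Integrable d μ) (p : C(X, ℂ)) :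
    (integralAgainst hd p).re = ∫ x, d x * (p x).re ∂μ := by
  refine (Complex.reCLM.integral_comp_comm (integrable_smul_continuousMap hd p)).symm.trans ?_
  simp only [Complex.reCLM_apply, Complex.smul_re, smul_eq_mul]

lemma im_integralAgainst (hd : Integrable d μ) (p : C(X, ℂ)) :
    (integralAgainst hd p).im = ∫ x, d x * (p x).im ∂μ := by
  refine (Complex.imCLM.integral_comp_comm (integrable_smul_continuousMap hd p)).symm.trans ?_
  simp only [Complex.imCLM_apply, Complex.smul_im, smul_eq_mul]

end CompactSpace

lemma integral_mul_eq_zero_of_fourier {d : Torus → ℝ} (hd : Integrable d)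
    (hRe : ∀ k, ∫ x, d x * fourierRe k x = 0) (hIm : ∀ k, ∫ x, d x * fourierIm k x = 0)
    {ψ : Torus → ℝ} (hψ : Continuous ψ) : ∫ x, d x * ψ x = 0 := by
  have hker : (⊤ : Submodule ℂ C(Torus, ℂ)) ≤ (integralAgainst hd).ker := by
    rw [← UnitAddTorus.span_mFourier_closure_eq_top]
    refine Submodule.topologicalClosure_minimal _ (Submodule.span_le.2 ?_)
      (integralAgainst hd).isClosed_ker
    rintro _ ⟨k, rfl⟩
    exact Complex.ext ((re_integralAgainst hd _).trans (hRe k))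
      ((im_integralAgainst hd _).trans (hIm k))
  have hzero : integralAgainst hd ⟨fun x => (ψ x : ℂ), Complex.continuous_ofReal.comp hψ⟩ = 0 :=
    hker trivial
  simpa only [ContinuousMap.coe_mk, Complex.ofReal_re, Complex.zero_re, hzero, eq_comm]
    using re_integralAgainst hd ⟨fun x => (ψ x : ℂ), Complex.continuous_ofReal.comp hψ⟩

lemma integrable_mul_comp_fst {d : Phase → ℝ} (hd : Integrable d) {c : Torus → ℝ}
    (hc : Continuous c) : Integrable fun z : Phase => d z * c z.1 := by
  obtain ⟨C, hC⟩ := isCompact_univ.exists_bound_of_continuousOn hc.continuousOn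
  exact hd.mul_bdd (hc.comp continuous_fst).aestronglyMeasurable
    (Eventually.of_forall fun z => hC z.1 (mem_univ _))

lemma locallyIntegrable_mul_of_continuous {w u : Vel → ℝ} (hw : Continuous w) (hu : Integrable u) :
    LocallyIntegrable fun v => w v * u v :=
  locallyIntegrableOn_univ.1 <| (hu.locallyIntegrable.locallyIntegrableOn univ).continuousOn_mul
    hw.continuousOn isOpen_univ.isLocallyClosed

lemma locallyIntegrable_mul_of_abs_le {a u : Vel → ℝ} (ha : Measurable a) {C : ℝ}
    (hC : ∀ v, |a v| ≤ C * (1 + ‖v‖)) (hu : Integrable u) :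
    LocallyIntegrable fun v => a v * u v := by
  refine (locallyIntegrable_mul_of_continuous (w := fun v => C * (1 + ‖v‖)) (by fun_prop) hu).mono
    (ha.aestronglyMeasurable.mul hu.1) (Eventually.of_forall fun v => ?_)
  rw [norm_mul, norm_mul, Real.norm_eq_abs (a v), Real.norm_eq_abs (C * _)]
  exact mul_le_mul_of_nonneg_right ((hC v).trans (le_abs_self _)) (norm_nonneg _)

/-- `-v · ∂ₓ d = a(v) d` in the sense of distributions. -/
def IsTransportEigenfunction (a : Vel → ℝ) (d : Phase → ℝ) : Prop :=
  ∀ φ, IsTestFunction φ → Integrable (fun z : Phase => d z * (streamDeriv φ z - a z.2 * φ z)) ∧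
    ∫ z : Phase, d z * (streamDeriv φ z - a z.2 * φ z) = 0

section Uniqueness

variable {a : Vel → ℝ} {d : Phase → ℝ}

/-- The equation tested against `c(x) χ(v)` and then freed of the arbitrary `χ`. -/
lemma IsTransportEigenfunction.ae_eq_zero (hd : IsTransportEigenfunction a d) (hdi : Integrable d)
    (ha : Measurable a) {C : ℝ} (hC : ∀ v, |a v| ≤ C * (1 + ‖v‖)) (k : Fin 3 → ℤ)
    {c c' : Torus → ℝ} (hc : ContDiff ℝ ∞ fun y => c (torusProj y)) (hcc : Continuous c)
    (hcc' : Continuous c') (hderiv : ∀ (χ : Vel → ℝ) z, streamDeriv (fun z => c z.1 * χ z.2) z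
      = phaseDot k (fun i => z.2 i) * c' z.1 * χ z.2) :
    ∀ᵐ v : Vel, phaseDot k (fun i => v i) * (∫ x, d (x, v) * c' x)
      - a v * ∫ x, d (x, v) * c x = 0 := by
  refine ae_eq_zero_of_integral_contDiff_smul_eq_zero ((locallyIntegrable_mul_of_continuous
    ((contDiff_phaseDot k).continuous.comp (by fun_prop))
    (integrable_mul_comp_fst hdi hcc').integral_prod_right).sub
    (locallyIntegrable_mul_of_abs_le ha hC (integrable_mul_comp_fst hdi hcc).integral_prod_right))
    fun χ hχ hs => ?_
  obtain ⟨hint, hzero⟩ := hd _ (isTestFunction_mul hc hχ hs)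
  rw [← hzero, Measure.volume_eq_prod, integral_prod_symm _ hint]
  refine integral_congr_ae ?_
  filter_upwards [hdi.prod_left_ae] with v hv
  have hsplit (x : Torus) : d (x, v) * (phaseDot k (fun i => v i) * c' x * χ v - a v * (c x * χ v))
      = χ v * phaseDot k (fun i => v i) * (d (x, v) * c' x) - χ v * a v * (d (x, v) * c x) := by
    ring
  simp only [hderiv, hsplit]
  rw [integral_sub ((integrable_mul_of_continuous hv hcc').const_mul _)
    ((integrable_mul_of_continuous hv hcc).const_mul _), integral_const_mul, integral_const_mul,
    smul_eq_mul]
  ring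

lemma IsTransportEigenfunction.ae_fourier_eq_zero (hd : IsTransportEigenfunction a d)
    (hdi : Integrable d) (ha : Measurable a) (hpos : ∀ v, 0 < a v) {C : ℝ}
    (hC : ∀ v, |a v| ≤ C * (1 + ‖v‖)) (k : Fin 3 → ℤ) :
    ∀ᵐ v : Vel, ∫ x, d (x, v) * fourierRe k x = 0 ∧ ∫ x, d (x, v) * fourierIm k x = 0 := by
  filter_upwards [hd.ae_eq_zero hdi ha hC k (contDiff_fourierRe k) (continuous_fourierRe k)
      (continuous_fourierIm k).neg (streamDeriv_fourierRe k),
    hd.ae_eq_zero hdi ha hC k (contDiff_fourierIm k) (continuous_fourierIm k)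
      (continuous_fourierRe k) (streamDeriv_fourierIm k)] with v hRe hIm
  simp only [Pi.neg_apply, mul_neg, integral_neg] at hRe
  set r := ∫ x, d (x, v) * fourierRe k x
  set s := ∫ x, d (x, v) * fourierIm k x
  have hsum : a v * (r ^ 2 + s ^ 2) = 0 := by linear_combination -r * hRe - s * hIm
  have hsq : r ^ 2 + s ^ 2 = 0 := (mul_eq_zero.1 hsum).resolve_left (hpos v).ne'
  exact ⟨by nlinarith only [hsq, sq_nonneg r, sq_nonneg s],
    by nlinarith only [hsq, sq_nonneg r, sq_nonneg s]⟩

lemma IsTransportEigenfunction.eq_zero {d : L1Phase} (hd : IsTransportEigenfunction a d)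
    (ha : Measurable a) (hpos : ∀ v, 0 < a v) {C : ℝ} (hC : ∀ v, |a v| ≤ C * (1 + ‖v‖)) :
    d = 0 := by
  have hdi := L1.integrable_coeFn d
  refine eq_zero_of_integral_test d fun φ hφ => ?_
  refine (integral_prod_symm _ (integrable_mul_test (locallyIntegrable_coe d) hφ.continuous
    hφ.2)).trans (integral_eq_zero_of_ae ?_)
  filter_upwards [ae_all_iff.2 (hd.ae_fourier_eq_zero hdi ha hpos hC), hdi.prod_left_ae]
    with v hv hvi
  exact integral_mul_eq_zero_of_fourier hvi (fun k => (hv k).1) (fun k => (hv k).2)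
    (hφ.continuous.comp (by fun_prop : Continuous fun x : Torus => (x, v)))

end Uniqueness

lemma isTransportEigenfunction_of_isTransportLoss {g : L1Vel} {lam : ℝ} {d : L1Phase}
    (hd : IsTransportLoss g d (lam • d)) :
    IsTransportEigenfunction (fun v => lam + collRate g v) d := by
  refine fun φ hφ => ⟨integrable_mul_transport_test lam hd.1 hφ, ?_⟩
  have hsmul : ∫ z, (lam • d) z * φ z = lam * ∫ z, d z * φ z := by
    rw [← integral_const_mul]
    refine integral_congr_ae ?_
    filter_upwards [Lp.coeFn_smul lam d] with z hz
    rw [hz, Pi.smul_apply, smul_eq_mul, mul_assoc]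
  rw [integral_mul_transport_test lam hd.1 hφ, hd.2 φ hφ, hsmul, sub_self]

lemma eq_zero_of_isTransportLoss {g : L1Vel} {lam C : ℝ} (hσ : Measurable (collRate g))
    (hσ0 : ∀ v, 0 ≤ collRate g v) (hC : ∀ v, collRate g v ≤ C * (1 + ‖v‖)) (hlam : 0 < lam)
    {d : L1Phase} (hd : IsTransportLoss g d (lam • d)) : d = 0 := by
  have hpos : ∀ v, 0 < lam + collRate g v := fun v => add_pos_of_pos_of_nonneg hlam (hσ0 v)
  refine (isTransportEigenfunction_of_isTransportLoss hd).eq_zero (hσ.const_add lam) hpos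
    (C := lam + C) fun v => ?_
  rw [abs_of_pos (hpos v), add_mul]
  exact add_le_add (le_mul_of_one_le_right hlam.le (le_add_of_nonneg_right (norm_nonneg v))) (hC v)

/-! ### Collisions -/

section Sphere

open scoped Pointwise

variable {E : Type*} [NormedAddCommGroup E] [NormedSpace ℝ E] [MeasurableSpace E] [BorelSpace E]

lemma measurePreserving_neg_toSphere (μ : Measure E) [μ.IsNegInvariant] :
    MeasurePreserving (fun ν : Metric.sphere (0 : E) 1 => -ν) μ.toSphere μ.toSphere := by
  refine ⟨continuous_neg.measurable, Measure.ext fun s hs => ?_⟩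
  rw [Measure.map_apply continuous_neg.measurable hs,
    Measure.toSphere_apply' _ (continuous_neg.measurable hs), Measure.toSphere_apply' _ hs]
  have hcone : Ioo (0 : ℝ) 1 • ((↑) '' ((fun ν : Metric.sphere (0 : E) 1 => -ν) ⁻¹' s) : Set E)
      = -(Ioo (0 : ℝ) 1 • ((↑) '' s : Set E)) := by
    rw [← Set.smul_neg]
    congr 1
    ext v
    constructor
    · rintro ⟨ν, hν, rfl⟩
      exact ⟨-ν, hν, coe_neg_sphere ν⟩
    · rintro ⟨ν, hν, h⟩
      exact ⟨-ν, by rwa [mem_preimage, neg_neg], by rw [coe_neg_sphere, h, neg_neg]⟩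
  rw [hcone, Measure.measure_neg]

end Sphere

lemma measurePreserving_prodLeftComm {α β γ : Type*} [MeasurableSpace α] [MeasurableSpace β]
    [MeasurableSpace γ] (μ : Measure α) (ν : Measure β) (ρ : Measure γ) [SFinite μ] [SFinite ν]
    [SFinite ρ] : MeasurePreserving (fun p : α × β × γ => (p.2.1, p.1, p.2.2))
      (μ.prod (ν.prod ρ)) (ν.prod (μ.prod ρ)) :=
  (measurePreserving_prodAssoc ν μ ρ).comp
    ((Measure.measurePreserving_swap.prod (MeasurePreserving.id ρ)).comp
      ((measurePreserving_prodAssoc μ ν ρ).symm MeasurableEquiv.prodAssoc))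

lemma inner_self_sphere (ν : Sph) : inner ℝ (ν : Vel) (ν : Vel) = (1 : ℝ) := by
  rw [real_inner_self_eq_norm_sq, norm_eq_of_mem_sphere, one_pow]

lemma collMap_comp_collMap (ν : Sph) :
    collMap (ν : Vel) ∘ₗ collMap (ν : Vel) = LinearMap.id := by
  refine LinearMap.ext fun q => Prod.ext ?_ ?_ <;>
  · simp only [collMap, LinearMap.comp_apply, LinearMap.coe_mk, AddHom.coe_mk, LinearMap.id_apply,
      inner_add_right, inner_sub_right, inner_smul_right, inner_self_sphere]
    module

lemma measurePreserving_collMap (ν : Sph) :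
    MeasurePreserving (collMap (ν : Vel))
      ((volume : Measure Vel).prod volume) ((volume : Measure Vel).prod volume) := by
  have hdet : LinearMap.det (collMap (ν : Vel)) * LinearMap.det (collMap (ν : Vel)) = 1 := by
    rw [← LinearMap.det_comp, collMap_comp_collMap, LinearMap.det_id]
  have habs : |LinearMap.det (collMap (ν : Vel))| = 1 := (abs_eq zero_le_one).2
    (mul_self_eq_one_iff.1 hdet)
  refine ⟨(LinearMap.continuous_of_finiteDimensional _).measurable, ?_⟩
  rw [Measure.map_linearMap_addHaar_eq_smul_addHaar _ (left_ne_zero_of_mul_eq_one hdet), abs_inv,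
    habs, inv_one, ENNReal.ofReal_one, one_smul]

/-- The collision `(v, ν, v̄) ↦ (v', -ν, v̄')` at a fixed position; the sign of `ν` makes it
preserve the collision kernel. -/
def collFlip (q : Phase × (Sph × Vel)) : Phase × (Sph × Vel) :=
  ((q.1.1, preVel q.1.2 q.2), (-q.2.1, preVelBar q.1.2 q.2))

lemma preVel_flip (v : Vel) (p : Sph × Vel) :
    preVel (preVel v p) (-p.1, preVelBar v p) = v := by
  simp only [preVel, preVelBar, coe_neg_sphere, inner_neg_left, inner_sub_right,
    inner_add_right, inner_smul_right, inner_self_sphere]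
  module

lemma collKernel_flip (v : Vel) (p : Sph × Vel) :
    collKernel (preVel v p) (-p.1, preVelBar v p) = collKernel v p := by
  unfold collKernel
  congr 1
  simp only [preVel, preVelBar, coe_neg_sphere, inner_neg_right, inner_sub_left, inner_add_left,
    inner_sub_right, real_inner_smul_left, inner_self_sphere, real_inner_comm v,
    real_inner_comm p.2]
  ring

lemma measurePreserving_neg_collMap :
    MeasurePreserving (fun q : Sph × (Vel × Vel) => (-q.1, collMap (q.1 : Vel) q.2))
      (sphMeasure.prod ((volume : Measure Vel).prod volume))
      (sphMeasure.prod ((volume : Measure Vel).prod volume)) := by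
  refine (measurePreserving_neg_toSphere (volume : Measure Vel)).skew_product
    (μc := (volume : Measure Vel).prod volume) (μd := (volume : Measure Vel).prod volume)
    (g := fun ν q => collMap (ν : Vel) q) ?_
    (Eventually.of_forall fun ν => (measurePreserving_collMap ν).map_eq)
  simp only [Function.uncurry_def, collMap, LinearMap.coe_mk, AddHom.coe_mk]
  fun_prop

lemma measurePreserving_collFlip :
    MeasurePreserving collFlip ((volume : Measure Phase).prod collMeasure)
      ((volume : Measure Phase).prod collMeasure) := by
  have hvel := (measurePreserving_prodLeftComm sphMeasure (volume : Measure Vel)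
    (volume : Measure Vel)).comp (measurePreserving_neg_collMap.comp
      (measurePreserving_prodLeftComm (volume : Measure Vel) sphMeasure (volume : Measure Vel)))
  have hassoc := measurePreserving_prodAssoc (volume : Measure Torus) (volume : Measure Vel)
    collMeasure
  exact (hassoc.symm MeasurableEquiv.prodAssoc).comp
    (((MeasurePreserving.id (volume : Measure Torus)).prod hvel).comp hassoc)

/-! ### Estimates of the collision kernel -/

lemma measurable_collKernel : Measurable fun q : Vel × (Sph × Vel) => collKernel q.1 q.2 := by
  unfold collKernel
  fun_prop

lemma collKernel_nonneg (v : Vel) (p : Sph × Vel) : 0 ≤ collKernel v p := le_max_right _ _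

lemma collKernel_le_norm_sub (v : Vel) (p : Sph × Vel) : collKernel v p ≤ ‖v - p.2‖ := by
  refine max_le ((real_inner_le_norm _ _).trans_eq ?_) (norm_nonneg _)
  rw [norm_eq_of_mem_sphere, mul_one]

lemma collKernel_le (v : Vel) (p : Sph × Vel) :
    collKernel v p ≤ 2 * (1 + ‖v‖) * (1 + ‖p.2‖ ^ 2) := by
  refine (collKernel_le_norm_sub v p).trans ((norm_sub_le _ _).trans ?_)
  nlinarith [sq_nonneg (‖p.2‖ - 1), mul_nonneg (norm_nonneg v) (sq_nonneg ‖p.2‖), norm_nonneg v]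

lemma max_sub_mul_sub_le {a b n n' : ℝ} (hn : 0 ≤ n)
    (hsq : n' ^ 2 = n ^ 2 - a ^ 2 + b ^ 2) (hle : n' ≤ n + |b - a|) :
    max (a - b) 0 * (n' - n) ≤ 4 * b ^ 2 := by
  rcases le_or_gt a b with hab | hab
  · rw [max_eq_right (sub_nonpos.2 hab), zero_mul]
    positivity
  rw [max_eq_left (sub_pos.2 hab).le]
  rcases le_or_gt n' n with hnn | hnn
  · exact (mul_nonpos_of_nonneg_of_nonpos (sub_pos.2 hab).le (sub_nonpos.2 hnn)).trans
      (by positivity)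
  -- The speed grows only if `|a| < |b|`, and then both factors are at most `2|b|`.
  have hlt : |a| < |b| := sq_lt_sq.1 (by nlinarith only [hnn, hn, hsq])
  have hdiff : a - b ≤ 2 * |b| := by linarith only [hlt, le_abs_self a, neg_abs_le b]
  have hspeed : n' - n ≤ a - b := by
    rw [abs_sub_comm, abs_of_pos (sub_pos.2 hab)] at hle
    linarith only [hle]
  calc (a - b) * (n' - n) ≤ 2 * |b| * (2 * |b|) :=
        mul_le_mul hdiff (hspeed.trans hdiff) (sub_pos.2 hnn).le (by positivity)
    _ = 4 * b ^ 2 := by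
        rw [← sq_abs b]
        ring

/-- The growth of the speed in a collision, weighted with the kernel, does not depend on `v`. -/
lemma collKernel_mul_norm_preVel_sub_le (v : Vel) (p : Sph × Vel) :
    collKernel v p * (‖preVel v p‖ - ‖v‖) ≤ 4 * ‖p.2‖ ^ 2 := by
  have hν : ‖(p.1 : Vel)‖ = 1 := norm_eq_of_mem_sphere _
  set a : ℝ := inner ℝ (p.1 : Vel) v with ha
  set b : ℝ := inner ℝ (p.1 : Vel) p.2
  have hkernel : collKernel v p = max (a - b) 0 := by
    rw [collKernel, inner_sub_left, real_inner_comm, real_inner_comm (p.1 : Vel) p.2]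
  have hpre : preVel v p = v + (b - a) • (p.1 : Vel) := by rw [preVel, inner_sub_right]
  have hsq : ‖preVel v p‖ ^ 2 = ‖v‖ ^ 2 - a ^ 2 + b ^ 2 := by
    rw [hpre, norm_add_sq_real, inner_smul_right, norm_smul, hν, real_inner_comm, ← ha,
      Real.norm_eq_abs, mul_one, sq_abs]
    ring
  have hdist : ‖preVel v p‖ ≤ ‖v‖ + |b - a| := by
    rw [hpre]
    refine (norm_add_le _ _).trans_eq ?_
    rw [norm_smul, hν, mul_one, Real.norm_eq_abs]
  have hb_le : |b| ≤ ‖p.2‖ := by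
    simpa only [hν, one_mul] using abs_real_inner_le_norm (p.1 : Vel) p.2
  rw [hkernel]
  calc _ ≤ 4 * b ^ 2 := max_sub_mul_sub_le (norm_nonneg v) hsq hdist
    _ ≤ 4 * ‖p.2‖ ^ 2 := by
        rw [← sq_abs b]
        gcongr

/-! ### The collision rate -/

/-- A nonnegative background density with finite second moment. -/
structure IsBackground (g : L1Vel) : Prop where
  nonneg : 0 ≤ g
  integrable_moment : Integrable fun v : Vel => g v * (1 + ‖v‖ ^ 2)

/-- The second moment `∫ g(v̄) (1 + |v̄|²) dv̄ dν`. -/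
def collMoment (g : L1Vel) : ℝ := ∫ p, g p.2 * (1 + ‖p.2‖ ^ 2) ∂collMeasure

section Rate

variable {g : L1Vel}

lemma ae_nonneg_coll (hg : 0 ≤ g) : ∀ᵐ p ∂collMeasure, 0 ≤ g p.2 :=
  Measure.quasiMeasurePreserving_snd.ae ((Lp.coeFn_nonneg g).2 hg)

lemma stronglyMeasurable_coll (g : L1Vel) :
    StronglyMeasurable fun q : Vel × (Sph × Vel) => g q.2.2 * collKernel q.1 q.2 :=
  ((Lp.stronglyMeasurable g).comp_measurable measurable_snd.snd).mul
    measurable_collKernel.stronglyMeasurable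

lemma measurable_enorm_coll (g : L1Vel) (v : Vel) :
    Measurable fun p : Sph × Vel => ‖g p.2 * collKernel v p‖ₑ :=
  ((stronglyMeasurable_coll g).measurable.comp measurable_prodMk_left).enorm

lemma measurable_collRate (g : L1Vel) : Measurable (collRate g) :=
  (StronglyMeasurable.integral_prod_right' (stronglyMeasurable_coll g)).measurable

lemma collRate_nonneg (hg : 0 ≤ g) (v : Vel) : 0 ≤ collRate g v :=
  integral_nonneg_of_ae <| (ae_nonneg_coll hg).mono fun _ hp =>
    mul_nonneg hp (collKernel_nonneg _ _)

lemma collMoment_nonneg (hg : 0 ≤ g) : 0 ≤ collMoment g :=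
  integral_nonneg_of_ae <| (ae_nonneg_coll hg).mono fun _ hp => mul_nonneg hp (by positivity)

lemma mul_collKernel_le {c : ℝ} (hc : 0 ≤ c) (v : Vel) (p : Sph × Vel) :
    c * collKernel v p ≤ 2 * (1 + ‖v‖) * (c * (1 + ‖p.2‖ ^ 2)) := by
  linear_combination mul_le_mul_of_nonneg_left (collKernel_le v p) hc

namespace IsBackground

lemma integrable_moment_coll (hg : IsBackground g) :
    Integrable (fun p : Sph × Vel => g p.2 * (1 + ‖p.2‖ ^ 2)) collMeasure :=
  hg.integrable_moment.comp_snd sphMeasure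

lemma integrable_coll (hg : IsBackground g) (v : Vel) :
    Integrable (fun p : Sph × Vel => g p.2 * collKernel v p) collMeasure := by
  refine (hg.integrable_moment_coll.const_mul (2 * (1 + ‖v‖))).mono'
    ((stronglyMeasurable_coll g).comp_measurable measurable_prodMk_left).aestronglyMeasurable ?_
  filter_upwards [ae_nonneg_coll hg.nonneg] with p hp
  rw [norm_mul, Real.norm_of_nonneg hp, Real.norm_of_nonneg (collKernel_nonneg _ _)]
  exact mul_collKernel_le hp v p

lemma collRate_le (hg : IsBackground g) (v : Vel) :
    collRate g v ≤ 2 * collMoment g * (1 + ‖v‖) := by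
  calc collRate g v ≤ ∫ p, 2 * (1 + ‖v‖) * (g p.2 * (1 + ‖p.2‖ ^ 2)) ∂collMeasure :=
        integral_mono_ae (hg.integrable_coll v) (hg.integrable_moment_coll.const_mul _)
          ((ae_nonneg_coll hg.nonneg).mono fun p hp => mul_collKernel_le hp v p)
    _ = 2 * collMoment g * (1 + ‖v‖) := by
        rw [integral_const_mul, collMoment]
        ring

lemma lintegral_coll (hg : IsBackground g) (v : Vel) :
    ∫⁻ p, ‖g p.2 * collKernel v p‖ₑ ∂collMeasure = ENNReal.ofReal (collRate g v) := by
  have hnonneg : ∀ᵐ p ∂collMeasure, 0 ≤ g p.2 * collKernel v p :=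
    (ae_nonneg_coll hg.nonneg).mono fun p hp => mul_nonneg hp (collKernel_nonneg _ _)
  rw [collRate, ofReal_integral_eq_lintegral_ofReal (hg.integrable_coll v) hnonneg]
  exact lintegral_congr_ae (hnonneg.mono fun p hp => Real.enorm_of_nonneg hp)

lemma lintegral_coll_preVel_le (hg : IsBackground g) (v : Vel) :
    ∫⁻ p, ‖g p.2 * collKernel v p‖ₑ * ENNReal.ofReal (1 + ‖preVel v p‖) ∂collMeasure
      ≤ ENNReal.ofReal (collRate g v) * ENNReal.ofReal (1 + ‖v‖)
        + ENNReal.ofReal (4 * collMoment g) := by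
  have hmeas := measurable_enorm_coll g v
  have hmoment : ENNReal.ofReal (4 * collMoment g)
      = ∫⁻ p, ENNReal.ofReal (4 * (g p.2 * (1 + ‖p.2‖ ^ 2))) ∂collMeasure := by
    rw [collMoment, ← integral_const_mul]
    exact ofReal_integral_eq_lintegral_ofReal (hg.integrable_moment_coll.const_mul 4)
      ((ae_nonneg_coll hg.nonneg).mono fun p hp => by positivity)
  rw [← hg.lintegral_coll, ← lintegral_mul_const _ hmeas, hmoment,
    ← lintegral_add_left (hmeas.mul_const _)]
  refine lintegral_mono_ae ?_
  filter_upwards [ae_nonneg_coll hg.nonneg] with p hp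
  have hk := mul_nonneg hp (collKernel_nonneg v p)
  rw [Real.enorm_of_nonneg hk, ← ENNReal.ofReal_mul hk, ← ENNReal.ofReal_mul hk,
    ← ENNReal.ofReal_add (by positivity) (by positivity)]
  refine ENNReal.ofReal_le_ofReal ?_
  linear_combination mul_le_mul_of_nonneg_left (collKernel_mul_norm_preVel_sub_le v p) hp + 4 * hp

end IsBackground

end Rate

/-! ### The gain term -/

/-- The density `f(x, v) g(v̄) [(v - v̄) · ν]₊` of collisions. -/
def collDensity (g : L1Vel) (f : L1Phase) (q : Phase × (Sph × Vel)) : ℝ :=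
  f q.1 * (g q.2.2 * collKernel q.1.2 q.2)

section Gain

variable {g : L1Vel} {f : L1Phase}

lemma stronglyMeasurable_collDensity (g : L1Vel) (f : L1Phase) :
    StronglyMeasurable (collDensity g f) :=
  ((Lp.stronglyMeasurable f).comp_measurable measurable_fst).mul
    ((stronglyMeasurable_coll g).comp_measurable (measurable_fst.snd.prodMk measurable_snd))

lemma gainIntegrand_eq (g : L1Vel) (f : L1Phase) (z : Phase) (p : Sph × Vel) :
    gainIntegrand g f z p = collDensity g f (collFlip (z, p)) := by
  simp only [gainIntegrand, collDensity, collFlip, collKernel_flip]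
  ring

lemma gain_eq_integral (g : L1Vel) (f : L1Phase) (z : Phase) :
    gain g f z = ∫ p, collDensity g f (collFlip (z, p)) ∂collMeasure := by
  simp only [gain, gainIntegrand_eq]

lemma lintegral_collDensity_collFlip (g : L1Vel) (f : L1Phase) {Φ : Vel → ℝ≥0∞}
    (hΦ : Measurable Φ) :
    ∫⁻ q, ‖collDensity g f (collFlip q)‖ₑ * Φ q.1.2 ∂((volume : Measure Phase).prod collMeasure)
      = ∫⁻ z, ‖f z‖ₑ * ∫⁻ p, ‖g p.2 * collKernel z.2 p‖ₑ * Φ (preVel z.2 p) ∂collMeasure := by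
  have hmeas : Measurable fun q => ‖collDensity g f q‖ₑ * Φ (preVel q.1.2 q.2) :=
    (stronglyMeasurable_collDensity g f).measurable.enorm.mul
      (hΦ.comp (measurable_preVel.comp (measurable_fst.snd.prodMk measurable_snd)))
  calc ∫⁻ q, ‖collDensity g f (collFlip q)‖ₑ * Φ q.1.2
        ∂((volume : Measure Phase).prod collMeasure)
      = ∫⁻ q, ‖collDensity g f (collFlip q)‖ₑ * Φ (preVel (collFlip q).1.2 (collFlip q).2)
          ∂((volume : Measure Phase).prod collMeasure) :=
        lintegral_congr fun q => by simp only [collFlip, preVel_flip]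
    _ = ∫⁻ q, ‖collDensity g f q‖ₑ * Φ (preVel q.1.2 q.2)
          ∂((volume : Measure Phase).prod collMeasure) :=
        measurePreserving_collFlip.lintegral_comp hmeas
    _ = ∫⁻ z, ∫⁻ p, ‖collDensity g f (z, p)‖ₑ * Φ (preVel z.2 p) ∂collMeasure :=
        lintegral_prod _ hmeas.aemeasurable
    _ = _ := by
        refine lintegral_congr fun z => ?_
        have hmeas_z : Measurable fun p => ‖g p.2 * collKernel z.2 p‖ₑ * Φ (preVel z.2 p) :=
          (measurable_enorm_coll g z.2).mul
            (hΦ.comp (measurable_preVel.comp measurable_prodMk_left))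
        rw [← lintegral_const_mul _ hmeas_z]
        simp only [collDensity, enorm_mul, mul_assoc]

lemma lintegral_gain_mul_le (g : L1Vel) (f : L1Phase) {Φ : Vel → ℝ≥0∞} (hΦ : Measurable Φ) :
    ∫⁻ z, ‖gain g f z‖ₑ * Φ z.2
      ≤ ∫⁻ z, ‖f z‖ₑ * ∫⁻ p, ‖g p.2 * collKernel z.2 p‖ₑ * Φ (preVel z.2 p) ∂collMeasure := by
  have hmeas : Measurable fun q => ‖collDensity g f (collFlip q)‖ₑ :=
    (stronglyMeasurable_collDensity g f).measurable.enorm.comp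
      measurePreserving_collFlip.measurable
  calc ∫⁻ z, ‖gain g f z‖ₑ * Φ z.2
      ≤ ∫⁻ z, ∫⁻ p, ‖collDensity g f (collFlip (z, p))‖ₑ * Φ z.2 ∂collMeasure := by
        refine lintegral_mono fun z => ?_
        have hmeas_z : Measurable fun p => ‖collDensity g f (collFlip (z, p))‖ₑ :=
          hmeas.comp measurable_prodMk_left
        rw [lintegral_mul_const _ hmeas_z, gain_eq_integral]
        gcongr
        exact enorm_integral_le_lintegral_enorm _
    _ = ∫⁻ q, ‖collDensity g f (collFlip q)‖ₑ * Φ q.1.2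
          ∂((volume : Measure Phase).prod collMeasure) :=
        (lintegral_prod _ (hmeas.mul (hΦ.comp measurable_fst.snd)).aemeasurable).symm
    _ = _ := lintegral_collDensity_collFlip g f hΦ

lemma gain_nonneg (hg : 0 ≤ g) (hf : 0 ≤ f) : ∀ᵐ z, 0 ≤ gain g f z := by
  have hdensity : ∀ᵐ q ∂((volume : Measure Phase).prod collMeasure), 0 ≤ collDensity g f q := by
    filter_upwards [Measure.quasiMeasurePreserving_fst.ae ((Lp.coeFn_nonneg f).2 hf),
      Measure.quasiMeasurePreserving_snd.ae (ae_nonneg_coll hg)] with q hfq hgq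
    exact mul_nonneg hfq (mul_nonneg hgq (collKernel_nonneg _ _))
  filter_upwards [Measure.ae_ae_of_ae_prod
    (measurePreserving_collFlip.quasiMeasurePreserving.ae hdensity)] with z hz
  rw [gain_eq_integral]
  exact integral_nonneg_of_ae hz

namespace IsBackground

lemma lintegral_gain_le (hg : IsBackground g) (f : L1Phase) :
    ∫⁻ z, ‖gain g f z‖ₑ ≤ ∫⁻ z, ‖f z‖ₑ * ENNReal.ofReal (collRate g z.2) := by
  simpa only [mul_one, hg.lintegral_coll] using
    lintegral_gain_mul_le g f (Φ := fun _ => 1) measurable_const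

lemma lintegral_gain_weight_le (hg : IsBackground g) (f : L1Phase) :
    ∫⁻ z, ‖gain g f z‖ₑ * ENNReal.ofReal (1 + ‖z.2‖)
      ≤ (∫⁻ z, ‖f z‖ₑ * (ENNReal.ofReal (collRate g z.2) * ENNReal.ofReal (1 + ‖z.2‖)))
        + ENNReal.ofReal (4 * collMoment g) * ‖f‖ₑ := by
  have hmeas : Measurable fun z => ‖f z‖ₑ := (Lp.stronglyMeasurable f).measurable.enorm
  have hrate := measurable_collRate g
  calc _ ≤ ∫⁻ z, ‖f z‖ₑ * (ENNReal.ofReal (collRate g z.2) * ENNReal.ofReal (1 + ‖z.2‖)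
          + ENNReal.ofReal (4 * collMoment g)) := by
        refine (lintegral_gain_mul_le g f (Φ := fun v => ENNReal.ofReal (1 + ‖v‖))
          (by fun_prop)).trans (lintegral_mono fun z => ?_)
        gcongr
        exact hg.lintegral_coll_preVel_le z.2
    _ = _ := by
        simp only [mul_add]
        rw [lintegral_add_left (by fun_prop), lintegral_mul_const _ hmeas, enorm_eq_lintegral,
          mul_comm (ENNReal.ofReal _)]

lemma integrable_collDensity (hg : IsBackground g) (hf : Integrable (loss g f)) :
    Integrable (collDensity g f) ((volume : Measure Phase).prod collMeasure) := by
  have hmeas := stronglyMeasurable_collDensity g f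
  refine ⟨hmeas.aestronglyMeasurable, ?_⟩
  rw [HasFiniteIntegral, lintegral_prod _ hmeas.measurable.enorm.aemeasurable]
  refine (lintegral_congr fun z => ?_).trans_lt hf.2
  simp only [collDensity, enorm_mul (f z)]
  rw [lintegral_const_mul _ (measurable_enorm_coll g z.2), hg.lintegral_coll, loss, enorm_mul,
    Real.enorm_of_nonneg (collRate_nonneg hg.nonneg _)]

lemma gainIntegrable (hg : IsBackground g) (hf : Integrable (loss g f)) :
    GainIntegrable g f := by
  have hflip := measurePreserving_collFlip.integrable_comp_of_integrable
    (hg.integrable_collDensity hf)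
  refine ⟨?_, hflip.integral_prod_left.congr
    (Eventually.of_forall fun z => (gain_eq_integral g f z).symm)⟩
  filter_upwards [hflip.prod_right_ae] with z hz
  exact hz.congr (Eventually.of_forall fun p => (gainIntegrand_eq g f z p).symm)

lemma integral_gain (hg : IsBackground g) (hf : Integrable (loss g f)) :
    ∫ z, gain g f z = ∫ z, loss g f z := by
  have hdensity := hg.integrable_collDensity hf
  have hflip := measurePreserving_collFlip.integrable_comp_of_integrable hdensity
  calc ∫ z, gain g f z = ∫ q, (collDensity g f ∘ collFlip) q
        ∂((volume : Measure Phase).prod collMeasure) := by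
        rw [integral_prod _ hflip]
        exact integral_congr_ae (Eventually.of_forall fun z => gain_eq_integral g f z)
    _ = ∫ q, collDensity g f q ∂((volume : Measure Phase).prod collMeasure) := by
        conv_rhs => rw [← measurePreserving_collFlip.map_eq]
        exact (integral_map measurePreserving_collFlip.measurable.aemeasurable
          (stronglyMeasurable_collDensity g f).aestronglyMeasurable).symm
    _ = ∫ z, loss g f z := by
        rw [integral_prod _ hdensity]
        simp only [collDensity, loss, collRate, integral_const_mul]

end IsBackground

end Gain

/-! ### The weighted norm -/

lemma measurable_enorm_mul {α : Type*} [MeasurableSpace α] {μ : Measure α} {p : ℝ≥0∞}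
    {w : α → ℝ≥0∞} (hw : Measurable w) (f : Lp ℝ p μ) : Measurable fun z => ‖f z‖ₑ * w z :=
  (Lp.stronglyMeasurable f).measurable.enorm.mul hw

lemma lowerSemicontinuous_lintegral_enorm_mul {α : Type*} [MeasurableSpace α] {μ : Measure α}
    {p : ℝ≥0∞} [Fact (1 ≤ p)] {w : α → ℝ≥0∞} (hw : Measurable w) (hwtop : ∀ z, w z ≠ ⊤) :
    LowerSemicontinuous fun f : Lp ℝ p μ => ∫⁻ z, ‖f z‖ₑ * w z ∂μ := by
  rw [lowerSemicontinuous_iff_isClosed_preimage]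
  refine fun c => IsSeqClosed.isClosed fun f f₀ hf hlim => ?_
  obtain ⟨ns, _, hns⟩ := (tendstoInMeasure_of_tendsto_Lp hlim).exists_seq_tendsto_ae
  have hfatou : ∫⁻ z, ‖f₀ z‖ₑ * w z ∂μ
      ≤ liminf (fun i => ∫⁻ z, ‖f (ns i) z‖ₑ * w z ∂μ) atTop := by
    refine (lintegral_mono_ae ?_).trans
      (lintegral_liminf_le fun i => measurable_enorm_mul hw (f (ns i)))
    filter_upwards [hns] with z hz
    exact (ENNReal.Tendsto.mul_const hz.enorm (Or.inr (hwtop z))).liminf_eq.ge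
  exact hfatou.trans (liminf_le_of_frequently_le' (Frequently.of_forall fun i => hf (ns i)))

lemma isLscSeminorm_lintegral_enorm_mul {α : Type*} [MeasurableSpace α] {μ : Measure α}
    {p : ℝ≥0∞} [Fact (1 ≤ p)] {w : α → ℝ≥0∞} (hw : Measurable w) (hwtop : ∀ z, w z ≠ ⊤) :
    IsLscSeminorm fun f : Lp ℝ p μ => ∫⁻ z, ‖f z‖ₑ * w z ∂μ where
  add_le f f' := by
    rw [← lintegral_add_left (measurable_enorm_mul hw f)]
    refine lintegral_mono_ae ?_
    filter_upwards [Lp.coeFn_add f f'] with z hz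
    rw [hz, Pi.add_apply, ← add_mul]
    gcongr
    exact enorm_add_le _ _
  smul_le r f := by
    rw [← lintegral_const_mul _ (measurable_enorm_mul hw f)]
    refine lintegral_mono_ae ?_
    filter_upwards [Lp.coeFn_smul r f] with z hz
    rw [hz, Pi.smul_apply, smul_eq_mul, enorm_mul, Real.enorm_eq_ofReal_abs, mul_assoc]
  lsc := lowerSemicontinuous_lintegral_enorm_mul hw hwtop

/-- The extended norm `∫ |f| (1 + |v|)`. -/
def weightNorm (f : L1Phase) : ℝ≥0∞ := ∫⁻ z, ‖f z‖ₑ * ENNReal.ofReal (1 + ‖z.2‖)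

lemma isLscSeminorm_weightNorm : IsLscSeminorm weightNorm :=
  isLscSeminorm_lintegral_enorm_mul (by fun_prop) fun _ => ENNReal.ofReal_ne_top

lemma enorm_le_weightNorm (f : L1Phase) : ‖f‖ₑ ≤ weightNorm f := by
  rw [enorm_eq_lintegral]
  exact lintegral_mono fun z => le_mul_of_one_le_right zero_le
    (ENNReal.one_le_ofReal.2 (le_add_of_nonneg_right (norm_nonneg z.2)))

lemma weightNorm_lt_top_iff (f : L1Phase) :
    weightNorm f < ⊤ ↔ Integrable fun z : Phase => f z * (1 + ‖z.2‖) := by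
  have hmeas : Measurable fun z : Phase => f z * (1 + ‖z.2‖) :=
    (Lp.stronglyMeasurable f).measurable.mul (by fun_prop)
  have heq : ∫⁻ z : Phase, ‖f z * (1 + ‖z.2‖)‖ₑ = weightNorm f := by
    refine lintegral_congr fun z => ?_
    rw [enorm_mul, Real.enorm_of_nonneg (r := 1 + ‖z.2‖) (by positivity)]
  rw [← heq]
  exact (and_iff_right hmeas.aestronglyMeasurable).symm

lemma dense_weightNorm_lt_top : Dense {f : L1Phase | weightNorm f < ⊤} := by
  refine fun f => Metric.mem_closure_iff.2 fun ε hε => ?_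
  have : IsLocallyFiniteMeasure (volume : Measure Phase) :=
    inferInstanceAs (IsLocallyFiniteMeasure
      ((volume : Measure Torus).prod (volume : Measure Vel)))
  obtain ⟨h, hs, hle, hc, hi⟩ := (L1.integrable_coeFn f).exists_hasCompactSupport_integral_sub_le
    (half_pos hε)
  refine ⟨hi.toL1 h, (weightNorm_lt_top_iff _).2 ?_, ?_⟩
  · have hcont : Continuous fun z : Phase => h z * (1 + ‖z.2‖) := by fun_prop
    refine (hcont.integrable_of_hasCompactSupport hs.mul_right).congr ?_
    filter_upwards [hi.coeFn_toL1] with z hz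
    rw [hz]
  · rw [dist_eq_norm, L1.norm_eq_integral_norm]
    refine (integral_congr_ae ?_).trans_le hle |>.trans_lt (half_lt_self hε)
    filter_upwards [Lp.coeFn_sub f (hi.toL1 h), hi.coeFn_toL1] with z hsub hz
    rw [hsub, Pi.sub_apply, hz]

lemma IsBackground.integrable_loss {g : L1Vel} {f : L1Phase} (hg : IsBackground g)
    (hf : weightNorm f < ⊤) : Integrable (loss g f) := by
  refine (((weightNorm_lt_top_iff f).1 hf).norm.const_mul (2 * collMoment g)).mono'
    ((Lp.stronglyMeasurable f).measurable.mul
      ((measurable_collRate g).comp measurable_snd)).aestronglyMeasurable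
    (Eventually.of_forall fun z => ?_)
  rw [loss, norm_mul, norm_mul, Real.norm_of_nonneg (collRate_nonneg hg.nonneg _),
    Real.norm_of_nonneg (r := 1 + ‖z.2‖) (by positivity)]
  linear_combination mul_le_mul_of_nonneg_left (hg.collRate_le z.2) (norm_nonneg (f z))

/-! ### The linear Boltzmann operator -/

lemma enorm_eq_lintegral_of_ae_eq {f : L1Phase} {F : Phase → ℝ} (h : f =ᵐ[volume] F) :
    ‖f‖ₑ = ∫⁻ z, ‖F z‖ₑ := by
  rw [enorm_eq_lintegral]
  exact lintegral_congr_ae (h.fun_comp enorm)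

lemma weightNorm_eq_lintegral_of_ae_eq {f : L1Phase} {F : Phase → ℝ} (h : f =ᵐ[volume] F) :
    weightNorm f = ∫⁻ z, ‖F z‖ₑ * ENNReal.ofReal (1 + ‖z.2‖) :=
  lintegral_congr_ae ((h.fun_comp enorm).mul EventuallyEq.rfl)

/-- The total mass `∫ f`, as a continuous linear functional. -/
def mass : L1Phase →L[ℝ] ℝ := L1.integralCLM

lemma mass_apply (f : L1Phase) : mass f = ∫ z, f z := by
  rw [← L1.integral_eq_integral, L1.integral_eq]
  rfl

instance posSMulMono_Lp {α : Type*} [MeasurableSpace α] {μ : Measure α} {p : ℝ≥0∞} :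
    PosSMulMono ℝ (Lp ℝ p μ) :=
  .of_smul_nonneg fun r hr f hf => by
    rw [← Lp.coeFn_nonneg]
    filter_upwards [Lp.coeFn_smul r f, (Lp.coeFn_nonneg f).2 hf] with z hsmul hz
    rw [hsmul]
    exact mul_nonneg hr hz

lemma lintegral_lossResolvent_add_le {g : L1Vel} {lam : ℝ} (hσ : Measurable (collRate g))
    (hσ0 : ∀ v, 0 ≤ collRate g v) (hlam : 0 < lam) (h : L1Phase) {Φ : Vel → ℝ≥0∞}
    (hΦ : Measurable Φ) :
    ENNReal.ofReal lam * (∫⁻ z, ‖lossResolvent lam hσ hσ0 hlam h z‖ₑ * Φ z.2)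
        + ∫⁻ z, ‖lossResolvent lam hσ hσ0 hlam h z‖ₑ * (ENNReal.ofReal (collRate g z.2) * Φ z.2)
      ≤ ∫⁻ z, ‖h z‖ₑ * Φ z.2 := by
  have hmeas : Measurable fun z : Phase => ‖lossResolvent lam hσ hσ0 hlam h z‖ₑ * Φ z.2 :=
    measurable_enorm_mul (hΦ.comp measurable_snd) _
  rw [← lintegral_const_mul _ hmeas, ← lintegral_add_left (hmeas.const_mul _)]
  refine (lintegral_congr fun z => ?_).trans_le (lintegral_streamResolventL1_mul_rate_le
    (hσ.const_add lam) hlam (fun v => le_add_of_nonneg_right (hσ0 v)) h hΦ)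
  rw [ENNReal.ofReal_add hlam.le (hσ0 _), lossResolvent]
  ring

namespace IsBackground

variable {g : L1Vel} {lam : ℝ}

/-- The resolvent `(λ - A)⁻¹`. -/
def resolventA (hg : IsBackground g) (hlam : 0 < lam) : L1Phase →L[ℝ] L1Phase :=
  lossResolvent lam (measurable_collRate g) (collRate_nonneg hg.nonneg) hlam

lemma integrable_loss_resolventA (hg : IsBackground g) (hlam : 0 < lam) (h : L1Phase) :
    Integrable (loss g (hg.resolventA hlam h)) :=
  integrable_loss_lossResolvent _ _ hlam h

lemma gainIntegrable_resolventA (hg : IsBackground g) (hlam : 0 < lam) (h : L1Phase) :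
    GainIntegrable g (hg.resolventA hlam h) :=
  hg.gainIntegrable (hg.integrable_loss_resolventA hlam h)

lemma norm_resolventA_add_le (hg : IsBackground g) (hlam : 0 < lam) (h : L1Phase) :
    lam * ‖hg.resolventA hlam h‖ + ‖(hg.gainIntegrable_resolventA hlam h).toL1‖ ≤ ‖h‖ := by
  have henorm : ENNReal.ofReal lam * ‖hg.resolventA hlam h‖ₑ
      + ‖(hg.gainIntegrable_resolventA hlam h).toL1‖ₑ ≤ ‖h‖ₑ := by
    have hrate := lintegral_lossResolvent_add_le (measurable_collRate g)
      (collRate_nonneg hg.nonneg) hlam h (Φ := fun _ => 1) measurable_const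
    simp only [mul_one, ← enorm_eq_lintegral] at hrate
    rw [enorm_eq_lintegral_of_ae_eq (hg.gainIntegrable_resolventA hlam h).coeFn_toL1]
    exact (add_le_add le_rfl (hg.lintegral_gain_le _)).trans hrate
  rwa [← ofReal_norm, ← ofReal_norm, ← ofReal_norm, ← ENNReal.ofReal_mul hlam.le,
    ← ENNReal.ofReal_add (by positivity) (norm_nonneg _),
    ENNReal.ofReal_le_ofReal_iff (norm_nonneg _)] at henorm

/-- The everywhere defined contraction `B (λ - A)⁻¹`. -/
def gainResolventA (hg : IsBackground g) (hlam : 0 < lam) : L1Phase →L[ℝ] L1Phase :=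
  LinearMap.mkContinuous
    ((opB g).toFun ∘ₗ (hg.resolventA hlam : L1Phase →ₗ[ℝ] L1Phase).codRestrict (opB g).domain
      fun h => hg.gainIntegrable_resolventA hlam h) 1 fun h => by
    have hR : 0 ≤ lam * ‖hg.resolventA hlam h‖ := by positivity
    rw [one_mul]
    exact (le_add_of_nonneg_left hR).trans (hg.norm_resolventA_add_le hlam h)

lemma coeFn_gainResolventA (hg : IsBackground g) (hlam : 0 < lam) (h : L1Phase) :
    hg.gainResolventA hlam h =ᵐ[volume] gain g (hg.resolventA hlam h) :=
  (hg.gainIntegrable_resolventA hlam h).coeFn_toL1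

lemma resolventA_left_inv (hg : IsBackground g) (hlam : 0 < lam) {p : L1Phase × L1Phase}
    (hp : p ∈ (opA g).graph) : hg.resolventA hlam (lam • p.1 - p.2) = p.1 := by
  set R := hg.resolventA hlam (lam • p.1 - p.2)
  have hR : IsTransportLoss g R (lam • R - (lam • p.1 - p.2)) :=
    isTransportLoss_lossResolvent _ _ hlam _
  refine (sub_eq_zero.1 (eq_zero_of_isTransportLoss (measurable_collRate g)
    (collRate_nonneg hg.nonneg) hg.collRate_le hlam ?_)).symm
  convert (opA_graph.1 hp).add (hR.smul (-1)) using 1 <;> module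

lemma isKatoPair (hg : IsBackground g) (hlam : 0 < lam) :
    IsKatoPair (opA g) (opB g) lam (hg.resolventA hlam) (hg.gainResolventA hlam) where
  pos := hlam
  norm_le := hg.norm_resolventA_add_le hlam
  mem_graph h := opA_graph.2 (isTransportLoss_lossResolvent _ _ hlam h)
  left_inv _ hp := hg.resolventA_left_inv hlam hp
  mem_graph_perturbation h :=
    opB_graph.2 ⟨hg.gainIntegrable_resolventA hlam h, hg.coeFn_gainResolventA hlam h⟩

lemma weightNorm_gainResolventA_add_le (hg : IsBackground g) (hlam : 0 < lam) (h : L1Phase) :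
    weightNorm (hg.gainResolventA hlam h) + ENNReal.ofReal lam * weightNorm (hg.resolventA hlam h)
      ≤ weightNorm h + ENNReal.ofReal (4 * collMoment g) * ‖hg.resolventA hlam h‖ₑ := by
  have hrate := lintegral_lossResolvent_add_le (measurable_collRate g)
    (collRate_nonneg hg.nonneg) hlam h (Φ := fun v => ENNReal.ofReal (1 + ‖v‖)) (by fun_prop)
  rw [weightNorm_eq_lintegral_of_ae_eq (hg.coeFn_gainResolventA hlam h)]
  refine (add_le_add (hg.lintegral_gain_weight_le _) le_rfl).trans ?_
  rw [add_right_comm, add_comm (lintegral _ _)]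
  exact add_le_add hrate le_rfl

lemma enorm_gainResolventA_le (hg : IsBackground g) (hlam : 0 < lam) (h : L1Phase) :
    ‖hg.gainResolventA hlam h‖ₑ
      ≤ ENNReal.ofReal (2 * collMoment g) * weightNorm (hg.resolventA hlam h) := by
  have hC : 0 ≤ 2 * collMoment g := mul_nonneg zero_le_two (collMoment_nonneg hg.nonneg)
  rw [enorm_eq_lintegral_of_ae_eq (hg.coeFn_gainResolventA hlam h), weightNorm,
    ← lintegral_const_mul _ (measurable_enorm_mul (by fun_prop) _)]
  refine (hg.lintegral_gain_le _).trans (lintegral_mono fun z => ?_)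
  rw [mul_left_comm, ← ENNReal.ofReal_mul hC]
  gcongr
  exact hg.collRate_le z.2

lemma isLyapunov_weightNorm (hg : IsBackground g) (hlam : 0 < lam) :
    IsLyapunov weightNorm (4 * collMoment g) (2 * collMoment g) lam (hg.resolventA hlam)
      (hg.gainResolventA hlam) where
  weight_le := hg.weightNorm_gainResolventA_add_le hlam
  enorm_le := hg.enorm_gainResolventA_le hlam

lemma tendsto_gainResolventA_pow (hg : IsBackground g) (hlam : 0 < lam) (h : L1Phase) :
    Tendsto (fun n : ℕ => (hg.gainResolventA hlam ^ n) h) atTop (𝓝 0) :=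
  (hg.isLyapunov_weightNorm hlam).tendsto_pow (hg.isKatoPair hlam) dense_weightNorm_lt_top h

lemma mass_balance (hg : IsBackground g) (hlam : 0 < lam) (h : L1Phase) :
    lam * mass (hg.resolventA hlam h) + mass (hg.gainResolventA hlam h) = mass h := by
  have hloss := hg.integrable_loss_resolventA hlam h
  have hgain : mass (hg.gainResolventA hlam h) = ∫ z, loss g (hg.resolventA hlam h) z := by
    rw [mass_apply, ← hg.integral_gain hloss]
    exact integral_congr_ae (hg.coeFn_gainResolventA hlam h)
  rw [hgain, mass_apply, mass_apply, ← integral_const_mul,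
    ← integral_add ((L1.integrable_coeFn _).const_mul lam) hloss,
    ← integral_streamResolventL1_mul_rate ((measurable_collRate g).const_add lam) hlam
      (fun v => le_add_of_nonneg_right (collRate_nonneg hg.nonneg v)) h]
  refine integral_congr_ae (Eventually.of_forall fun z => ?_)
  simp only [loss, resolventA, lossResolvent]
  ring

lemma resolventA_nonneg (hg : IsBackground g) (hlam : 0 < lam) {h : L1Phase} (h0 : 0 ≤ h) :
    0 ≤ hg.resolventA hlam h :=
  streamResolventL1_nonneg _ _ _ h0

lemma gainResolventA_nonneg (hg : IsBackground g) (hlam : 0 < lam) {h : L1Phase} (h0 : 0 ≤ h) :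
    0 ≤ hg.gainResolventA hlam h := by
  rw [← Lp.coeFn_nonneg]
  filter_upwards [hg.coeFn_gainResolventA hlam h,
    gain_nonneg hg.nonneg (hg.resolventA_nonneg hlam h0)] with z hz hgain
  rwa [hz]

/-- The resolvent at `λ > 0` of the closure of `A + B`; its value for `λ ≤ 0` is irrelevant and set
to zero. -/
def resolventAdd (hg : IsBackground g) (lam : ℝ) : L1Phase →L[ℝ] L1Phase :=
  if hlam : 0 < lam then (hg.isKatoPair hlam).resolvent else 0

lemma resolventAdd_of_pos (hg : IsBackground g) (hlam : 0 < lam) :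
    hg.resolventAdd lam = (hg.isKatoPair hlam).resolvent :=
  dif_pos hlam

lemma isResolventFamily (hg : IsBackground g) :
    IsResolventFamily (opA g + opB g) hg.resolventAdd where
  norm_le lam hlam x := by
    rw [hg.resolventAdd_of_pos hlam]
    exact (hg.isKatoPair hlam).norm_resolvent_le x
  mem_closure lam hlam x := by
    rw [hg.resolventAdd_of_pos hlam]
    exact (hg.isKatoPair hlam).resolvent_mem_closure (hg.tendsto_gainResolventA_pow hlam) x
  left_inv lam hlam p hp := by
    rw [hg.resolventAdd_of_pos hlam]
    exact (hg.isKatoPair hlam).resolvent_left_inv (hg.tendsto_gainResolventA_pow hlam) hp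
  dense := dense_of_streamResolventL1_mem (measurable_collRate g) (collRate_nonneg hg.nonneg)
    fun _ hlam h => LinearPMap.mem_domain_of_mem_graph ((hg.isKatoPair hlam).mem_graph_add h)

lemma resolventAdd_nonneg (hg : IsBackground g) (hlam : 0 < lam) {f : L1Phase} (hf : 0 ≤ f) :
    0 ≤ hg.resolventAdd lam f := by
  rw [hg.resolventAdd_of_pos hlam]
  exact (hg.isKatoPair hlam).resolvent_mem (.positive ℝ _) (fun _ => hg.resolventA_nonneg hlam)
    (fun _ => hg.gainResolventA_nonneg hlam) hf

lemma mass_resolventAdd (hg : IsBackground g) (hlam : 0 < lam) (f : L1Phase) :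
    lam * mass (hg.resolventAdd lam f) = mass f := by
  rw [hg.resolventAdd_of_pos hlam]
  exact (hg.isKatoPair hlam).map_resolvent (hg.tendsto_gainResolventA_pow hlam) mass
    (hg.mass_balance hlam) f

lemma weightNorm_resolventAdd_le (hg : IsBackground g) (hlam : 0 < lam) (f : L1Phase) :
    weightNorm (hg.resolventAdd lam f)
      ≤ ENNReal.ofReal ((1 + 4 * collMoment g / lam) / lam) * weightNorm f := by
  rw [hg.resolventAdd_of_pos hlam]
  exact (hg.isLyapunov_weightNorm hlam).weight_resolvent_le (hg.isKatoPair hlam)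
    isLscSeminorm_weightNorm (mul_nonneg zero_le_four (collMoment_nonneg hg.nonneg))
    enorm_le_weightNorm f

lemma mem_graph_of_weightNorm_lt_top (hg : IsBackground g) {x y : L1Phase}
    (h : (x, y) ∈ closure ((opA g + opB g).graph : Set (L1Phase × L1Phase)))
    (hx : weightNorm x < ⊤) (hy : weightNorm y < ⊤) : (x, y) ∈ (opA g + opB g).graph := by
  have hJ := hg.isResolventFamily
  have hfix : (hg.isKatoPair one_pos).resolvent ((1 : ℝ) • x - y) = x := by
    rw [← hg.resolventAdd_of_pos one_pos]
    exact (hJ.mem_closure_iff one_pos).1 h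
  have hdom : x ∈ (opA g + opB g).domain := by
    rw [← hfix]
    exact (hg.isLyapunov_weightNorm one_pos).resolvent_mem_domain (hg.isKatoPair one_pos)
      (isLscSeminorm_weightNorm.sub_lt_top (isLscSeminorm_weightNorm.smul_lt_top 1 hx) hy)
  obtain ⟨y', hy'⟩ := LinearPMap.mem_domain_iff.1 hdom
  have hdiff := (opA g + opB g).graph.topologicalClosure.sub_mem h (subset_closure hy')
  rw [Prod.mk_sub_mk, sub_self] at hdiff
  rwa [sub_eq_zero.1 (hJ.snd_eq_zero hdiff)]

end IsBackground

/-! ### The mild solution -/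

lemma integrable_mul_one_add_norm_of_sq {f : L1Phase}
    (hf : Integrable fun z : Phase => f z * (1 + ‖z.2‖ ^ 2)) :
    Integrable fun z : Phase => f z * (1 + ‖z.2‖) := by
  have hmeas : Measurable fun z : Phase => f z * (1 + ‖z.2‖) :=
    (Lp.stronglyMeasurable f).measurable.mul (by fun_prop)
  refine (hf.norm.const_mul 2).mono' hmeas.aestronglyMeasurable
    (Eventually.of_forall fun z => ?_)
  have hle : 1 + ‖z.2‖ ≤ 2 * (1 + ‖z.2‖ ^ 2) := by nlinarith [sq_nonneg (‖z.2‖ - 1)]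
  rw [norm_mul, norm_mul, Real.norm_of_nonneg (r := 1 + ‖z.2‖) (by positivity),
    Real.norm_of_nonneg (r := 1 + ‖z.2‖ ^ 2) (by positivity), mul_left_comm]
  gcongr

lemma isMildSolution_of_mem_graph {L : L1Phase →ₗ.[ℝ] L1Phase} {u₀ : L1Phase} {T : ℝ}
    {u : ℝ → L1Phase} (hu : IntegrableOn u (Icc 0 T))
    (hmem : ∀ t ∈ Icc 0 T, (∫ s in (0 : ℝ)..t, u s, u t - u₀) ∈ L.graph) :
    IsMildSolution L u₀ T u where
  integrable := hu
  mild t ht :=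
    ⟨LinearPMap.mem_domain_of_mem_graph (hmem t ht), ((LinearPMap.image_iff _).2 (hmem t ht)).symm⟩

lemma mem_graph_of_isMildSolution {L : L1Phase →ₗ.[ℝ] L1Phase} {u₀ : L1Phase} {T : ℝ}
    {u : ℝ → L1Phase} (hu : IsMildSolution L u₀ T u) {t : ℝ} (ht : t ∈ Icc 0 T) :
    (∫ s in (0 : ℝ)..t, u s, u t - u₀) ∈ L.graph := by
  obtain ⟨hdom, heq⟩ := hu.mild t ht
  rw [← heq]
  exact L.mem_graph ⟨_, hdom⟩

lemma IsResolventFamily.eqOn_semigroup {L : L1Phase →ₗ.[ℝ] L1Phase}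
    {J : ℝ → L1Phase →L[ℝ] L1Phase} (hJ : IsResolventFamily L J) {u₀ : L1Phase} {T : ℝ}
    {u : ℝ → L1Phase} (hu : IsMildSolution L.closure u₀ T u) :
    EqOn u (fun t => semigroup J t u₀) (Icc 0 T) := by
  have hint : IntegrableOn (fun t => semigroup J t u₀) (Icc 0 T) :=
    ((hJ.continuousOn_semigroup u₀).mono Icc_subset_Ici_self).integrableOn_Icc
  intro t ht
  refine sub_eq_zero.1 (hJ.eq_zero_of_integral_mem_closure (hu.integrable.sub hint)
    (fun s hs => ?_) t ht)
  have hmem := L.graph.topologicalClosure.sub_mem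
    (hJ.mem_graph_closure_iff.1 (mem_graph_of_isMildSolution hu hs))
    (hJ.integral_semigroup_mem_closure hs.1 u₀)
  rwa [Prod.mk_sub_mk, sub_sub_sub_cancel_right, ← intervalIntegral.integral_sub
    (intervalIntegrable_of_integrableOn_Icc hu.integrable hs)
    (intervalIntegrable_of_integrableOn_Icc hint hs)] at hmem

namespace IsBackground

variable {g : L1Vel} {f₀ : L1Phase} {t : ℝ}

lemma semigroup_nonneg (hg : IsBackground g) (ht : 0 ≤ t) (hf : 0 ≤ f₀) :
    0 ≤ semigroup hg.resolventAdd t f₀ :=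
  hg.isResolventFamily.semigroup_mem (.positive ℝ _)
    (fun _ hlam _ => hg.resolventAdd_nonneg hlam) ht hf

lemma integral_semigroup (hg : IsBackground g) (ht : 0 ≤ t) (f₀ : L1Phase) :
    ∫ z, semigroup hg.resolventAdd t f₀ z = ∫ z, f₀ z := by
  rw [← mass_apply, ← mass_apply]
  exact hg.isResolventFamily.map_semigroup mass (fun _ hlam => hg.mass_resolventAdd hlam) ht f₀

lemma weightNorm_semigroup_le (hg : IsBackground g) (ht : 0 ≤ t) (f₀ : L1Phase) :
    weightNorm (semigroup hg.resolventAdd t f₀)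
      ≤ ENNReal.ofReal (Real.exp (t * (4 * collMoment g))) * weightNorm f₀ :=
  isLscSeminorm_weightNorm.semigroup_le hg.isResolventFamily
    (mul_nonneg zero_le_four (collMoment_nonneg hg.nonneg))
    (fun _ hlam => hg.weightNorm_resolventAdd_le hlam) ht f₀

lemma weightNorm_semigroup_lt_top (hg : IsBackground g) (ht : 0 ≤ t) (hf : weightNorm f₀ < ⊤) :
    weightNorm (semigroup hg.resolventAdd t f₀) < ⊤ :=
  (hg.weightNorm_semigroup_le ht f₀).trans_lt (ENNReal.mul_lt_top ENNReal.ofReal_lt_top hf)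

lemma weightNorm_integral_semigroup_lt_top (hg : IsBackground g) (ht : 0 ≤ t)
    (hf : weightNorm f₀ < ⊤) :
    weightNorm (∫ s in (0 : ℝ)..t, semigroup hg.resolventAdd s f₀) < ⊤ := by
  have hC := collMoment_nonneg hg.nonneg
  have hint : IntegrableOn (fun s => semigroup hg.resolventAdd s f₀) (Ioc 0 t) :=
    ((hg.isResolventFamily.continuousOn_semigroup f₀).mono
      Icc_subset_Ici_self).integrableOn_Icc.mono_set Ioc_subset_Icc_self
  refine isLscSeminorm_weightNorm.intervalIntegral_lt_top ht hint
    (c := ENNReal.ofReal (Real.exp (t * (4 * collMoment g))) * weightNorm f₀)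
    (ENNReal.mul_lt_top ENNReal.ofReal_lt_top hf)
    fun s hs => (hg.weightNorm_semigroup_le hs.1.le f₀).trans ?_
  gcongr
  exact hs.2

lemma isMildSolution_semigroup (hg : IsBackground g) (hf : weightNorm f₀ < ⊤) (T : ℝ) :
    IsMildSolution (opA g + opB g) f₀ T (fun t => semigroup hg.resolventAdd t f₀) :=
  isMildSolution_of_mem_graph
    ((hg.isResolventFamily.continuousOn_semigroup f₀).mono Icc_subset_Ici_self).integrableOn_Icc
    fun _ ht => hg.mem_graph_of_weightNorm_lt_top
      (hg.isResolventFamily.integral_semigroup_mem_closure ht.1 f₀)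
      (hg.weightNorm_integral_semigroup_lt_top ht.1 hf)
      (isLscSeminorm_weightNorm.sub_lt_top (hg.weightNorm_semigroup_lt_top ht.1 hf) hf)

lemma semigroup_mem_domain_opB (hg : IsBackground g) (ht : 0 ≤ t) (hf : weightNorm f₀ < ⊤) :
    semigroup hg.resolventAdd t f₀ ∈ (opB g).domain :=
  hg.gainIntegrable (hg.integrable_loss (hg.weightNorm_semigroup_lt_top ht hf))

end IsBackground

end LinBoltz

end

theorem proposition3p4_general {f₀ : LinBoltz.L1Phase} {g₀ : LinBoltz.L1Vel} (hg0 : 0 ≤ g₀)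
    (hg : Integrable (fun v : LinBoltz.Vel => g₀ v * (1 + ‖v‖ ^ 2)))
    (hf : Integrable (fun z : LinBoltz.Phase => f₀ z * (1 + ‖z.2‖))) :
    (LinBoltz.opA g₀ + LinBoltz.opB g₀).IsClosable ∧
    ∃ f : ℝ → LinBoltz.L1Phase,
      ContinuousOn f (Ici 0) ∧
      (∀ T, LinBoltz.IsMildSolution (LinBoltz.opA g₀ + LinBoltz.opB g₀) f₀ T f ∧
        ∀ u : ℝ → LinBoltz.L1Phase,
          LinBoltz.IsMildSolution (LinBoltz.opA g₀ + LinBoltz.opB g₀).closure f₀ T u →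
            EqOn u f (Icc 0 T)) ∧
      ∀ t, 0 ≤ t →
        (0 ≤ f₀ → 0 ≤ f t) ∧
        ∫ z, f t z = ∫ z, f₀ z ∧
        Integrable (fun z : LinBoltz.Phase => f t z * (1 + ‖z.2‖)) ∧
        f t ∈ (LinBoltz.opB g₀).domain := by
  have hbg : LinBoltz.IsBackground g₀ := ⟨hg0, hg⟩
  have hw : LinBoltz.weightNorm f₀ < ⊤ := (LinBoltz.weightNorm_lt_top_iff f₀).2 hf
  have hJ := hbg.isResolventFamily
  exact ⟨hJ.isClosable, fun t => LinBoltz.semigroup hbg.resolventAdd t f₀,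
    hJ.continuousOn_semigroup f₀,
    fun T => ⟨hbg.isMildSolution_semigroup hw T, fun _ hu => hJ.eqOn_semigroup hu⟩,
    fun t ht => ⟨hbg.semigroup_nonneg ht, hbg.integral_semigroup ht f₀,
      (LinBoltz.weightNorm_lt_top_iff _).1 (hbg.weightNorm_semigroup_lt_top ht hw),
      hbg.semigroup_mem_domain_opB ht hw⟩⟩

theorem proposition3p4 (T : ℝ) (hT : 0 < T) (η : ℝ) (hη : 0 < η)
    (f₀ : LinBoltz.L1Phase) (g₀ : LinBoltz.L1Vel) (h : LinBoltz.Admissible η f₀ g₀) :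
    (LinBoltz.opA g₀ + LinBoltz.opB g₀).IsClosable ∧
    ∃ f : ℝ → LinBoltz.L1Phase,
      LinBoltz.IsMildSolution (LinBoltz.opA g₀ + LinBoltz.opB g₀) f₀ T f ∧
      (∀ u : ℝ → LinBoltz.L1Phase,
        LinBoltz.IsMildSolution (LinBoltz.opA g₀ + LinBoltz.opB g₀).closure f₀ T u →
          Set.EqOn u f (Set.Icc 0 T)) ∧
      ContinuousOn f (Set.Icc 0 T) ∧
      ∀ t ∈ Set.Icc 0 T,
        0 ≤ f t ∧
        ∫ z, f t z = 1 ∧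
        Integrable (fun z : LinBoltz.Phase => f t z * (1 + ‖z.2‖)) volume ∧
        f t ∈ (LinBoltz.opB g₀).domain := by
  obtain ⟨hclosable, f, hcont, hmild, hprop⟩ := proposition3p4_general h.g_nonneg h.g_moment
    (LinBoltz.integrable_mul_one_add_norm_of_sq h.f_moment)
  exact ⟨hclosable, f, (hmild T).1, (hmild T).2, hcont.mono Icc_subset_Ici_self,
    fun t ht => (hprop t ht.1).imp (fun h0 => h0 h.f_nonneg)
      fun hrest => ⟨hrest.1.trans h.f_mass, hrest.2⟩⟩
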